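/- For $k\in\mathbb Z$ and $z\in\mathbb C$ let $J_k(z)$ be the Bessel function of the first kind of integer order, i.e. $J_k(z)=\sum_{m\ge 0}\frac{(-1)^m}{m!\,(m+k)!}\left(\frac z2\right)^{2m+k}$ for $k\ge 0$ and $J_{k}(z)=(-1)^{k}J_{-k}(z)$ for $k<0$. For $\theta\in\mathbb C$ and integers $x\ne y$ let $$J(x,y,\theta^2)=\theta\,\frac{J_x(2\theta)J_{y+1}(2\theta)-J_{x+1}(2\theta)J_y(2\theta)}{x-y}$$ be the discrete Bessel kernel. There is a constant $\gamma>0$ such that for all $a,b\in(-2,2)$ and all sequences of integers $(x_n)$, $(y_n)$ with $\lim_{n\to\infty}x_n/\sqrt n=a$, $\lim_{n\to\infty}y_n/\sqrt n=b$ and $\lim_{n\to\infty}(y_n-x_n)=+\infty$ the following holds. For all $n$, all $\theta\in\mathbb C$ and all integers $i\in[x_n,y_n]$ the series $\sum_{j\in\mathbb Z,\,j\notin[x_n,y_n]}J(i,j,\theta^2)^2$ converges absolutely, and $$\sup_{\theta\in\mathbb C}\left|\frac{\sum_{i\in\mathbb Z\cap[x_n,y_n]}\ \sum_{j\in\mathbb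 Z\setminus[x_n,y_n]}J(i,j,\theta^2)^2}{\log(y_n-x_n)}-\frac1{\pi^2}\right|\exp\left(-\gamma\left|\sqrt n-\theta\right|\right)\longrightarrow 0\qquad(n\to\infty).$$ -/

import Mathlib

/-- The Bessel function `J_k(z)` of the first kind, of integer order `k` and complex argument `z`:
the power series `∑_{m ≥ 0} (-1)^m / (m! (m+k)!) (z/2)^(2m+k)` for `k ≥ 0`, and
`J_k(z) = (-1)^|k| J_{|k|}(z)` for `k < 0`. -/
noncomputable def besselJ (k : ℤ) (z : ℂ) : ℂ :=
  (if 0 ≤ k then 1 else (-1) ^ k.natAbs) *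
    ∑' m : ℕ, (-1) ^ m / ((m.factorial : ℂ) * ((m + k.natAbs).factorial : ℂ)) *
      (z / 2) ^ (2 * m + k.natAbs)

/-- The discrete Bessel kernel `J(x, y, θ²)` on `ℤ × ℤ`, as a function of `θ`.  On the diagonal,
where the quotient reads `0 / 0`, it takes its usual value `∑_{k ≥ 1} J_{x+k}(2θ)²`. -/
noncomputable def besselKernel (x y : ℤ) (θ : ℂ) : ℂ :=
  if x = y then ∑' k : ℕ, besselJ (x + k + 1) (2 * θ) ^ 2
  else θ * (besselJ x (2 * θ) * besselJ (y + 1) (2 * θ) -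
    besselJ (x + 1) (2 * θ) * besselJ y (2 * θ)) / ((x : ℂ) - (y : ℂ))

/-- The double sum `∑_{i ∈ [x, y]} ∑_{j ∉ [x, y]} J(i, j, θ²)²` over integers `i` and `j`. -/
noncomputable def poissonizedVariance (x y : ℤ) (θ : ℂ) : ℂ :=
  ∑ i ∈ Finset.Icc x y, ∑' j : {j : ℤ // j ∉ Finset.Icc x y}, besselKernel i j θ ^ 2

/-! Write V(θ) for `poissonizedVariance x y θ`, and r = √n. Two separate estimates prove the
theorem: V barely changes between r and a complex θ, and V(r) has the stated logarithmic growth.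

Complex θ. Off the diagonal, the θ-derivative of J(i, j, θ²) is the rank-two expression J_i J_{j+1}
+ J_{i+1} J_j (all arguments 2θ). So V' consists of two values of the bilinear form of the kernel on
Bessel sequences. Since J(i, j, θ²) = ∑_{k ≥ 1} J_{i+k} J_{j+k}, that form is controlled by
convolutions with symbol exp(θ(t - 1/t)), whose modulus on the unit circle is at most exp(2|Im θ|).
This gives a derivative bound 4 exp(8|Im θ|) that does not depend on the interval
(`norm_poissonizedVariance_sub_le`). Division by the logarithm makes the change negligible.

Real θ. Only the three-term recurrence and the two ℓ² identities of `IsBesselSeq` are used. In the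
bulk |k| ≤ (2 - δ)θ the recurrence is an oscillator whose parameter c = k/θ varies slowly. Its
energy E_k divided by √(4 - c²) is almost constant (`exists_abs_energy_mul_sub_le`), and the ℓ²
identities fix the constant: θ E_k ≈ √(4 - c²)/(2π). For fixed j the numerator v_i = (i - j) J(i, j,
θ²) solves the same recurrence up to O(1/θ), so v_i² is 1/(2π²) plus a bounded telescoping term plus
a small error (`exists_wronskian_sq_expansion`). Exactly e pairs at distance e straddle a given end
point, so the weight 1/e² leaves (1/(2π²)) ∑ 1/e per end point, and the two end points give log(y -
x)/π². Distances beyond a fixed small fraction of y - x contribute O(1). -/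

/-! ### Bessel functions as coefficients of exp(θt) exp(-θ/t). -/

/-- The `p`-th Taylor coefficient `θ ^ p / p!` of `t ↦ exp (θ t)`, extended by zero to `p < 0`. -/
noncomputable def expCoeff (θ : ℂ) (p : ℤ) : ℂ :=
  if p < 0 then 0 else θ ^ p.toNat / (p.toNat.factorial : ℂ)

theorem expCoeff_natCast (θ : ℂ) (n : ℕ) : expCoeff θ n = θ ^ n / (n.factorial : ℂ) := by
  simp [expCoeff]

theorem expCoeff_of_neg (θ : ℂ) {p : ℤ} (hp : p < 0) : expCoeff θ p = 0 := by
  simp [expCoeff, hp]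

theorem intCast_mul_expCoeff (θ : ℂ) (p : ℤ) :
    (p : ℂ) * expCoeff θ p = θ * expCoeff θ (p - 1) := by
  rcases lt_trichotomy p 0 with h | h | h
  · rw [expCoeff_of_neg θ h, expCoeff_of_neg θ (by omega)]; simp
  · subst h; rw [expCoeff_of_neg θ (by norm_num : (0 - 1 : ℤ) < 0)]; simp
  · obtain ⟨n, rfl⟩ : ∃ n : ℕ, p = n + 1 := ⟨(p - 1).toNat, by omega⟩
    have h1 : ((n : ℤ) + 1 - 1) = n := by ring
    have h2 : ((n : ℤ) + 1) = ((n + 1 : ℕ) : ℤ) := by push_cast; ring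
    rw [h1, expCoeff_natCast, h2, expCoeff_natCast, Nat.factorial_succ]
    have : (n.factorial : ℂ) ≠ 0 := by exact_mod_cast n.factorial_ne_zero
    have : (n : ℂ) + 1 ≠ 0 := by exact_mod_cast n.succ_ne_zero
    push_cast
    field_simp
    ring

theorem norm_expCoeff_le {θ η : ℂ} (h : ‖θ‖ ≤ ‖η‖) (p : ℤ) : ‖expCoeff θ p‖ ≤ ‖expCoeff η p‖ := by
  unfold expCoeff
  split_ifs
  · simp
  · rw [norm_div, norm_div, norm_pow, norm_pow]
    gcongr

theorem hasDerivAt_expCoeff (θ : ℂ) (p : ℤ) :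
    HasDerivAt (fun z => expCoeff z p) (expCoeff θ (p - 1)) θ := by
  rcases lt_trichotomy p 0 with h | h | h
  · simp only [expCoeff_of_neg _ h, expCoeff_of_neg _ (show p - 1 < 0 by omega)]
    exact hasDerivAt_const _ _
  · subst h
    rw [expCoeff_of_neg θ (by norm_num : (0 - 1 : ℤ) < 0)]
    simpa [expCoeff] using hasDerivAt_const θ (1 : ℂ)
  · obtain ⟨n, rfl⟩ : ∃ n : ℕ, p = n + 1 := ⟨(p - 1).toNat, by omega⟩
    have h1 : ((n : ℤ) + 1 - 1) = n := by ring
    have h2 : ((n : ℤ) + 1) = ((n + 1 : ℕ) : ℤ) := by push_cast; ring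
    rw [h1, h2]
    simp only [expCoeff_natCast]
    have := (hasDerivAt_pow (n + 1) θ).div_const ((n + 1).factorial : ℂ)
    refine this.congr_deriv ?_
    rw [Nat.factorial_succ]
    have : (n.factorial : ℂ) ≠ 0 := by exact_mod_cast n.factorial_ne_zero
    have : (n : ℂ) + 1 ≠ 0 := by exact_mod_cast n.succ_ne_zero
    push_cast
    field_simp

theorem expCoeff_mul_zpow (θ : ℂ) {t : ℂ} (p : ℤ) :
    expCoeff θ p * t ^ p = expCoeff (θ * t) p := by
  unfold expCoeff
  split_ifs with h
  · simp
  · have : t ^ p = t ^ p.toNat := by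
      conv_lhs => rw [← Int.toNat_of_nonneg (not_lt.1 h)]
      exact zpow_natCast _ _
    rw [this, mul_pow]; ring

theorem hasSum_expCoeff (θ : ℂ) : HasSum (expCoeff θ) (Complex.exp θ) := by
  have h : HasSum (fun n : ℕ => expCoeff θ n) (Complex.exp θ) := by
    simp only [expCoeff_natCast]
    rw [Complex.exp_eq_exp_ℂ]
    exact NormedSpace.expSeries_div_hasSum_exp θ
  refine (Function.Injective.hasSum_iff (g := fun n : ℕ => (n : ℤ)) Nat.cast_injective ?_).1 h
  intro p hp
  apply expCoeff_of_neg
  by_contra hc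
  exact hp ⟨p.toNat, Int.toNat_of_nonneg (not_lt.1 hc)⟩

theorem summable_norm_expCoeff (θ : ℂ) : Summable fun p => ‖expCoeff θ p‖ :=
  (hasSum_expCoeff θ).summable.norm

theorem summable_norm_expCoeff_mul (θ η : ℂ) :
    Summable fun x : ℤ × ℤ => ‖expCoeff θ x.1 * expCoeff η x.2‖ := by
  have := (summable_norm_expCoeff θ).mul_of_nonneg (summable_norm_expCoeff η)
    (fun _ => norm_nonneg _) (fun _ => norm_nonneg _)
  simpa only [norm_mul] using this

/-- The shear `(k, q) ↦ (q + k, q)` of `ℤ × ℤ`. -/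
def intShear : ℤ × ℤ ≃ ℤ × ℤ where
  toFun x := (x.2 + x.1, x.2)
  invFun x := (x.1 - x.2, x.2)
  left_inv x := by simp
  right_inv x := by simp

theorem summable_norm_expCoeff_shear (θ η : ℂ) :
    Summable fun x : ℤ × ℤ => ‖expCoeff θ (x.2 + x.1) * expCoeff η x.2‖ :=
  (intShear.summable_iff (f := fun x : ℤ × ℤ => ‖expCoeff θ x.1 * expCoeff η x.2‖)).2
    (summable_norm_expCoeff_mul θ η)

theorem summable_norm_expCoeff_add_mul (θ η : ℂ) (k l : ℤ) :
    Summable fun q : ℤ => ‖expCoeff θ (q + k) * expCoeff η (q + l)‖ := by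
  have h := (summable_norm_expCoeff_shear θ η).prod_factor (k - l)
  have := ((Equiv.addRight l).summable_iff
    (f := fun q : ℤ => ‖expCoeff θ (q + (k - l)) * expCoeff η q‖)).2 h
  refine this.congr fun q => ?_
  simp [add_assoc]

theorem summable_expCoeff_add_mul (θ η : ℂ) (k l : ℤ) :
    Summable fun q : ℤ => expCoeff θ (q + k) * expCoeff η (q + l) :=
  (summable_norm_expCoeff_add_mul θ η k l).of_norm

/-- This is the coefficient of t^k in exp(θt) exp(-θ/t). Because `expCoeff` vanishes at negative
indices, one bilateral series serves both signs of k, and later identities need no case split. -/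
theorem besselJ_two_mul (k : ℤ) (θ : ℂ) :
    besselJ k (2 * θ) = ∑' q : ℤ, expCoeff θ (q + k) * expCoeff (-θ) q := by
  have hz : 2 * θ / 2 = θ := by ring
  unfold besselJ
  rw [hz, ← tsum_mul_left]
  -- The first q with both q and q + k nonnegative is max(0, -k).
  have hinj : Function.Injective (fun m : ℕ => (m : ℤ) + (-k).toNat) := by
    intro a b h
    simpa using h
  rw [← hinj.tsum_eq (f := fun q : ℤ => expCoeff θ (q + k) * expCoeff (-θ) q)]
  · refine tsum_congr fun m => ?_
    rcases le_or_gt 0 k with h | h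
    · obtain ⟨n, rfl⟩ := Int.eq_ofNat_of_zero_le h
      have h1 : ((-(n : ℤ)).toNat : ℤ) = 0 := by simp
      rw [h1, add_zero, ← Nat.cast_add, expCoeff_natCast, expCoeff_natCast, if_pos h,
        Int.natAbs_natCast, neg_pow]
      field_simp
      ring
    · obtain ⟨n, rfl⟩ : ∃ n : ℕ, k = -n := ⟨k.natAbs, by omega⟩
      have h1 : ((- -(n : ℤ)).toNat : ℤ) = n := by simp
      have h2 : (m : ℤ) + n + -(n : ℤ) = m := by ring
      rw [h1, h2, ← Nat.cast_add, expCoeff_natCast, expCoeff_natCast, if_neg (not_le.2 h),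
        Int.natAbs_neg, Int.natAbs_natCast, neg_pow]
      field_simp
      ring
  · intro q hq
    rw [Function.mem_support] at hq
    have h1 : 0 ≤ q := by
      by_contra hc
      exact hq (by rw [expCoeff_of_neg (-θ) (not_le.1 hc), mul_zero])
    have h2 : 0 ≤ q + k := by
      by_contra hc
      exact hq (by rw [expCoeff_of_neg θ (not_le.1 hc), zero_mul])
    exact ⟨(q - (-k).toNat).toNat, by simp only; omega⟩

/-- Coefficientwise, write k = (q + k) - q and let each factor absorb its own index through
`intCast_mul_expCoeff`. -/
theorem besselJ_recurrence (k : ℤ) (θ : ℂ) :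
    θ * (besselJ (k - 1) (2 * θ) + besselJ (k + 1) (2 * θ)) = k * besselJ k (2 * θ) := by
  have h1 : besselJ (k + 1) (2 * θ) =
      ∑' q : ℤ, expCoeff θ (q + k) * expCoeff (-θ) (q - 1) := by
    rw [besselJ_two_mul, ← (Equiv.addRight (1 : ℤ)).tsum_eq
      (fun q : ℤ => expCoeff θ (q + k) * expCoeff (-θ) (q - 1))]
    refine tsum_congr fun q => ?_
    simp [add_assoc, add_comm k 1]
  rw [h1, besselJ_two_mul, besselJ_two_mul, mul_add, ← tsum_mul_left, ← tsum_mul_left,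
    ← tsum_mul_left, ← Summable.tsum_add]
  · refine tsum_congr fun q => ?_
    have e1 := intCast_mul_expCoeff θ (q + k)
    have e2 := intCast_mul_expCoeff (-θ) q
    have e3 : q + (k - 1) = q + k - 1 := by ring
    rw [e3]
    push_cast at e1
    linear_combination (-expCoeff (-θ) q) * e1 + expCoeff θ (q + k) * e2
  · simpa using (summable_expCoeff_add_mul θ (-θ) (k - 1) 0).mul_left θ
  · exact (summable_expCoeff_add_mul θ (-θ) k (-1)).mul_left θ

theorem hasDerivAt_besselJ_two_mul (k : ℤ) (θ : ℂ) :
    HasDerivAt (fun z => besselJ k (2 * z)) (besselJ (k - 1) (2 * θ) - besselJ (k + 1) (2 * θ))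
      θ := by
  have h1 : besselJ (k + 1) (2 * θ) =
      ∑' q : ℤ, expCoeff θ (q + k) * expCoeff (-θ) (q - 1) := by
    rw [besselJ_two_mul, ← (Equiv.addRight (1 : ℤ)).tsum_eq
      (fun q : ℤ => expCoeff θ (q + k) * expCoeff (-θ) (q - 1))]
    refine tsum_congr fun q => ?_
    simp [add_assoc, add_comm k 1]
  rw [h1, besselJ_two_mul, ← Summable.tsum_sub]
  rotate_left
  · simpa using summable_expCoeff_add_mul θ (-θ) (k - 1) 0
  · exact summable_expCoeff_add_mul θ (-θ) k (-1)
  simp only [besselJ_two_mul]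
  -- A real majorant: on the ball of radius ‖θ‖ + 1 every Taylor coefficient is dominated by its
  -- value at R, which justifies termwise differentiation.
  set R : ℂ := ((‖θ‖ + 1 : ℝ) : ℂ) with hR
  have hRn : ‖R‖ = ‖θ‖ + 1 := by
    rw [hR, Complex.norm_real, Real.norm_of_nonneg (by positivity)]
  have hb : ∀ z ∈ Metric.ball (0 : ℂ) (‖θ‖ + 1), ‖z‖ ≤ ‖R‖ := by
    intro z hz
    rw [hRn]
    exact (mem_ball_zero_iff.1 hz).le
  have hθ : θ ∈ Metric.ball (0 : ℂ) (‖θ‖ + 1) := by simp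
  refine hasDerivAt_tsum_of_isPreconnected (𝕜 := ℂ) (F := ℂ)
    (g := fun (q : ℤ) (z : ℂ) => expCoeff z (q + k) * expCoeff (-z) q)
    (g' := fun (q : ℤ) (z : ℂ) => expCoeff z (q + (k - 1)) * expCoeff (-z) q -
      expCoeff z (q + k) * expCoeff (-z) (q - 1))
    (u := fun q : ℤ => ‖expCoeff R (q + (k - 1)) * expCoeff R (q + 0)‖ +
      ‖expCoeff R (q + k) * expCoeff R (q + -1)‖)
    (t := Metric.ball (0 : ℂ) (‖θ‖ + 1)) (y₀ := θ) ?_ Metric.isOpen_ball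
    (convex_ball (0 : ℂ) (‖θ‖ + 1)).isPreconnected ?_ ?_ hθ ?_ hθ
  · exact (summable_norm_expCoeff_add_mul R R _ _).add (summable_norm_expCoeff_add_mul R R _ _)
  · intro q z _
    have d1 := hasDerivAt_expCoeff z (q + k)
    have d2 : HasDerivAt (fun w : ℂ => expCoeff (-w) q) (-expCoeff (-z) (q - 1)) z :=
      ((hasDerivAt_expCoeff (-z) q).comp z (hasDerivAt_neg z)).congr_deriv (by ring)
    refine (d1.mul d2).congr_deriv ?_
    rw [show q + (k - 1) = q + k - 1 by ring]
    ring
  · intro q z hz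
    have hz := hb z hz
    have hz' : ‖-z‖ ≤ ‖R‖ := by rwa [norm_neg]
    refine (norm_sub_le _ _).trans ?_
    rw [norm_mul, norm_mul, norm_mul, norm_mul, add_zero, ← sub_eq_add_neg]
    gcongr <;> exact norm_expCoeff_le (by assumption) _
  · simpa using summable_expCoeff_add_mul θ (-θ) k 0

theorem summable_norm_besselJ (θ : ℂ) : Summable fun k : ℤ => ‖besselJ k (2 * θ)‖ := by
  have h := summable_norm_expCoeff_shear θ (-θ)
  refine Summable.of_nonneg_of_le (fun _ => norm_nonneg _) (fun k => ?_) h.prod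
  rw [besselJ_two_mul]
  exact norm_tsum_le_tsum_norm (h.prod_factor k)

/-- The generating function of the Bessel functions of integer order. -/
theorem hasSum_besselJ_mul_zpow (θ : ℂ) {t : ℂ} (ht : t ≠ 0) :
    HasSum (fun k : ℤ => besselJ k (2 * θ) * t ^ k) (Complex.exp (θ * (t - t⁻¹))) := by
  have h1 := (hasSum_expCoeff (θ * t)).mul (hasSum_expCoeff (-θ * t⁻¹))
    (summable_norm_expCoeff_mul _ _).of_norm
  rw [← Complex.exp_add] at h1
  have h2 := (intShear.hasSum_iff (f := fun x : ℤ × ℤ =>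
    expCoeff (θ * t) x.1 * expCoeff (-θ * t⁻¹) x.2)).2 h1
  have h3 := h2.prod_fiberwise (g := fun k : ℤ => besselJ k (2 * θ) * t ^ k) fun k => by
    rw [besselJ_two_mul, ← tsum_mul_right]
    have := ((summable_expCoeff_add_mul θ (-θ) k 0).mul_right (t ^ k)).hasSum
    simp only [add_zero] at this
    refine this.congr_fun ?_
    intro q
    simp only [Function.comp, intShear, Equiv.coe_fn_mk]
    rw [← expCoeff_mul_zpow θ, ← expCoeff_mul_zpow (-θ), inv_zpow, zpow_add₀ ht]
    have : t ^ q ≠ 0 := zpow_ne_zero _ ht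
    field_simp
  convert h3 using 2
  ring

theorem besselJ_ofReal_im (k : ℤ) (θ : ℝ) : (besselJ k (2 * (θ : ℂ))).im = 0 := by
  rw [← Complex.conj_eq_iff_im]
  unfold besselJ
  rw [map_mul, Complex.conj_tsum]
  split_ifs <;> simp

/-! ### Parseval and the ℓ² norm of convolution with Bessel functions. -/

theorem Orthonormal.norm_sq_sum_smul {ι E : Type*} [NormedAddCommGroup E] [InnerProductSpace ℂ E]
    {v : ι → E} (hv : Orthonormal ℂ v) (φ : ι → ℂ) (s : Finset ι) :
    ‖∑ i ∈ s, φ i • v i‖ ^ 2 = ∑ i ∈ s, ‖φ i‖ ^ 2 := by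
  have h := hv.inner_sum φ φ s
  rw [inner_self_eq_norm_sq_to_K] at h
  simp only [RCLike.conj_mul] at h
  have h' := congrArg Complex.re h
  exact_mod_cast h'

/-- Parseval's identity for an absolutely convergent Fourier series. -/
theorem hasSum_sq_norm_of_hasSum_fourier {φ : ℤ → ℂ} (hφ : Summable fun k => ‖φ k‖)
    {f : C(UnitAddCircle, ℂ)} (hf : ∀ x, HasSum (fun k => φ k * fourier k x) (f x)) :
    HasSum (fun k => ‖φ k‖ ^ 2)
      (‖ContinuousMap.toLp (E := ℂ) 2 AddCircle.haarAddCircle ℂ f‖ ^ 2) := by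
  have hs : Summable fun k => φ k • (fourier k : C(UnitAddCircle, ℂ)) := by
    refine Summable.of_norm (hφ.congr fun k => ?_)
    rw [norm_smul, fourier_norm, mul_one]
  have h1 : HasSum (fun k => φ k • (fourier k : C(UnitAddCircle, ℂ))) f := by
    convert hs.hasSum using 1
    ext x
    refine (hf x).unique ?_
    simpa using hs.hasSum.mapL (ContinuousMap.evalCLM ℂ x)
  have h2 := h1.mapL (ContinuousMap.toLp (E := ℂ) 2 AddCircle.haarAddCircle ℂ)
  refine (h2.norm.pow 2).congr fun s => ?_
  simp only [map_smul]
  exact orthonormal_fourier.norm_sq_sum_smul φ s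

/-- On the unit circle t⁻¹ is the conjugate of t, so t - t⁻¹ = 2i Im t. In particular the symbol is
unimodular when θ is real. -/
theorem norm_exp_mul_fourier_sub (θ : ℂ) (x : UnitAddCircle) :
    ‖Complex.exp (θ * (fourier 1 x - (fourier 1 x)⁻¹))‖ =
      Real.exp (-2 * θ.im * (fourier 1 x : ℂ).im) := by
  have h : (fourier 1 x : ℂ)⁻¹ = (starRingEnd ℂ) (fourier 1 x) := by
    rw [fourier_one, ← Circle.coe_inv, Circle.coe_inv_eq_conj]
  rw [Complex.norm_exp, h, Complex.sub_conj]
  congr 1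
  simp
  ring

theorem hasSum_sum_mul_besselJ_mul_zpow (θ : ℂ) {t : ℂ} (ht : t ≠ 0) (I : Finset ℤ) (a : ℤ → ℂ) :
    HasSum (fun k : ℤ => (∑ i ∈ I, a i * besselJ (i + k) (2 * θ)) * t ^ k)
      (∑ i ∈ I, a i * t ^ (-i) * Complex.exp (θ * (t - t⁻¹))) := by
  simp only [Finset.sum_mul]
  refine hasSum_sum fun i _ => ?_
  have h := ((Equiv.addLeft i).hasSum_iff.2 (hasSum_besselJ_mul_zpow θ ht)).mul_left
    (a i * t ^ (-i))
  refine h.congr_fun fun k => ?_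
  simp only [Function.comp, Equiv.coe_addLeft, zpow_add₀ ht, zpow_neg]
  field_simp

theorem summable_norm_sum_mul_besselJ (θ : ℂ) (I : Finset ℤ) (a : ℤ → ℂ) :
    Summable fun k : ℤ => ‖∑ i ∈ I, a i * besselJ (i + k) (2 * θ)‖ := by
  refine Summable.of_nonneg_of_le (fun _ => norm_nonneg _) (fun k => norm_sum_le _ _) ?_
  refine summable_sum fun i _ => ?_
  simp only [norm_mul]
  exact ((Equiv.addLeft i).summable_iff.2 (summable_norm_besselJ θ)).mul_left _

/-- Convolution by the Bessel functions has norm at most `exp (2 |Im θ|)` on square summable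
sequences, and is isometric for real `θ`. -/
theorem exists_hasSum_sq_norm_sum_mul_besselJ (θ : ℂ) (I : Finset ℤ) (a : ℤ → ℂ) :
    ∃ S : ℝ, HasSum (fun k : ℤ => ‖∑ i ∈ I, a i * besselJ (i + k) (2 * θ)‖ ^ 2) S ∧
      S ≤ Real.exp (4 * |θ.im|) * ∑ i ∈ I, ‖a i‖ ^ 2 ∧
      (θ.im = 0 → S = ∑ i ∈ I, ‖a i‖ ^ 2) := by
  have hne : ∀ x : UnitAddCircle, (fourier 1 x : ℂ) ≠ 0 := fun x => by
    rw [fourier_one]; exact Circle.coe_ne_zero _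
  have hpow : ∀ (k : ℤ) (x : UnitAddCircle), (fourier k x : ℂ) = (fourier 1 x : ℂ) ^ k := by
    intro k x
    rw [fourier_one, fourier_apply, AddCircle.toCircle_zsmul, Circle.coe_zpow]
  have hcont : Continuous fun x : UnitAddCircle =>
      Complex.exp (θ * (fourier 1 x - (fourier 1 x)⁻¹)) := by
    have h1 : Continuous fun x : UnitAddCircle => (fourier 1 x : ℂ) := (fourier 1).continuous
    exact Complex.continuous_exp.comp (continuous_const.mul (h1.sub (h1.inv₀ hne)))
  let g : C(UnitAddCircle, ℂ) := ⟨_, hcont⟩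
  let f : C(UnitAddCircle, ℂ) := ∑ i ∈ I, a i • fourier (-i)
  let P := ContinuousMap.toLp (E := ℂ) 2 (AddCircle.haarAddCircle (T := 1)) ℂ
  have hf : ‖P f‖ ^ 2 = ∑ i ∈ I, ‖a i‖ ^ 2 := by
    have h := (orthonormal_fourier (T := 1)).comp (fun i : ℤ => -i) neg_injective
    rw [← h.norm_sq_sum_smul a I]
    simp only [P, f, map_sum, map_smul]
    rfl
  have hS := hasSum_sq_norm_of_hasSum_fourier (summable_norm_sum_mul_besselJ θ I a) (f := f * g)
    fun x => by
      have h := hasSum_sum_mul_besselJ_mul_zpow θ (hne x) I a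
      have hfx : f x = ∑ i ∈ I, a i * (fourier 1 x : ℂ) ^ (-i) := by
        simp only [f, ContinuousMap.sum_apply, ContinuousMap.smul_apply, smul_eq_mul]
        exact Finset.sum_congr rfl fun i _ => by rw [hpow]
      rw [← Finset.sum_mul, ← hfx] at h
      exact h.congr_fun fun k => by rw [hpow k x]
  have him : ∀ x : UnitAddCircle, |(fourier 1 x : ℂ).im| ≤ 1 := fun x => by
    refine (Complex.abs_im_le_norm _).trans ?_
    rw [fourier_one, Circle.norm_coe]
  have hle : ∀ x, ‖(f * g) x‖ ≤ Real.exp (2 * |θ.im|) * ‖f x‖ := fun x => by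
    rw [ContinuousMap.mul_apply, norm_mul, mul_comm]
    gcongr
    change ‖Complex.exp (θ * (fourier 1 x - (fourier 1 x)⁻¹))‖ ≤ _
    rw [norm_exp_mul_fourier_sub]
    apply Real.exp_le_exp.2
    refine (le_abs_self _).trans ?_
    rw [abs_mul, abs_mul, abs_neg, abs_two]
    exact mul_le_of_le_one_right (by positivity) (him x)
  refine ⟨_, hS, ?_, ?_⟩
  · rw [← hf]
    have h : ‖P (f * g)‖ ≤ Real.exp (2 * |θ.im|) * ‖P f‖ := by
      refine MeasureTheory.Lp.norm_le_mul_norm_of_ae_le_mul ?_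
      filter_upwards [ContinuousMap.coeFn_toLp (𝕜 := ℂ) (p := 2)
        (AddCircle.haarAddCircle (T := 1)) (f * g), ContinuousMap.coeFn_toLp (𝕜 := ℂ) (p := 2)
        (AddCircle.haarAddCircle (T := 1)) f] with x h1 h2
      rw [h1, h2]
      exact hle x
    calc ‖P (f * g)‖ ^ 2 ≤ (Real.exp (2 * |θ.im|) * ‖P f‖) ^ 2 := by gcongr
      _ = Real.exp (4 * |θ.im|) * ‖P f‖ ^ 2 := by
        rw [mul_pow, ← Real.exp_nat_mul]; ring_nf
  · intro h0
    rw [← hf]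
    have hnorm : ∀ u v : MeasureTheory.Lp ℂ 2 (AddCircle.haarAddCircle (T := 1)),
        (∀ᵐ x ∂(AddCircle.haarAddCircle (T := 1)), ‖u x‖ = ‖v x‖) → ‖u‖ = ‖v‖ := fun u v h =>
      le_antisymm (MeasureTheory.Lp.norm_le_norm_of_ae_le (h.mono fun _ h => h.le))
        (MeasureTheory.Lp.norm_le_norm_of_ae_le (h.mono fun _ h => h.ge))
    congr 1
    refine hnorm _ _ ?_
    filter_upwards [ContinuousMap.coeFn_toLp (𝕜 := ℂ) (p := 2)
      (AddCircle.haarAddCircle (T := 1)) (f * g), ContinuousMap.coeFn_toLp (𝕜 := ℂ) (p := 2)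
      (AddCircle.haarAddCircle (T := 1)) f] with x h1 h2
    rw [h1, h2, ContinuousMap.mul_apply, norm_mul]
    change _ * ‖Complex.exp (θ * (fourier 1 x - (fourier 1 x)⁻¹))‖ = _
    rw [norm_exp_mul_fourier_sub, h0]
    simp

/-! ### Lipschitz dependence of the double sum on θ, uniform in the interval. -/

/-- The discrete Bessel kernel as a sum of products of Bessel functions. -/
theorem hasSum_besselKernel {i j : ℤ} (hij : i ≠ j) (θ : ℂ) :
    HasSum (fun k : ℕ => besselJ (i + k + 1) (2 * θ) * besselJ (j + k + 1) (2 * θ))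
      (besselKernel i j θ) := by
  have hne : ((i : ℂ) - j) ≠ 0 := sub_ne_zero.2 (by exact_mod_cast hij)
  -- `T k` is the kernel at (i + k, j + k). The recurrence turns `T k - T (k + 1)` into one product
  -- of Bessel functions, and `T` tends to 0.
  set T : ℕ → ℂ := fun k => θ * (besselJ (i + k) (2 * θ) * besselJ (j + k + 1) (2 * θ) -
    besselJ (i + k + 1) (2 * θ) * besselJ (j + k) (2 * θ)) / ((i : ℂ) - j) with hT
  have hT0 : besselKernel i j θ = T 0 := by simp [hT, besselKernel, hij]
  have hlim : ∀ l : ℤ, Filter.Tendsto (fun k : ℕ => besselJ (l + k) (2 * θ)) Filter.atTop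
      (nhds 0) := fun l => by
    have h := (summable_norm_besselJ θ).of_norm
    have h2 := h.comp_injective (i := fun k : ℕ => l + (k : ℤ)) fun a b h => by simpa using h
    exact h2.tendsto_atTop_zero
  have hlim' : ∀ l : ℤ, Filter.Tendsto (fun k : ℕ => besselJ (l + k + 1) (2 * θ)) Filter.atTop
      (nhds 0) := fun l => by
    refine (hlim (l + 1)).congr fun k => ?_
    congr 1; ring
  have hTlim : Filter.Tendsto T Filter.atTop (nhds 0) := by
    have := ((((hlim i).mul (hlim' j)).sub ((hlim' i).mul (hlim j))).const_mul θ).div_const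
      ((i : ℂ) - j)
    simpa using this
  have hstep : ∀ k : ℕ, besselJ (i + k + 1) (2 * θ) * besselJ (j + k + 1) (2 * θ) =
      T k - T (k + 1) := fun k => by
    have e1 := besselJ_recurrence (i + k + 1) θ
    have e2 := besselJ_recurrence (j + k + 1) θ
    simp only [hT]
    push_cast at e1 e2 ⊢
    rw [show i + (k : ℤ) + 1 - 1 = i + k by ring] at e1
    rw [show j + (k : ℤ) + 1 - 1 = j + k by ring] at e2
    rw [← add_assoc, ← add_assoc, div_sub_div_same, eq_div_iff hne]
    linear_combination (-besselJ (j + k + 1) (2 * θ)) * e1 + besselJ (i + k + 1) (2 * θ) * e2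
  have hsum : Summable fun k : ℕ => besselJ (i + k + 1) (2 * θ) * besselJ (j + k + 1) (2 * θ) := by
    have h1 : ∀ l : ℤ, Summable fun k : ℕ => ‖besselJ (l + k + 1) (2 * θ)‖ := fun l =>
      (summable_norm_besselJ θ).comp_injective (i := fun k : ℕ => l + (k : ℤ) + 1)
        fun a b h => by simpa using h
    refine Summable.of_norm ?_
    simp only [norm_mul]
    exact ((h1 i).mul_of_nonneg (h1 j) (fun _ => norm_nonneg _)
      (fun _ => norm_nonneg _)).comp_injective (i := fun k : ℕ => (k, k))
      fun a b h => (Prod.mk.inj h).1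
  rw [hsum.hasSum_iff_tendsto_nat, hT0]
  simp only [hstep, Finset.sum_range_sub']
  simpa using tendsto_const_nhds.sub hTlim

/-- Eliminating θ with the four recurrences produces a factor i - j, which cancels the denominator.
The rank-two form that remains is what makes the derivative of the double sum bounded. -/
theorem hasDerivAt_besselKernel {i j : ℤ} (hij : i ≠ j) (θ : ℂ) :
    HasDerivAt (besselKernel i j) (besselJ i (2 * θ) * besselJ (j + 1) (2 * θ) +
      besselJ (i + 1) (2 * θ) * besselJ j (2 * θ)) θ := by
  have hne : ((i : ℂ) - j) ≠ 0 := sub_ne_zero.2 (by exact_mod_cast hij)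
  have hfun : besselKernel i j = fun z => z * (besselJ i (2 * z) * besselJ (j + 1) (2 * z) -
      besselJ (i + 1) (2 * z) * besselJ j (2 * z)) / ((i : ℂ) - j) := by
    funext z; simp [besselKernel, hij]
  rw [hfun]
  have d := hasDerivAt_besselJ_two_mul
  refine (((hasDerivAt_id θ).mul (((d i θ).mul (d (j + 1) θ)).sub
    ((d (i + 1) θ).mul (d j θ)))).div_const ((i : ℂ) - j)).congr_deriv ?_
  have r1 := besselJ_recurrence i θ
  have r2 := besselJ_recurrence (i + 1) θ
  have r3 := besselJ_recurrence j θ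
  have r4 := besselJ_recurrence (j + 1) θ
  rw [add_sub_cancel_right] at r2 r4
  push_cast at r2 r4
  rw [add_sub_cancel_right, add_sub_cancel_right, div_eq_iff hne]
  simp only [id, Pi.mul_apply, Pi.sub_apply]
  linear_combination besselJ (j + 1) (2 * θ) * r1 - besselJ i (2 * θ) * r4 +
    besselJ j (2 * θ) * r2 - besselJ (i + 1) (2 * θ) * r3

theorem sum_sq_norm_besselJ_le (θ : ℂ) (I : Finset ℤ) (l : ℤ) :
    ∑ i ∈ I, ‖besselJ (i + l) (2 * θ)‖ ^ 2 ≤ Real.exp (4 * |θ.im|) := by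
  obtain ⟨S, hS, hle, -⟩ := exists_hasSum_sq_norm_sum_mul_besselJ θ {l} 1
  simp only [Finset.sum_singleton, Pi.one_apply, one_mul, norm_one, one_pow, mul_one] at hS hle
  simp only [add_comm _ l]
  exact (sum_le_hasSum I (fun _ _ => by positivity) hS).trans hle

/-- The bilinear form of the discrete Bessel kernel between two disjoint sets. -/
theorem norm_sum_besselKernel_mul_le (θ : ℂ) {I F : Finset ℤ} (hd : Disjoint I F) (a b : ℤ → ℂ) :
    ‖∑ i ∈ I, ∑ j ∈ F, besselKernel i j θ * (a i * b j)‖ ≤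
      Real.exp (4 * |θ.im|) * (∑ i ∈ I, ‖a i‖ ^ 2 + ∑ j ∈ F, ‖b j‖ ^ 2) / 2 := by
  obtain ⟨S, hS, hSle, -⟩ := exists_hasSum_sq_norm_sum_mul_besselJ θ I a
  obtain ⟨S', hS', hSle', -⟩ := exists_hasSum_sq_norm_sum_mul_besselJ θ F b
  set A : ℤ → ℂ := fun k => ∑ i ∈ I, a i * besselJ (i + k) (2 * θ) with hA
  set B : ℤ → ℂ := fun k => ∑ i ∈ F, b i * besselJ (i + k) (2 * θ) with hB
  have hinj : Function.Injective fun k : ℕ => (k : ℤ) + 1 := fun a b h => by simpa using h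
  -- The bilinear form is the pairing over k ≥ 1 of two convolved sequences, so the inequality 2|AB|
  -- ≤ |A|² + |B|² and the ℓ² bounds on A and B suffice.
  have hsum : HasSum (fun k : ℕ => A (k + 1) * B (k + 1))
      (∑ i ∈ I, ∑ j ∈ F, besselKernel i j θ * (a i * b j)) := by
    have h : HasSum (fun k : ℕ => ∑ i ∈ I, ∑ j ∈ F, besselJ (i + k + 1) (2 * θ) *
        besselJ (j + k + 1) (2 * θ) * (a i * b j))
        (∑ i ∈ I, ∑ j ∈ F, besselKernel i j θ * (a i * b j)) :=
      hasSum_sum fun i hi => hasSum_sum fun j hj =>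
        (hasSum_besselKernel (i := i) (j := j)
          (fun h => Finset.disjoint_left.1 hd hi (h ▸ hj)) θ).mul_right _
    refine h.congr_fun fun k => ?_
    simp only [hA, hB, Finset.sum_mul_sum, add_assoc]
    exact Finset.sum_congr rfl fun i _ => Finset.sum_congr rfl fun j _ => by ring
  have hgA : Summable fun k : ℕ => ‖A (k + 1)‖ ^ 2 := hS.summable.comp_injective hinj
  have hgB : Summable fun k : ℕ => ‖B (k + 1)‖ ^ 2 := hS'.summable.comp_injective hinj
  have hg : Summable fun k : ℕ => (‖A (k + 1)‖ ^ 2 + ‖B (k + 1)‖ ^ 2) / 2 :=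
    (hgA.add hgB).div_const 2
  have h1 : ∑' k : ℕ, ‖A (k + 1)‖ ^ 2 ≤ S := by
    rw [← hS.tsum_eq]
    exact tsum_comp_le_tsum_of_inj hS.summable (fun _ => by positivity) hinj
  have h2 : ∑' k : ℕ, ‖B (k + 1)‖ ^ 2 ≤ S' := by
    rw [← hS'.tsum_eq]
    exact tsum_comp_le_tsum_of_inj hS'.summable (fun _ => by positivity) hinj
  rw [← hsum.tsum_eq]
  refine (tsum_of_norm_bounded hg.hasSum fun k => ?_).trans ?_
  · rw [norm_mul]
    nlinarith [sq_nonneg (‖A (k + 1)‖ - ‖B (k + 1)‖)]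
  · rw [tsum_div_const, hgA.tsum_add hgB]
    have : S + S' ≤ Real.exp (4 * |θ.im|) * (∑ i ∈ I, ‖a i‖ ^ 2 + ∑ j ∈ F, ‖b j‖ ^ 2) := by
      rw [mul_add]; linarith
    linarith

/-- The bilinear form costs exp(4|Im θ|), and the squared ℓ² norms of the Bessel sequences cost
exp(4|Im θ|) again. The 4 is the 2 from differentiating a square times the two rank-one terms.
Nothing depends on `I` or `F`. -/
theorem hasDerivAt_sum_sq_besselKernel {I F : Finset ℤ} (hd : Disjoint I F) (θ : ℂ) :
    ∃ D : ℂ, HasDerivAt (fun z => ∑ i ∈ I, ∑ j ∈ F, besselKernel i j z ^ 2) D θ ∧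
      ‖D‖ ≤ 4 * Real.exp (8 * |θ.im|) := by
  refine ⟨2 * (∑ i ∈ I, ∑ j ∈ F, besselKernel i j θ *
      (besselJ i (2 * θ) * besselJ (j + 1) (2 * θ)) + ∑ i ∈ I, ∑ j ∈ F, besselKernel i j θ *
      (besselJ (i + 1) (2 * θ) * besselJ j (2 * θ))), ?_, ?_⟩
  · rw [← Finset.sum_add_distrib, Finset.mul_sum]
    refine HasDerivAt.fun_sum fun i hi => ?_
    rw [← Finset.sum_add_distrib, Finset.mul_sum]
    refine HasDerivAt.fun_sum fun j hj => ?_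
    have hij : i ≠ j := fun h => Finset.disjoint_left.1 hd hi (h ▸ hj)
    refine ((hasDerivAt_besselKernel hij θ).pow 2).congr_deriv ?_
    simp
    ring
  · have hs : ∀ (J : Finset ℤ) , ∑ i ∈ J, ‖besselJ i (2 * θ)‖ ^ 2 ≤ Real.exp (4 * |θ.im|) :=
      fun J => by simpa using sum_sq_norm_besselJ_le θ J 0
    have hs1 := fun J => sum_sq_norm_besselJ_le θ J 1
    have h1 := norm_sum_besselKernel_mul_le θ hd (fun i => besselJ i (2 * θ))
      (fun j => besselJ (j + 1) (2 * θ))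
    have h2 := norm_sum_besselKernel_mul_le θ hd (fun i => besselJ (i + 1) (2 * θ))
      (fun j => besselJ j (2 * θ))
    have he : Real.exp (8 * |θ.im|) = Real.exp (4 * |θ.im|) * Real.exp (4 * |θ.im|) := by
      rw [← Real.exp_add]; ring_nf
    have hpos := Real.exp_pos (4 * |θ.im|)
    have b1 := mul_le_mul_of_nonneg_left (add_le_add (hs I) (hs1 F)) hpos.le
    have b2 := mul_le_mul_of_nonneg_left (add_le_add (hs1 I) (hs F)) hpos.le
    rw [norm_mul, Complex.norm_ofNat, he]
    refine (mul_le_mul_of_nonneg_left (norm_add_le _ _) two_pos.le).trans ?_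
    linarith

/-- Mean value inequality on the disc about the real point r through θ, where |Im z| ≤ |z - r| ≤ |r
- θ|. -/
theorem norm_sum_sq_besselKernel_sub_le {I F : Finset ℤ} (hd : Disjoint I F) (r : ℝ) (θ : ℂ) :
    ‖∑ i ∈ I, ∑ j ∈ F, besselKernel i j θ ^ 2 - ∑ i ∈ I, ∑ j ∈ F, besselKernel i j r ^ 2‖ ≤
      4 * Real.exp (8 * ‖(r : ℂ) - θ‖) * ‖(r : ℂ) - θ‖ := by
  choose D hD hDle using hasDerivAt_sum_sq_besselKernel hd
  have h := (convex_closedBall (r : ℂ) ‖(r : ℂ) - θ‖).norm_image_sub_le_of_norm_hasDerivWithin_le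
    (𝕜 := ℂ) (f := fun z => ∑ i ∈ I, ∑ j ∈ F, besselKernel i j z ^ 2) (f' := D)
    (C := 4 * Real.exp (8 * ‖(r : ℂ) - θ‖)) (x := (r : ℂ)) (y := θ)
    (fun z _ => (hD z).hasDerivWithinAt) ?_ (by simp) (by simp [dist_eq_norm, norm_sub_rev])
  · rwa [norm_sub_rev θ] at h
  · intro z hz
    refine (hDle z).trans ?_
    gcongr
    have h1 : |(z - r).im| ≤ ‖z - r‖ := Complex.abs_im_le_norm _
    rw [Complex.sub_im, Complex.ofReal_im, sub_zero] at h1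
    rw [mem_closedBall_iff_norm] at hz
    exact h1.trans hz

/-- For j ≠ i the denominator has modulus at least 1 and may be dropped, which leaves an absolutely
summable majorant; squares of a summable nonnegative sequence are summable. -/
theorem summable_sq_besselKernel (θ : ℂ) (i : ℤ) {I : Finset ℤ} (hi : i ∈ I) :
    Summable fun j : {j : ℤ // j ∉ I} => besselKernel i j θ ^ 2 := by
  have h0 := summable_norm_besselJ θ
  have h1 : Summable fun j : ℤ => ‖besselJ (j + 1) (2 * θ)‖ :=
    (Equiv.addRight (1 : ℤ)).summable_iff.2 h0
  set g : ℤ → ℝ := fun j => ‖θ‖ * (‖besselJ i (2 * θ)‖ * ‖besselJ (j + 1) (2 * θ)‖ +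
    ‖besselJ (i + 1) (2 * θ)‖ * ‖besselJ j (2 * θ)‖) with hg
  have hgs : Summable g := ((h1.mul_left _).add (h0.mul_left _)).mul_left _
  have hgn : ∀ j, 0 ≤ g j := fun j => by positivity
  have hg2 : Summable fun j => g j ^ 2 := by
    refine Summable.of_nonneg_of_le (fun _ => by positivity) (fun j => ?_)
      (hgs.mul_left (∑' j, g j))
    rw [sq]
    exact mul_le_mul_of_nonneg_right (hgs.le_tsum j fun k _ => hgn k) (hgn j)
  refine Summable.of_norm_bounded (hg2.subtype _) fun j => ?_
  have hij : i ≠ j := fun h => j.2 (h ▸ hi)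
  have hne : 1 ≤ ‖(i : ℂ) - (j : ℤ)‖ := by
    rw [← Int.cast_sub, Complex.norm_intCast]
    have : 1 ≤ |i - j| := Int.one_le_abs (sub_ne_zero.2 hij)
    exact_mod_cast this
  simp only [Function.comp, norm_pow]
  gcongr
  simp only [besselKernel, if_neg hij, norm_div, norm_mul, hg]
  refine (div_le_self (by positivity) hne).trans ?_
  gcongr
  refine (norm_sub_le _ _).trans ?_
  rw [norm_mul, norm_mul]

theorem norm_poissonizedVariance_sub_le (x y : ℤ) (r : ℝ) (θ : ℂ) :
    ‖poissonizedVariance x y θ - poissonizedVariance x y r‖ ≤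
      4 * Real.exp (8 * ‖(r : ℂ) - θ‖) * ‖(r : ℂ) - θ‖ := by
  have hlim : ∀ z : ℂ, HasSum (fun j : {j : ℤ // j ∉ Finset.Icc x y} =>
      ∑ i ∈ Finset.Icc x y, besselKernel i j z ^ 2) (poissonizedVariance x y z) := fun z =>
    hasSum_sum fun i hi => (summable_sq_besselKernel z i hi).hasSum
  refine le_of_tendsto ((hlim θ).sub (hlim r)).norm (Filter.Eventually.of_forall fun s => ?_)
  have hd : Disjoint (Finset.Icc x y) (s.map (Function.Embedding.subtype _)) := by
    rw [Finset.disjoint_left]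
    intro i hi hi'
    obtain ⟨j, -, rfl⟩ := Finset.mem_map.1 hi'
    exact j.2 hi
  have h := norm_sum_sq_besselKernel_sub_le hd r θ
  rw [Finset.sum_comm, Finset.sum_comm (s := Finset.Icc x y), Finset.sum_map, Finset.sum_map] at h
  rw [Finset.sum_sub_distrib]
  exact h

/-! ### Real θ: discrete energies and the size of Bessel functions in the bulk. -/

/-- The properties of the sequence `k ↦ J_k(2θ)` for real `θ` that determine its asymptotics. -/
structure IsBesselSeq (θ : ℝ) (J : ℤ → ℝ) : Prop where
  recurrence : ∀ k : ℤ, θ * (J (k - 1) + J (k + 1)) = k * J k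
  hasSum_sq : HasSum (fun k => J k ^ 2) 1
  hasSum_sq_add : HasSum (fun k => (J (k - 1) + J (k + 1)) ^ 2) 2

/-- The ℓ² identities come from the isometry for real θ, applied to the unit mass at 0 and to the
sum of the unit masses at -1 and 1. -/
theorem isBesselSeq_besselJ (θ : ℝ) : IsBesselSeq θ fun k => (besselJ k (2 * (θ : ℂ))).re := by
  have hre : ∀ k, (((besselJ k (2 * (θ : ℂ))).re : ℝ) : ℂ) = besselJ k (2 * (θ : ℂ)) := fun k =>
    Complex.ext (by simp) (by simp [besselJ_ofReal_im])
  refine ⟨fun k => ?_, ?_, ?_⟩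
  · have := besselJ_recurrence k θ
    rw [← hre (k - 1), ← hre (k + 1), ← hre k] at this
    exact_mod_cast this
  · obtain ⟨S, hS, -, h⟩ := exists_hasSum_sq_norm_sum_mul_besselJ θ {0} 1
    rw [h (Complex.ofReal_im θ)] at hS
    simp only [Finset.sum_singleton, Pi.one_apply, one_mul, norm_one, one_pow, zero_add] at hS
    refine hS.congr_fun fun k => ?_
    rw [← hre k, Complex.norm_real, Real.norm_eq_abs, sq_abs, Complex.ofReal_re]
  · obtain ⟨S, hS, -, h⟩ := exists_hasSum_sq_norm_sum_mul_besselJ θ {-1, 1} 1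
    rw [h (Complex.ofReal_im θ)] at hS
    simp only [Finset.sum_pair (show (-1 : ℤ) ≠ 1 by norm_num), Pi.one_apply, one_mul, norm_one,
      one_pow] at hS
    norm_num at hS
    refine hS.congr_fun fun k => ?_
    rw [neg_add_eq_sub, add_comm 1 k, ← hre (k - 1), ← hre (k + 1), ← Complex.ofReal_add,
      Complex.norm_real, Real.norm_eq_abs, sq_abs, Complex.ofReal_re, Complex.ofReal_re]

theorem abs_sub_le_of_abs_step_le {f : ℤ → ℝ} {B R : ℝ}
    (h : ∀ k : ℤ, |(k : ℝ)| ≤ R → |(k : ℝ) + 1| ≤ R → |f (k + 1) - f k| ≤ B) {k l : ℤ}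
    (hk : |(k : ℝ)| ≤ R) (hl : |(l : ℝ)| ≤ R) : |f k - f l| ≤ B * |(k : ℝ) - l| := by
  wlog hkl : l ≤ k generalizing k l
  · rw [abs_sub_comm, abs_sub_comm (k : ℝ)]
    exact this hl hk (by omega)
  have key : ∀ k : ℤ, l ≤ k → |(k : ℝ)| ≤ R → |f k - f l| ≤ B * ((k : ℝ) - l) := by
    intro k hk
    induction k, hk using Int.leInduction with
    | base => simp
    | succ k hk ih =>
      intro hk1
      have hlk : (l : ℝ) ≤ k := by exact_mod_cast hk
      push_cast at hk1
      have hkR : |(k : ℝ)| ≤ R :=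
        abs_le.2 ⟨(abs_le.1 hl).1.trans hlk, by linarith [(abs_le.1 hk1).2]⟩
      have := abs_sub_le (f (k + 1)) (f k) (f l)
      push_cast
      linarith [h k hkR hk1, ih hkR]
  have := key k hkl hk
  rwa [abs_of_nonneg (a := (k : ℝ) - l)]
  exact sub_nonneg.2 (by exact_mod_cast hkl)

/-- A two-sided discrete Gronwall inequality: it compares f at k and l whichever of the two is
larger. -/
theorem le_pow_mul_of_step_le {f : ℤ → ℝ} {q R : ℝ} (hq : 0 ≤ q)
    (h : ∀ k : ℤ, |(k : ℝ)| ≤ R → |(k : ℝ) + 1| ≤ R → f (k + 1) ≤ q * f k ∧ f k ≤ q * f (k + 1))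
    {k l : ℤ} (hk : |(k : ℝ)| ≤ R) (hl : |(l : ℝ)| ≤ R) : f k ≤ q ^ (k - l).natAbs * f l := by
  have key : ∀ n : ℕ, ∀ l : ℤ, |(l : ℝ)| ≤ R → |(l : ℝ) + n| ≤ R →
      f (l + n) ≤ q ^ n * f l ∧ f l ≤ q ^ n * f (l + n) := by
    intro n
    induction n with
    | zero => intro l _ _; simp
    | succ n ih =>
      intro l hl hn
      push_cast at hn
      have hn' : |(l : ℝ) + n| ≤ R := by
        have := n.cast_nonneg (α := ℝ)
        rw [abs_le] at hl hn ⊢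
        constructor <;> linarith
      obtain ⟨h1, h2⟩ := ih l hl hn'
      obtain ⟨h3, h4⟩ := h (l + n) (by push_cast; exact hn') (by push_cast; rwa [add_assoc])
      push_cast
      rw [← add_assoc, pow_succ]
      constructor
      · nlinarith [mul_le_mul_of_nonneg_left h1 hq]
      · nlinarith [mul_le_mul_of_nonneg_left h4 (pow_nonneg hq n)]
  rcases le_total l k with hkl | hkl
  · have := (key (k - l).natAbs l hl (by
      rw [Nat.cast_natAbs, abs_of_nonneg (sub_nonneg.2 hkl)]; push_cast; simpa using hk)).1
    rwa [show l + ((k - l).natAbs : ℤ) = k by omega] at this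
  · have := (key (k - l).natAbs k hk (by
      rw [Nat.cast_natAbs, abs_of_nonpos (sub_nonpos.2 hkl)]; push_cast; simpa using hl)).2
    rwa [show k + ((k - l).natAbs : ℤ) = l by omega] at this

/-- The energy of a solution `u` of `u (k + 1) + u (k - 1) = (k / θ) u k`; for `k / θ` frozen it is
a conserved quantity. -/
noncomputable def energy (θ : ℝ) (u : ℤ → ℝ) (k : ℤ) : ℝ :=
  u k ^ 2 + u (k + 1) ^ 2 - k / θ * u k * u (k + 1)

/-- For an exact solution the bracket vanishes, and only the drift caused by the variation of k/θ
remains. -/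
theorem energy_sub_energy {θ : ℝ} (hθ : θ ≠ 0) (u : ℤ → ℝ) (k : ℤ) :
    energy θ u (k + 1) - energy θ u k = (u (k + 2) - u k) *
      (u (k + 2) + u k - (k + 1) / θ * u (k + 1)) - u k * u (k + 1) / θ := by
  simp only [energy, show k + 1 + 1 = k + 2 by ring]
  push_cast
  field_simp
  ring

/-- The oscillating term that relates `u k ^ 2` and `energy θ u k`. -/
noncomputable def energyFlux (θ : ℝ) (u : ℤ → ℝ) (k : ℤ) : ℝ :=
  u k ^ 2 - k / θ / 2 * u k * u (k - 1)

/-- Model case with frozen c = 2 cos α and u_k = cos(kα + φ): the energy is sin² α = (4 - c²)/4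
while u_k² averages 1/2. The oscillation about the average telescopes through `energyFlux`; the last
two terms are the defect in the recurrence and the drift of c. -/
theorem sq_eq_energy_add {θ : ℝ} (hθ : θ ≠ 0) (u : ℤ → ℝ) (k : ℤ) :
    (4 - (k / θ) ^ 2) / 2 * u k ^ 2 = energy θ u k + (energyFlux θ u k - energyFlux θ u (k + 1)) +
      k / θ / 2 * u k * (u (k + 1) + u (k - 1) - k / θ * u k) - u k * u (k + 1) / (2 * θ) := by
  simp only [energy, energyFlux, add_sub_cancel_right]
  push_cast
  field_simp
  ring

theorem abs_div_le_of_bulk {θ δ : ℝ} (hθ : 0 < θ) {k : ℤ} (hk : |(k : ℝ)| ≤ (2 - δ) * θ) :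
    |(k : ℝ) / θ| ≤ 2 - δ := by
  rwa [abs_div, abs_of_pos hθ, div_le_iff₀ hθ]

theorem abs_le_of_bulk_half {θ δ : ℝ} (hδ : 0 < δ) (hθ : 4 / δ ≤ θ) {k : ℤ}
    (hk : |(k : ℝ)| ≤ (2 - δ) * θ) {t : ℝ} (ht : |t| ≤ 2) : |(k : ℝ) + t| ≤ (2 - δ / 2) * θ := by
  have := abs_add_le (k : ℝ) t
  rw [div_le_iff₀ hδ] at hθ
  linarith

/-- The quadratic form a² + b² - c a b has smallest eigenvalue 1 - |c|/2, which is at least δ/2 in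
the bulk. -/
theorem mul_sq_add_sq_le_energy {θ δ : ℝ} (hθ : 0 < θ) (u : ℤ → ℝ) {k : ℤ}
    (hk : |(k : ℝ)| ≤ (2 - δ) * θ) :
    δ / 2 * (u k ^ 2 + u (k + 1) ^ 2) ≤ energy θ u k := by
  have hc := abs_div_le_of_bulk hθ hk
  have h1 : (k : ℝ) / θ * (u k * u (k + 1)) ≤ (2 - δ) * |u k * u (k + 1)| := by
    refine (le_abs_self _).trans ?_
    rw [abs_mul]
    gcongr
  have h2 : |u k * u (k + 1)| ≤ (u k ^ 2 + u (k + 1) ^ 2) / 2 := by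
    rw [abs_le]
    constructor <;> nlinarith [sq_nonneg (u k - u (k + 1)), sq_nonneg (u k + u (k + 1))]
  have h3 : 0 ≤ 2 - δ := (abs_nonneg _).trans hc
  unfold energy
  nlinarith [mul_le_mul_of_nonneg_left h2 h3]

theorem abs_energy_le {θ B : ℝ} (hθ : 0 < θ) (u : ℤ → ℝ) {k : ℤ}
    (hk : |(k : ℝ)| ≤ 2 * θ) (h0 : u k ^ 2 ≤ B) (h1 : u (k + 1) ^ 2 ≤ B) :
    |energy θ u k| ≤ 4 * B := by
  have hc : |(k : ℝ) / θ| ≤ 2 := by rwa [abs_div, abs_of_pos hθ, div_le_iff₀ hθ]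
  have h2 : |u k * u (k + 1)| ≤ B := by
    rw [abs_le]
    constructor <;> nlinarith [sq_nonneg (u k - u (k + 1)), sq_nonneg (u k + u (k + 1))]
  have h3 : |(k : ℝ) / θ * (u k * u (k + 1))| ≤ 2 * B := by
    rw [abs_mul]; gcongr
  rw [abs_le] at h3 ⊢
  unfold energy
  constructor <;> nlinarith [sq_nonneg (u k), sq_nonneg (u (k + 1))]

theorem abs_energyFlux_le {θ B : ℝ} (hθ : 0 < θ) (u : ℤ → ℝ) {k : ℤ}
    (hk : |(k : ℝ)| ≤ 2 * θ) (h0 : u k ^ 2 ≤ B) (h1 : u (k - 1) ^ 2 ≤ B) :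
    |energyFlux θ u k| ≤ 2 * B := by
  have hc : |(k : ℝ) / θ| ≤ 2 := by rwa [abs_div, abs_of_pos hθ, div_le_iff₀ hθ]
  have h2 : |u k * u (k - 1)| ≤ B := by
    rw [abs_le]
    constructor <;> nlinarith [sq_nonneg (u k - u (k - 1)), sq_nonneg (u k + u (k - 1))]
  have h3 : |(k : ℝ) / θ * (u k * u (k - 1))| ≤ 2 * B := by
    rw [abs_mul]; gcongr
  rw [abs_le] at h3 ⊢
  unfold energyFlux
  constructor <;> nlinarith [sq_nonneg (u k), sq_nonneg (u (k - 1))]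

namespace IsBesselSeq

variable {θ : ℝ} {J : ℤ → ℝ}

theorem add_eq (hJ : IsBesselSeq θ J) (hθ : θ ≠ 0) (k : ℤ) :
    J (k + 1) + J (k - 1) = k / θ * J k := by
  have := hJ.recurrence k
  field_simp
  linarith

theorem energy_succ (hJ : IsBesselSeq θ J) (hθ : θ ≠ 0) (k : ℤ) :
    energy θ J (k + 1) = energy θ J k - J k * J (k + 1) / θ := by
  have h := energy_sub_energy hθ J k
  have h1 := hJ.add_eq hθ (k + 1)
  rw [add_sub_cancel_right, show k + 1 + 1 = k + 2 by ring] at h1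
  push_cast at h1
  rw [h1, sub_self, mul_zero] at h
  linarith

theorem sum_sq_le (hJ : IsBesselSeq θ J) (s : Finset ℤ) : ∑ k ∈ s, J k ^ 2 ≤ 1 :=
  sum_le_hasSum s (fun _ _ => sq_nonneg _) hJ.hasSum_sq

theorem sum_sq_succ_le (hJ : IsBesselSeq θ J) (s : Finset ℤ) : ∑ k ∈ s, J (k + 1) ^ 2 ≤ 1 :=
  sum_le_hasSum s (fun _ _ => sq_nonneg _) ((Equiv.addRight (1 : ℤ)).hasSum_iff.2 hJ.hasSum_sq)

end IsBesselSeq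

/-- In the bulk `|k| ≤ (2 - δ) θ` the Bessel functions `J_k(2θ)` are of order `θ ^ (-1/2)`. -/
theorem exists_mul_sq_le_of_bulk {δ : ℝ} (hδ : 0 < δ) (hδ1 : δ ≤ 1) :
    ∃ C > 0, ∃ θ₀ > 0, ∀ θ ≥ θ₀, ∀ J, IsBesselSeq θ J → ∀ k : ℤ, |(k : ℝ)| ≤ (2 - δ) * θ →
      θ * J k ^ 2 ≤ C := by
  refine ⟨2 / δ * (4 * Real.exp (8 / δ)), by positivity, 2 / δ, by positivity,
    fun θ hθ J hJ k hk => ?_⟩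
  have hθ0 : 0 < θ := lt_of_lt_of_le (by positivity) hθ
  have hδθ : 2 ≤ δ * θ := by rw [ge_iff_le, div_le_iff₀ hδ] at hθ; linarith
  -- The relative drift of the energy per step: |J_k J_{k+1}|/θ is at most β times the energy. The
  -- bound β ≤ 1/2 gives 1/(1 - β) ≤ 1 + 2β, so the comparison also runs backwards.
  set β : ℝ := 1 / (δ * θ) with hβ
  have hβ0 : 0 < β := by positivity
  have hβ1 : β ≤ 1 / 2 := one_div_le_one_div_of_le two_pos hδθ
  have hstep : ∀ k : ℤ, |(k : ℝ)| ≤ (2 - δ) * θ → |(k : ℝ) + 1| ≤ (2 - δ) * θ →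
      energy θ J (k + 1) ≤ (1 + 2 * β) * energy θ J k ∧
      energy θ J k ≤ (1 + 2 * β) * energy θ J (k + 1) := by
    intro k hk _
    have h1 := hJ.energy_succ hθ0.ne' k
    have h2 := mul_sq_add_sq_le_energy hθ0 J hk
    have hE : 0 ≤ energy θ J k := le_trans (by positivity) h2
    have h3 : |J k * J (k + 1) / θ| ≤ β * energy θ J k := by
      have : |J k * J (k + 1)| ≤ (J k ^ 2 + J (k + 1) ^ 2) / 2 := by
        rw [abs_le]
        constructor <;> nlinarith [sq_nonneg (J k - J (k + 1)), sq_nonneg (J k + J (k + 1))]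
      rw [abs_div, abs_of_pos hθ0, div_le_iff₀ hθ0, hβ, div_mul_eq_mul_div, div_mul_eq_mul_div,
        le_div_iff₀ (by positivity)]
      nlinarith [mul_le_mul_of_nonneg_left this (mul_pos hδ hθ0).le]
    rw [abs_le] at h3
    constructor
    · nlinarith
    · nlinarith [mul_nonneg hβ0.le hE, mul_nonneg (mul_nonneg hβ0.le hE) (sub_nonneg.2 hβ1)]
  -- At most 4θ steps separate k and l, so the energies compare up to the factor exp(8/δ). Summing
  -- over at least θ values of l, with total mass at most 1, bounds θ times the energy at k.
  have hcomp : ∀ l ∈ Finset.Icc (0 : ℤ) ⌊θ⌋, energy θ J k ≤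
      Real.exp (8 / δ) * (2 * (J l ^ 2 + J (l + 1) ^ 2)) := by
    intro l hl
    rw [Finset.mem_Icc, Int.le_floor] at hl
    have hl0 : (0 : ℝ) ≤ l := by exact_mod_cast hl.1
    have hlb : |(l : ℝ)| ≤ (2 - δ) * θ := by
      rw [abs_of_nonneg hl0]; nlinarith
    have h1 := le_pow_mul_of_step_le (by positivity : 0 ≤ 1 + 2 * β) hstep hk hlb
    have hElow : 0 ≤ energy θ J l := le_trans (by positivity) (mul_sq_add_sq_le_energy hθ0 J hlb)
    have hE2 : energy θ J l ≤ 2 * (J l ^ 2 + J (l + 1) ^ 2) := by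
      have hc := abs_div_le_of_bulk hθ0 hlb
      have h2 : -((l : ℝ) / θ * (J l * J (l + 1))) ≤ 2 * |J l * J (l + 1)| := by
        refine (neg_le_abs _).trans ?_
        rw [abs_mul]
        gcongr
        linarith
      have h3 : |J l * J (l + 1)| ≤ (J l ^ 2 + J (l + 1) ^ 2) / 2 := by
        rw [abs_le]
        constructor <;> nlinarith [sq_nonneg (J l - J (l + 1)), sq_nonneg (J l + J (l + 1))]
      unfold energy
      linarith
    have hpow : (1 + 2 * β) ^ (k - l).natAbs ≤ Real.exp (8 / δ) := by
      have e1 : 1 + 2 * β ≤ Real.exp (2 * β) := by linarith [Real.add_one_le_exp (2 * β)]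
      calc (1 + 2 * β) ^ (k - l).natAbs ≤ Real.exp (2 * β) ^ (k - l).natAbs := by gcongr
        _ = Real.exp ((k - l).natAbs * (2 * β)) := (Real.exp_nat_mul _ _).symm
        _ ≤ Real.exp (8 / δ) := by
          apply Real.exp_le_exp.2
          have h4 : (((k - l).natAbs : ℕ) : ℝ) ≤ 4 * θ := by
            rw [Nat.cast_natAbs]
            push_cast
            refine (abs_sub _ _).trans ?_
            nlinarith
          calc (((k - l).natAbs : ℕ) : ℝ) * (2 * β) ≤ 4 * θ * (2 * β) := by gcongr
            _ = 8 / δ := by rw [hβ]; field_simp; ring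
    exact h1.trans (mul_le_mul hpow hE2 hElow (Real.exp_pos _).le)
  have hsum := Finset.sum_le_sum hcomp
  rw [Finset.sum_const, ← Finset.mul_sum, ← Finset.mul_sum, Finset.sum_add_distrib,
    nsmul_eq_mul] at hsum
  have hcard : θ ≤ ((Finset.Icc (0 : ℤ) ⌊θ⌋).card : ℝ) := by
    rw [Int.card_Icc, sub_zero]
    have h0 : 0 ≤ ⌊θ⌋ := Int.floor_nonneg.2 hθ0.le
    have h1 : (((⌊θ⌋ + 1).toNat : ℤ) : ℝ) = (⌊θ⌋ : ℝ) + 1 := by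
      rw [Int.toNat_of_nonneg (by omega)]; push_cast; ring
    have h2 := (Int.lt_floor_add_one θ).le
    rw [← h1] at h2
    exact_mod_cast h2
  have hE := mul_sq_add_sq_le_energy hθ0 J hk
  have hE0 : 0 ≤ energy θ J k := le_trans (by positivity) hE
  have hb : θ * energy θ J k ≤ 4 * Real.exp (8 / δ) := by
    have h1 := hJ.sum_sq_le (Finset.Icc 0 ⌊θ⌋)
    have h2 := hJ.sum_sq_succ_le (Finset.Icc 0 ⌊θ⌋)
    have h3 : Real.exp (8 / δ) * (2 * (∑ i ∈ Finset.Icc 0 ⌊θ⌋, J i ^ 2 +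
        ∑ i ∈ Finset.Icc 0 ⌊θ⌋, J (i + 1) ^ 2)) ≤ Real.exp (8 / δ) * 4 := by
      gcongr; linarith
    have h4 := mul_le_mul_of_nonneg_right hcard hE0
    linarith
  have h1 : J k ^ 2 ≤ 2 / δ * energy θ J k := by
    rw [div_mul_eq_mul_div, le_div_iff₀ hδ]
    nlinarith [sq_nonneg (J (k + 1))]
  calc θ * J k ^ 2 ≤ θ * (2 / δ * energy θ J k) := by gcongr
    _ = 2 / δ * (θ * energy θ J k) := by ring
    _ ≤ _ := by gcongr

/-! ### Calculus of √(4 - c²) away from c = ±2. -/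

theorem abs_sub_sub_mul_le_of_deriv_lipschitz {f f' : ℝ → ℝ} {s : Set ℝ} (hs : Convex ℝ s) {L : ℝ}
    (hL : 0 ≤ L) (hf : ∀ x ∈ s, HasDerivAt f (f' x) x)
    (hf' : ∀ x ∈ s, ∀ y ∈ s, |f' x - f' y| ≤ L * |x - y|) {x y : ℝ} (hx : x ∈ s) (hy : y ∈ s) :
    |f x - f y - f' y * (x - y)| ≤ L * (x - y) ^ 2 := by
  have hsub : Set.uIcc y x ⊆ s := by
    rw [← segment_eq_uIcc]; exact hs.segment_subset hy hx
  have h := (convex_uIcc y x).norm_image_sub_le_of_norm_hasDerivWithin_le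
    (f := fun z => f z - f' y * z) (f' := fun z => f' z - f' y) (C := L * |x - y|)
    (fun z hz => (((hf z (hsub hz)).sub ((hasDerivAt_id z).const_mul (f' y))).congr_deriv
      (by simp)).hasDerivWithinAt) (fun z hz => ?_) Set.left_mem_uIcc Set.right_mem_uIcc
  · rw [Real.norm_eq_abs, Real.norm_eq_abs, mul_assoc, ← sq, sq_abs] at h
    convert h using 2
    ring
  · refine (hf' z (hsub hz) y hy).trans ?_
    gcongr L * ?_
    exact Set.abs_sub_left_of_mem_uIcc hz

theorem exists_lipschitz_bound {f : ℝ → ℝ} {a b : ℝ} (hf : ContDiffOn ℝ 1 f (Set.Icc a b)) :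
    ∃ L ≥ 0, (∀ x ∈ Set.Icc a b, |f x| ≤ L) ∧
      ∀ x ∈ Set.Icc a b, ∀ y ∈ Set.Icc a b, |f x - f y| ≤ L * |x - y| := by
  obtain ⟨K, hK⟩ := hf.exists_lipschitzOnWith one_ne_zero (convex_Icc a b) isCompact_Icc
  obtain ⟨B, hB⟩ := isCompact_Icc.exists_bound_of_continuousOn hf.continuousOn
  refine ⟨max K B, le_max_of_le_left K.2, fun x hx => (hB x hx).trans (le_max_right _ _),
    fun x hx y hy => ?_⟩
  have := hK.dist_le_mul x hx y hy
  rw [Real.dist_eq, Real.dist_eq] at this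
  exact this.trans (mul_le_mul_of_nonneg_right (le_max_left _ _) (abs_nonneg _))

/-- `√(4 - c²)`, which is `2 sin α` for `c = 2 cos α`. -/
noncomputable def arcHeight (c : ℝ) : ℝ := √(4 - c ^ 2)

/-- The derivative of `c ↦ (arcHeight c)⁻¹`. -/
noncomputable def arcHeightInvDeriv (c : ℝ) : ℝ := c * (arcHeight c)⁻¹ ^ 3

/-- A primitive of `arcHeight`. -/
noncomputable def arcHeightPrimitive (c : ℝ) : ℝ := c * arcHeight c / 2 + 2 * Real.arcsin (c / 2)

theorem four_sub_sq_pos {c : ℝ} (hc : |c| < 2) : 0 < 4 - c ^ 2 := by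
  rw [abs_lt] at hc; nlinarith

theorem arcHeight_pos {c : ℝ} (hc : |c| < 2) : 0 < arcHeight c :=
  Real.sqrt_pos.2 (four_sub_sq_pos hc)

theorem arcHeight_sq {c : ℝ} (hc : |c| < 2) : arcHeight c ^ 2 = 4 - c ^ 2 :=
  Real.sq_sqrt (four_sub_sq_pos hc).le

theorem hasDerivAt_arcHeight {c : ℝ} (hc : |c| < 2) :
    HasDerivAt arcHeight (-c * (arcHeight c)⁻¹) c := by
  have h : HasDerivAt (fun c : ℝ => 4 - c ^ 2) (-(2 * c)) c :=
    ((hasDerivAt_pow 2 c).const_sub 4).congr_deriv (by simp)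
  refine (h.sqrt (four_sub_sq_pos hc).ne').congr_deriv ?_
  have := arcHeight_pos hc
  unfold arcHeight at this ⊢
  field_simp

theorem hasDerivAt_inv_arcHeight {c : ℝ} (hc : |c| < 2) :
    HasDerivAt (fun c => (arcHeight c)⁻¹) (arcHeightInvDeriv c) c := by
  have := arcHeight_pos hc
  refine ((hasDerivAt_arcHeight hc).inv this.ne').congr_deriv ?_
  unfold arcHeightInvDeriv
  field_simp

theorem hasDerivAt_arcsin_half {c : ℝ} (hc : |c| < 2) :
    HasDerivAt (fun c => Real.arcsin (c / 2)) (arcHeight c)⁻¹ c := by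
  have hc' := abs_lt.1 hc
  have h1 : c / 2 ≠ -1 := by intro h; linarith
  have h2 : c / 2 ≠ 1 := by intro h; linarith
  refine ((Real.hasDerivAt_arcsin h1 h2).comp c ((hasDerivAt_id c).div_const 2)).congr_deriv ?_
  have h3 : √(1 - (c / 2) ^ 2) = arcHeight c / 2 := by
    rw [show 1 - (c / 2) ^ 2 = (4 - c ^ 2) / 2 ^ 2 by ring, Real.sqrt_div' _ (by norm_num),
      Real.sqrt_sq two_pos.le]
    rfl
  rw [h3]
  have := arcHeight_pos hc
  field_simp

theorem hasDerivAt_arcHeightPrimitive {c : ℝ} (hc : |c| < 2) :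
    HasDerivAt arcHeightPrimitive (arcHeight c) c := by
  refine ((((hasDerivAt_id c).mul (hasDerivAt_arcHeight hc)).div_const 2).add
    ((hasDerivAt_arcsin_half hc).const_mul 2)).congr_deriv ?_
  have h1 := arcHeight_pos hc
  have h2 := arcHeight_sq hc
  simp only [id]
  field_simp
  linarith

theorem abs_arcHeightPrimitive_le {c : ℝ} (hc : |c| ≤ 2) : |arcHeightPrimitive c| ≤ Real.pi := by
  have hmono : MonotoneOn arcHeightPrimitive (Set.Icc (-2) 2) := by
    refine monotoneOn_of_deriv_nonneg (convex_Icc _ _) ?_ ?_ ?_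
    · unfold arcHeightPrimitive arcHeight
      exact (((continuous_id.mul (by fun_prop)).div_const 2).add
        (continuous_const.mul (Real.continuous_arcsin.comp (by fun_prop)))).continuousOn
    · intro x hx
      rw [interior_Icc] at hx
      exact (hasDerivAt_arcHeightPrimitive
        (abs_lt.2 hx)).differentiableAt.differentiableWithinAt
    · intro x hx
      rw [interior_Icc] at hx
      rw [(hasDerivAt_arcHeightPrimitive (abs_lt.2 hx)).deriv]
      exact Real.sqrt_nonneg _
  have h2 : arcHeightPrimitive 2 = Real.pi := by
    simp [arcHeightPrimitive, arcHeight]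
    norm_num
    ring
  have h3 : arcHeightPrimitive (-2) = -Real.pi := by
    simp [arcHeightPrimitive, arcHeight]
    norm_num
    ring
  have hm := abs_le.1 hc
  rw [abs_le]
  exact ⟨h3 ▸ hmono (by norm_num) hm hm.1, h2 ▸ hmono hm (by norm_num) hm.2⟩

theorem contDiffOn_arcHeight {δ : ℝ} (hδ : 0 < δ) :
    ContDiffOn ℝ 1 arcHeight (Set.Icc (-(2 - δ)) (2 - δ)) := by
  intro c hc
  have : |c| < 2 := (abs_le.2 hc).trans_lt (by linarith)
  have h : ContDiffAt ℝ 1 (fun c : ℝ => √(4 - c ^ 2)) c :=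
    ContDiffAt.sqrt (by fun_prop) (four_sub_sq_pos this).ne'
  exact h.contDiffWithinAt

/-- The smooth weights on the bulk, with constants that depend on the bulk only. -/
structure ArcBound (δ L : ℝ) : Prop where
  nonneg : 0 ≤ L
  inv_le : ∀ c, |c| ≤ 2 - δ → |(arcHeight c)⁻¹| ≤ L
  deriv_le : ∀ c, |c| ≤ 2 - δ → |arcHeightInvDeriv c| ≤ L
  inv_sub : ∀ c c', |c| ≤ 2 - δ → |c'| ≤ 2 - δ → |(arcHeight c)⁻¹ - (arcHeight c')⁻¹| ≤ L * |c - c'|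
  deriv_sub : ∀ c c', |c| ≤ 2 - δ → |c'| ≤ 2 - δ →
    |arcHeightInvDeriv c - arcHeightInvDeriv c'| ≤ L * |c - c'|
  inv_taylor : ∀ c c', |c| ≤ 2 - δ → |c'| ≤ 2 - δ →
    |(arcHeight c)⁻¹ - (arcHeight c')⁻¹ - arcHeightInvDeriv c' * (c - c')| ≤ L * (c - c') ^ 2
  arcsin_taylor : ∀ c c', |c| ≤ 2 - δ → |c'| ≤ 2 - δ →
    |Real.arcsin (c / 2) - Real.arcsin (c' / 2) - (arcHeight c')⁻¹ * (c - c')| ≤ L * (c - c') ^ 2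
  primitive_taylor : ∀ c c', |c| ≤ 2 - δ → |c'| ≤ 2 - δ →
    |arcHeightPrimitive c - arcHeightPrimitive c' - arcHeight c' * (c - c')| ≤ L * (c - c') ^ 2

/-- `arcHeight`, its inverse and `arcHeightInvDeriv` are C¹ on a compact interval inside (-2, 2),
and each Taylor estimate needs only a Lipschitz derivative; the sum of the three constants serves
everywhere. -/
theorem exists_arcBound {δ : ℝ} (hδ : 0 < δ) : ∃ L, ArcBound δ L := by
  have hlt : ∀ c ∈ Set.Icc (-(2 - δ)) (2 - δ), |c| < 2 := fun c hc =>
    (abs_le.2 hc).trans_lt (by linarith)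
  have h1 := contDiffOn_arcHeight hδ
  have h2 : ContDiffOn ℝ 1 (fun c => (arcHeight c)⁻¹) (Set.Icc (-(2 - δ)) (2 - δ)) :=
    h1.inv fun c hc => (arcHeight_pos (hlt c hc)).ne'
  have h3 : ContDiffOn ℝ 1 arcHeightInvDeriv (Set.Icc (-(2 - δ)) (2 - δ)) :=
    contDiffOn_id.mul (h2.pow 3)
  obtain ⟨L1, h1n, -, h1l⟩ := exists_lipschitz_bound h1
  obtain ⟨L2, h2n, h2b, h2l⟩ := exists_lipschitz_bound h2
  obtain ⟨L3, h3n, h3b, h3l⟩ := exists_lipschitz_bound h3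
  have hx : Convex ℝ (Set.Icc (-(2 - δ)) (2 - δ)) := convex_Icc _ _
  have m : ∀ c, |c| ≤ 2 - δ → c ∈ Set.Icc (-(2 - δ)) (2 - δ) := fun c hc => abs_le.1 hc
  have t1 := fun (c c' : ℝ) (hc : |c| ≤ 2 - δ) (hc' : |c'| ≤ 2 - δ) =>
    abs_sub_sub_mul_le_of_deriv_lipschitz hx h3n
      (fun x h => hasDerivAt_inv_arcHeight (hlt x h)) h3l (m c hc) (m c' hc')
  have t2 := fun (c c' : ℝ) (hc : |c| ≤ 2 - δ) (hc' : |c'| ≤ 2 - δ) =>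
    abs_sub_sub_mul_le_of_deriv_lipschitz hx h2n
      (fun x h => hasDerivAt_arcsin_half (hlt x h)) h2l (m c hc) (m c' hc')
  have t3 := fun (c c' : ℝ) (hc : |c| ≤ 2 - δ) (hc' : |c'| ≤ 2 - δ) =>
    abs_sub_sub_mul_le_of_deriv_lipschitz hx h1n
      (fun x h => hasDerivAt_arcHeightPrimitive (hlt x h)) h1l (m c hc) (m c' hc')
  have e1 : L1 ≤ L1 + L2 + L3 := by linarith
  have e2 : L2 ≤ L1 + L2 + L3 := by linarith
  have e3 : L3 ≤ L1 + L2 + L3 := by linarith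
  exact ⟨L1 + L2 + L3, by positivity, fun c hc => (h2b c (m c hc)).trans e2,
    fun c hc => (h3b c (m c hc)).trans e3,
    fun c c' hc hc' => (h2l c (m c hc) c' (m c' hc')).trans
      (mul_le_mul_of_nonneg_right e2 (abs_nonneg _)),
    fun c c' hc hc' => (h3l c (m c hc) c' (m c' hc')).trans
      (mul_le_mul_of_nonneg_right e3 (abs_nonneg _)),
    fun c c' hc hc' => (t1 c c' hc hc').trans (mul_le_mul_of_nonneg_right e3 (sq_nonneg _)),
    fun c c' hc hc' => (t2 c c' hc hc').trans (mul_le_mul_of_nonneg_right e2 (sq_nonneg _)),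
    fun c c' hc hc' => (t3 c c' hc hc').trans (mul_le_mul_of_nonneg_right e1 (sq_nonneg _))⟩

/-! ### The adiabatic invariant and the local size of J_k². -/

theorem abs_mul_le_of_sq_le {a b B : ℝ} (ha : a ^ 2 ≤ B) (hb : b ^ 2 ≤ B) : |a * b| ≤ B := by
  rw [abs_le]
  constructor <;> nlinarith [sq_nonneg (a - b), sq_nonneg (a + b)]

/-- Widening the bulk from δ to δ/2 makes the neighbours k + t admissible once θ ≥ 4/δ. -/
theorem exists_sq_le_of_bulk {δ : ℝ} (hδ : 0 < δ) (hδ1 : δ ≤ 1) :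
    ∃ C > 0, ∃ θ₀ ≥ 1, ∀ θ ≥ θ₀, ∀ J, IsBesselSeq θ J → ∀ k : ℤ, |(k : ℝ)| ≤ (2 - δ) * θ →
      ∀ t : ℤ, |t| ≤ 2 → |((k + t : ℤ) : ℝ)| ≤ (2 - δ / 2) * θ ∧ J (k + t) ^ 2 ≤ C / θ := by
  obtain ⟨C, hC, θ₀, hθ₀, h⟩ := exists_mul_sq_le_of_bulk (half_pos hδ) (by linarith)
  refine ⟨C, hC, max (max 1 θ₀) (4 / δ), le_max_of_le_left (le_max_left _ _),
    fun θ hθ J hJ k hk t ht => ?_⟩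
  have h1 : 1 ≤ θ := (le_max_left _ _).trans ((le_max_left _ _).trans hθ)
  have hb : |((k + t : ℤ) : ℝ)| ≤ (2 - δ / 2) * θ := by
    push_cast
    exact abs_le_of_bulk_half hδ ((le_max_right _ _).trans hθ) hk (by exact_mod_cast ht)
  refine ⟨hb, ?_⟩
  rw [le_div_iff₀ (by linarith), mul_comm]
  exact h θ (((le_max_right _ _).trans (le_max_left _ _)).trans hθ) J hJ _ hb

/-- The correction that turns `energy / arcHeight` into an adiabatic invariant. -/
noncomputable def invariantFlux (θ : ℝ) (J : ℤ → ℝ) (k : ℤ) : ℝ :=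
  arcHeightInvDeriv (k / θ) * energyFlux θ J k + (arcHeight (k / θ))⁻¹ / 2 * (J (k - 1) * J k)

/-- Let h be `arcHeight`. By J_{k-1} J_k + J_k J_{k+1} = c J_k² and `sq_eq_energy_add`, the mean
drift of the energy is proportional to the energy, and (4 - c²)(1/h)' = c/h makes the weight 1/h
cancel it. The oscillating rest is carried by the flux correction, so the right side is of second
order in 1/θ. The values `A0`, `A1`, `b1` at neighbouring points are free here, because only `A` and
`b` enter the cancellation. -/
theorem IsBesselSeq.invariant_step {θ : ℝ} {J : ℤ → ℝ} (hJ : IsBesselSeq θ J) (hθ : θ ≠ 0) (k : ℤ)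
    (hk : |(k : ℝ) / θ| < 2) {A0 A A1 b b1 : ℝ} (hA : A = (arcHeight (k / θ))⁻¹)
    (hb : b = arcHeightInvDeriv (k / θ)) :
    (energy θ J k * A - (b1 * energyFlux θ J (k + 1) + A1 / 2 * (J k * J (k + 1))) / θ) -
      (energy θ J (k - 1) * A0 - (b * energyFlux θ J k + A / 2 * (J (k - 1) * J k)) / θ) =
    energy θ J k * (A - A0 - b / θ) + J (k - 1) * J k * (A - A0) / θ +
      (-(b1 - b) * energyFlux θ J (k + 1) - (A1 - A) / 2 * (J k * J (k + 1)) +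
        b * (J k * J (k + 1)) / (2 * θ)) / θ := by
  have e1 := hJ.energy_succ hθ (k - 1)
  rw [sub_add_cancel] at e1
  have e2 := sq_eq_energy_add hθ J k
  have e3 := hJ.add_eq hθ k
  rw [e3, sub_self, mul_zero, add_zero] at e2
  have hp := arcHeight_pos hk
  have e4 : b * (4 - (k / θ) ^ 2) = k / θ * A := by
    rw [hA, hb, ← arcHeight_sq hk, arcHeightInvDeriv]
    field_simp
  have e5 : J (k - 1) * J k + J k * J (k + 1) = k / θ * J k ^ 2 := by
    linear_combination J k * e3
  have e6 : energy θ J (k - 1) = energy θ J k + J (k - 1) * J k / θ := by linarith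
  rw [e6]
  linear_combination (-b / θ) * e2 + J k ^ 2 / (2 * θ) * e4 - A / (2 * θ) * e5

/-- `energy / arcHeight` is an adiabatic invariant in the bulk. -/
theorem exists_abs_energy_mul_sub_le {δ : ℝ} (hδ : 0 < δ) (hδ1 : δ ≤ 1) :
    ∃ C > 0, ∃ θ₀ ≥ 1, ∀ θ ≥ θ₀, ∀ J, IsBesselSeq θ J → ∀ k l : ℤ, |(k : ℝ)| ≤ (2 - δ) * θ →
      |(l : ℝ)| ≤ (2 - δ) * θ →
      |θ * energy θ J k * (arcHeight (k / θ))⁻¹ - θ * energy θ J l * (arcHeight (l / θ))⁻¹| ≤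
        C / θ := by
  obtain ⟨C, hC, θ₀, hθ₀, hbd⟩ := exists_sq_le_of_bulk hδ hδ1
  obtain ⟨L, hL⟩ := exists_arcBound (half_pos hδ)
  have hL0 := hL.nonneg
  refine ⟨37 * L * C + 1, by positivity, θ₀, hθ₀, fun θ hθ J hJ k l hk hl => ?_⟩
  have hθ1 : 1 ≤ θ := hθ₀.trans hθ
  have hθ0 : 0 < θ := by linarith
  set B := C / θ with hB
  have hB0 : 0 < B := by positivity
  have hsq : ∀ k : ℤ, |(k : ℝ)| ≤ (2 - δ) * θ → ∀ t : ℤ, |t| ≤ 2 → J (k + t) ^ 2 ≤ B :=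
    fun k hk t ht => (hbd θ hθ J hJ k hk t ht).2
  have hc : ∀ k : ℤ, |(k : ℝ)| ≤ (2 - δ) * θ → ∀ t : ℤ, |t| ≤ 2 →
      |((k + t : ℤ) : ℝ) / θ| ≤ 2 - δ / 2 := fun k hk t ht =>
    abs_div_le_of_bulk hθ0 (hbd θ hθ J hJ k hk t ht).1
  have h2θ : ∀ k : ℤ, |(k : ℝ)| ≤ (2 - δ) * θ → ∀ t : ℤ, |t| ≤ 2 →
      |((k + t : ℤ) : ℝ)| ≤ 2 * θ := fun k hk t ht =>
    (hbd θ hθ J hJ k hk t ht).1.trans (by nlinarith)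
  -- The corrected invariant changes by 8LB/θ² per step. Over at most 4θ steps, after multiplication
  -- by θ, this is 32LB; the two flux corrections add 5LB, whence 37.
  set f : ℤ → ℝ := fun k => energy θ J k * (arcHeight (k / θ))⁻¹ -
    invariantFlux θ J (k + 1) / θ with hf
  have hfl : ∀ k : ℤ, |(k : ℝ)| ≤ (2 - δ) * θ → ∀ t : ℤ, |t| ≤ 1 →
      |energyFlux θ J (k + t)| ≤ 2 * B := fun k hk t ht => by
    refine abs_energyFlux_le hθ0 J (h2θ k hk t (by omega)) (hsq k hk t (by omega)) ?_
    rw [add_sub_assoc]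
    refine hsq k hk _ ?_
    rw [abs_le] at ht ⊢; omega
  have hstep : ∀ k : ℤ, |(k : ℝ)| ≤ (2 - δ) * θ → |(k : ℝ) + 1| ≤ (2 - δ) * θ →
      |f (k + 1) - f k| ≤ 8 * L * B / θ ^ 2 := by
    intro m hm' hm
    obtain ⟨k, rfl⟩ : ∃ k : ℤ, m = k - 1 := ⟨m + 1, by ring⟩
    have hk : |(k : ℝ)| ≤ (2 - δ) * θ := by push_cast at hm; simpa using hm
    have hc0 : |(k : ℝ) / θ| ≤ 2 - δ / 2 := by simpa using hc k hk 0 (by norm_num)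
    have hcm : |((k - 1 : ℤ) : ℝ) / θ| ≤ 2 - δ / 2 := hc k hk (-1) (by norm_num)
    have hcp : |((k + 1 : ℤ) : ℝ) / θ| ≤ 2 - δ / 2 := hc k hk 1 (by norm_num)
    have hid := hJ.invariant_step hθ0.ne' k (hc0.trans_lt (by linarith))
      (A0 := (arcHeight ((k - 1 : ℤ) / θ))⁻¹) (A1 := (arcHeight ((k + 1 : ℤ) / θ))⁻¹)
      (b1 := arcHeightInvDeriv ((k + 1 : ℤ) / θ)) rfl rfl
    refine (congrArg abs (Eq.trans ?_ hid)).trans_le ?_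
    · simp only [hf, invariantFlux, sub_add_cancel, add_sub_cancel_right]
    have d1 : ((k : ℝ) / θ - ((k - 1 : ℤ) : ℝ) / θ) = 1 / θ := by push_cast; ring
    have d2 : (((k + 1 : ℤ) : ℝ) / θ - (k : ℝ) / θ) = 1 / θ := by push_cast; ring
    have d3 : (((k - 1 : ℤ) : ℝ) / θ - (k : ℝ) / θ) = -(1 / θ) := by push_cast; ring
    have a1 := hL.inv_taylor _ _ hcm hc0
    have a2 := hL.inv_sub _ _ hc0 hcm
    have a3 := hL.inv_sub _ _ hcp hc0
    have a4 := hL.deriv_sub _ _ hcp hc0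
    have a5 := hL.deriv_le _ hc0
    rw [d3, ← abs_neg] at a1
    rw [d1, abs_of_pos (by positivity : 0 < 1 / θ)] at a2
    rw [d2, abs_of_pos (by positivity : 0 < 1 / θ)] at a3 a4
    have E := abs_energy_le (B := B) hθ0 J (by simpa using h2θ k hk 0 (by norm_num))
      (by simpa using hsq k hk 0 (by norm_num)) (hsq k hk 1 (by norm_num))
    have p0 : |J (k - 1) * J k| ≤ B := abs_mul_le_of_sq_le (hsq k hk (-1) (by norm_num))
      (by simpa using hsq k hk 0 (by norm_num))
    have p1 : |J k * J (k + 1)| ≤ B := abs_mul_le_of_sq_le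
      (by simpa using hsq k hk 0 (by norm_num)) (hsq k hk 1 (by norm_num))
    have F1 := hfl k hk 1 (by norm_num)
    set A := (arcHeight (k / θ))⁻¹
    set A0 := (arcHeight ((k - 1 : ℤ) / θ))⁻¹
    set A1 := (arcHeight ((k + 1 : ℤ) / θ))⁻¹
    set b := arcHeightInvDeriv (k / θ)
    set b1 := arcHeightInvDeriv ((k + 1 : ℤ) / θ)
    have t1 : |energy θ J k * (A - A0 - b / θ)| ≤ 4 * B * (L * (-(1 / θ)) ^ 2) := by
      rw [show A - A0 - b / θ = -(A0 - A - b * -(1 / θ)) by ring, abs_mul]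
      gcongr
    have t2 : |J (k - 1) * J k * (A - A0) / θ| ≤ B * (L * (1 / θ)) / θ := by
      rw [abs_div, abs_of_pos hθ0, abs_mul]; gcongr
    have t3 : |-(b1 - b) * energyFlux θ J (k + 1)| ≤ L * (1 / θ) * (2 * B) := by
      rw [abs_mul, abs_neg]; gcongr
    have t4 : |(A1 - A) / 2 * (J k * J (k + 1))| ≤ L * (1 / θ) / 2 * B := by
      rw [abs_mul, abs_div, abs_two]; gcongr
    have t5 : |b * (J k * J (k + 1)) / (2 * θ)| ≤ L * B / (2 * θ) := by
      rw [abs_div, abs_of_pos (by positivity : 0 < 2 * θ), abs_mul]; gcongr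
    have t6 : |(-(b1 - b) * energyFlux θ J (k + 1) - (A1 - A) / 2 * (J k * J (k + 1)) +
        b * (J k * J (k + 1)) / (2 * θ)) / θ| ≤
        (L * (1 / θ) * (2 * B) + L * (1 / θ) / 2 * B + L * B / (2 * θ)) / θ := by
      rw [abs_div, abs_of_pos hθ0]
      gcongr
      refine (abs_add_le _ _).trans (add_le_add ((abs_sub _ _).trans (add_le_add t3 t4)) t5)
    refine (abs_add_le _ _).trans ((add_le_add ((abs_add_le _ _).trans
      (add_le_add t1 t2)) t6).trans (le_of_eq ?_))
    field_simp
    ring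
  have hY : ∀ k : ℤ, |(k : ℝ)| ≤ (2 - δ) * θ → |invariantFlux θ J (k + 1)| ≤ 5 / 2 * L * B := by
    intro k hk
    have hcp : |((k + 1 : ℤ) : ℝ) / θ| ≤ 2 - δ / 2 := hc k hk 1 (by norm_num)
    have p1 : |J k * J (k + 1)| ≤ B := abs_mul_le_of_sq_le
      (by simpa using hsq k hk 0 (by norm_num)) (hsq k hk 1 (by norm_num))
    have F1 := hfl k hk 1 (by norm_num)
    have a5 := hL.deriv_le _ hcp
    have a6 := hL.inv_le _ hcp
    unfold invariantFlux
    rw [add_sub_cancel_right]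
    have t1 : |arcHeightInvDeriv ((k + 1 : ℤ) / θ) * energyFlux θ J (k + 1)| ≤ L * (2 * B) := by
      rw [abs_mul]; gcongr
    have t2 : |(arcHeight ((k + 1 : ℤ) / θ))⁻¹ / 2 * (J k * J (k + 1))| ≤ L / 2 * B := by
      rw [abs_mul, abs_div, abs_two]; gcongr
    refine (abs_add_le _ _).trans ((add_le_add t1 t2).trans (le_of_eq (by ring)))
  have hmain := abs_sub_le_of_abs_step_le hstep hk hl
  have hkl : |(k : ℝ) - l| ≤ 4 * θ := (abs_sub _ _).trans (by nlinarith)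
  have hm2 : |f k - f l| ≤ 32 * L * B / θ := by
    refine (hmain.trans (mul_le_mul_of_nonneg_left hkl (by positivity))).trans (le_of_eq ?_)
    field_simp
    ring
  have hYk := hY k hk
  have hYl := hY l hl
  have hid : θ * energy θ J k * (arcHeight (k / θ))⁻¹ - θ * energy θ J l * (arcHeight (l / θ))⁻¹ =
      θ * (f k - f l) + (invariantFlux θ J (k + 1) - invariantFlux θ J (l + 1)) := by
    simp only [hf]
    field_simp
    ring
  rw [hid]
  have hfin : |θ * (f k - f l)| ≤ θ * (32 * L * B / θ) := by
    rw [abs_mul, abs_of_pos hθ0]; gcongr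
  calc _ ≤ θ * (32 * L * B / θ) + (5 / 2 * L * B + 5 / 2 * L * B) :=
        (abs_add_le _ _).trans (add_le_add hfin ((abs_sub _ _).trans (add_le_add hYk hYl)))
    _ = 37 * L * C / θ := by rw [hB]; field_simp; ring
    _ ≤ (37 * L * C + 1) / θ := by gcongr; linarith

theorem arcHeight_zero : arcHeight 0 = 2 := by
  rw [arcHeight, show (4 : ℝ) - 0 ^ 2 = 2 ^ 2 by norm_num, Real.sqrt_sq two_pos.le]

/-- The oscillating term in the expansion of `θ J_k(2θ)²`. -/
noncomputable def sqFlux (θ : ℝ) (J : ℤ → ℝ) (k : ℤ) : ℝ :=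
  2 * (arcHeight (k / θ))⁻¹ ^ 2 * θ * energyFlux θ J k

/-- Multiply `sq_eq_energy_add` by 2θ/h² with h² = 4 - c², and replace θ E_k / h by its value at 0,
where h = 2. Moving the flux weight from k to k + 1 costs O(1/θ). -/
theorem exists_abs_mul_sq_sub_le {δ : ℝ} (hδ : 0 < δ) (hδ1 : δ ≤ 1) :
    ∃ C > 0, ∃ θ₀ ≥ 1, ∀ θ ≥ θ₀, ∀ J, IsBesselSeq θ J → |θ * energy θ J 0 / 2| ≤ C ∧
      ∀ k : ℤ, |(k : ℝ)| ≤ (2 - δ) * θ → |sqFlux θ J k| ≤ C ∧ |sqFlux θ J (k + 1)| ≤ C ∧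
      |θ * J k ^ 2 - (2 * (arcHeight (k / θ))⁻¹ * (θ * energy θ J 0 / 2) +
        (sqFlux θ J k - sqFlux θ J (k + 1)))| ≤ C / θ := by
  obtain ⟨C, hC, θ₀, hθ₀, hbd⟩ := exists_sq_le_of_bulk hδ hδ1
  obtain ⟨C1, hC1, θ₁, hθ₁, hinv⟩ := exists_abs_energy_mul_sub_le hδ hδ1
  obtain ⟨L, hL⟩ := exists_arcBound (half_pos hδ)
  have hL0 := hL.nonneg
  refine ⟨2 * L * C1 + 9 * L ^ 2 * C + 2 * C, by positivity, max θ₀ θ₁, le_max_of_le_left hθ₀,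
    fun θ hθ J hJ => ?_⟩
  have hθ1 : 1 ≤ θ := hθ₀.trans ((le_max_left _ _).trans hθ)
  have hθ0 : 0 < θ := by linarith
  have hbd := hbd θ ((le_max_left _ _).trans hθ) J hJ
  have hinv := hinv θ ((le_max_right _ _).trans hθ) J hJ
  set B := C / θ with hB
  have hB0 : 0 < B := by positivity
  have hθB : θ * B = C := by rw [hB]; field_simp
  have h2θ : ∀ k : ℤ, |(k : ℝ)| ≤ (2 - δ) * θ → ∀ t : ℤ, |t| ≤ 2 →
      |((k + t : ℤ) : ℝ)| ≤ 2 * θ := fun k hk t ht =>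
    (hbd k hk t ht).1.trans (by nlinarith)
  have hz : |((0 : ℤ) : ℝ)| ≤ (2 - δ) * θ := by
    rw [Int.cast_zero, abs_zero]; nlinarith
  have hLC : 0 ≤ L * C1 := by positivity
  have hLC' : 0 ≤ L ^ 2 * C := by positivity
  refine ⟨?_, fun k hk => ?_⟩
  · have E := abs_energy_le (B := B) hθ0 J (by simpa using h2θ 0 hz 0 (by norm_num))
      (by simpa using (hbd 0 hz 0 (by norm_num)).2) (hbd 0 hz 1 (by norm_num)).2
    rw [abs_div, abs_two, abs_mul, abs_of_pos hθ0]
    have := mul_le_mul_of_nonneg_left E hθ0.le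
    linarith
  have hfl : ∀ t : ℤ, |t| ≤ 1 → |energyFlux θ J (k + t)| ≤ 2 * B := fun t ht => by
    refine abs_energyFlux_le hθ0 J (h2θ k hk t (by omega)) (hbd k hk t (by omega)).2 ?_
    rw [add_sub_assoc]
    refine (hbd k hk _ ?_).2
    rw [abs_le] at ht ⊢; omega
  have hf0 : |energyFlux θ J k| ≤ 2 * B := by simpa using hfl 0 (by norm_num)
  have hf1 := hfl 1 (by norm_num)
  have hc0 : |(k : ℝ) / θ| ≤ 2 - δ / 2 := by
    simpa using abs_div_le_of_bulk hθ0 (hbd k hk 0 (by norm_num)).1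
  have hc1 : |((k + 1 : ℤ) : ℝ) / θ| ≤ 2 - δ / 2 :=
    abs_div_le_of_bulk hθ0 (hbd k hk 1 (by norm_num)).1
  have a0 := hL.inv_le _ hc0
  have a1 := hL.inv_le _ hc1
  have a2 := hL.inv_sub _ _ hc1 hc0
  rw [show (((k + 1 : ℤ) : ℝ) / θ - (k : ℝ) / θ) = 1 / θ by push_cast; ring,
    abs_of_pos (by positivity : 0 < 1 / θ)] at a2
  have p1 : |J k * J (k + 1)| ≤ B := abs_mul_le_of_sq_le
    (by simpa using (hbd k hk 0 (by norm_num)).2) (hbd k hk 1 (by norm_num)).2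
  have a3 := hinv k 0 hk hz
  rw [Int.cast_zero, zero_div, arcHeight_zero] at a3
  have e2 := sq_eq_energy_add hθ0.ne' J k
  rw [hJ.add_eq hθ0.ne' k, sub_self, mul_zero, add_zero] at e2
  have hlt : |(k : ℝ) / θ| < 2 := hc0.trans_lt (by linarith)
  have hAs : (arcHeight (k / θ))⁻¹ ^ 2 * (4 - (k / θ) ^ 2) = 1 := by
    have := arcHeight_pos hlt
    rw [← arcHeight_sq hlt]
    field_simp
  unfold sqFlux
  set A := (arcHeight (k / θ))⁻¹
  set A1 := (arcHeight ((k + 1 : ℤ) / θ))⁻¹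
  have hZ : ∀ a F : ℝ, |a| ≤ L → |F| ≤ 2 * B → |2 * a ^ 2 * θ * F| ≤
      2 * L * C1 + 9 * L ^ 2 * C + 2 * C := fun a F ha hF => by
    have h1 : |2 * a ^ 2 * θ * F| ≤ 2 * L ^ 2 * θ * (2 * B) := by
      rw [abs_mul, abs_mul, abs_mul, abs_two, abs_of_pos hθ0, abs_pow]; gcongr
    nlinarith
  refine ⟨hZ _ _ a0 hf0, hZ _ _ a1 hf1, ?_⟩
  have hid : θ * J k ^ 2 - (2 * A * (θ * energy θ J 0 / 2) + (2 * A ^ 2 * θ * energyFlux θ J k -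
      2 * A1 ^ 2 * θ * energyFlux θ J (k + 1))) =
      2 * A * (θ * energy θ J k * A - θ * energy θ J 0 * 2⁻¹) +
      2 * ((A1 - A) * (A1 + A)) * (θ * energyFlux θ J (k + 1)) - A ^ 2 * (J k * J (k + 1)) := by
    have e3 : J k * J (k + 1) / (2 * θ) * θ = J k * J (k + 1) / 2 := by field_simp
    linear_combination 2 * A ^ 2 * θ * e2 - θ * J k ^ 2 * hAs - 2 * A ^ 2 * e3
  rw [hid]
  have t1 : |2 * A * (θ * energy θ J k * A - θ * energy θ J 0 * 2⁻¹)| ≤ 2 * L * (C1 / θ) := by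
    rw [abs_mul, abs_mul, abs_two]; gcongr
  have t2 : |2 * ((A1 - A) * (A1 + A)) * (θ * energyFlux θ J (k + 1))| ≤
      2 * (L * (1 / θ) * (L + L)) * (θ * (2 * B)) := by
    rw [abs_mul, abs_mul, abs_mul, abs_mul, abs_two, abs_of_pos hθ0]
    gcongr
    exact (abs_add_le _ _).trans (add_le_add a1 a0)
  have t3 : |A ^ 2 * (J k * J (k + 1))| ≤ L ^ 2 * B := by
    rw [abs_mul, abs_pow]; gcongr
  refine (abs_sub _ _).trans ((add_le_add ((abs_add_le _ _).trans (add_le_add t1 t2)) t3).trans ?_)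
  have : 2 * L * (C1 / θ) + 2 * (L * (1 / θ) * (L + L)) * (θ * (2 * B)) + L ^ 2 * B =
      (2 * L * C1 + 9 * L ^ 2 * C) / θ := by rw [hB]; field_simp; ring
  rw [this]
  exact (div_le_div_iff_of_pos_right hθ0).2 (by linarith)

/-! ### The value 1/(2π) of the invariant, from the two ℓ² identities. -/

theorem abs_sum_Ico_sub_le {f F : ℤ → ℝ} {ε : ℝ} {a : ℤ} {n : ℕ}
    (h : ∀ k, a ≤ k → k < a + n → |f k - (F (k + 1) - F k)| ≤ ε) :
    |∑ k ∈ Finset.Ico a (a + n), f k - (F (a + n) - F a)| ≤ n * ε := by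
  induction n with
  | zero => simp
  | succ n ih =>
    have hs : Finset.Ico a (a + (n + 1 : ℕ)) = insert (a + (n : ℤ)) (Finset.Ico a (a + n)) := by
      ext k; simp only [Finset.mem_Ico, Finset.mem_insert]; push_cast; omega
    rw [hs, Finset.sum_insert (by simp)]
    have h1 := ih fun k hk hk' => h k hk (by push_cast; omega)
    have h2 := h (a + n) (by omega) (by push_cast; omega)
    push_cast
    rw [← add_assoc]
    rw [abs_le] at h1 h2 ⊢
    constructor <;> linarith

/-- The recurrence identifies (k/θ) J_k with J_{k-1} + J_{k+1}, so the sum is 4·1 - 2. -/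
theorem IsBesselSeq.hasSum_four_sub_sq_mul {θ : ℝ} {J : ℤ → ℝ} (hJ : IsBesselSeq θ J)
    (hθ : θ ≠ 0) : HasSum (fun k : ℤ => (4 - (k / θ) ^ 2) * J k ^ 2) 2 := by
  have h := (hJ.hasSum_sq.mul_left 4).sub hJ.hasSum_sq_add
  norm_num at h
  refine h.congr_fun fun k => ?_
  have := hJ.add_eq hθ k
  rw [add_comm (J (k - 1)), this]
  ring

/-- Outside S the weight 4 - c² is at most 4δ, and negative beyond |c| = 2. Hence no mass estimate
near the turning points is needed. -/
theorem IsBesselSeq.le_sum_four_sub_sq_mul {θ : ℝ} {J : ℤ → ℝ} (hJ : IsBesselSeq θ J)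
    (hθ : 0 < θ) {δ : ℝ} (hδ : 0 < δ) (hδ1 : δ ≤ 1) (S : Finset ℤ)
    (hS : ∀ k ∉ S, (2 - δ) * θ ≤ |(k : ℝ)|) :
    2 - 4 * δ ≤ ∑ k ∈ S, (4 - (k / θ) ^ 2) * J k ^ 2 := by
  have h1 : HasSum (fun k => if k ∈ S then (4 - (k / θ) ^ 2) * J k ^ 2 else 0)
      (∑ k ∈ S, (4 - (k / θ) ^ 2) * J k ^ 2) := by
    rw [← Finset.sum_congr rfl fun k hk => if_pos hk]
    exact hasSum_sum_of_ne_finset_zero fun k hk => if_neg hk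
  have hle : ∀ k : ℤ, (4 - (k / θ) ^ 2) * J k ^ 2 ≤
      (if k ∈ S then (4 - (k / θ) ^ 2) * J k ^ 2 else 0) + 4 * δ * J k ^ 2 := fun k => by
    split_ifs with hk
    · have := sq_nonneg (J k)
      nlinarith
    · rw [zero_add]
      gcongr
      have h3 : 2 - δ ≤ |(k : ℝ) / θ| := by
        rw [abs_div, abs_of_pos hθ, le_div_iff₀ hθ]; exact hS k hk
      rw [← sq_abs]
      nlinarith
  have h2 := hasSum_le hle (hJ.hasSum_four_sub_sq_mul hθ.ne')
    (h1.add (hJ.hasSum_sq.mul_left (4 * δ)))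
  linarith

/-- Both normalizations of the sequence, in terms of the value at `0` of the invariant. -/
theorem exists_energy_zero_bounds {δ : ℝ} (hδ : 0 < δ) (hδ1 : δ ≤ 1) :
    ∃ C > 0, ∃ θ₀ ≥ 1, ∀ θ ≥ θ₀, ∀ J, IsBesselSeq θ J →
      4 * (θ * energy θ J 0 / 2) * Real.arcsin (1 - δ / 2) ≤ 1 + C / θ ∧
      2 - 4 * δ ≤ 4 * Real.pi * (θ * energy θ J 0 / 2) + C / θ := by
  obtain ⟨C, hC, θ₀, hθ₀, hexp⟩ := exists_abs_mul_sq_sub_le (half_pos hδ) (by linarith)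
  obtain ⟨L, hL⟩ := exists_arcBound (half_pos (half_pos hδ))
  have hL0 := hL.nonneg
  refine ⟨6 * (8 * C + 2 * C * L) + 8 * C, by positivity, max θ₀ (4 / (δ / 2)),
    le_max_of_le_left hθ₀, fun θ hθ J hJ => ?_⟩
  have hθ1 : 1 ≤ θ := hθ₀.trans ((le_max_left _ _).trans hθ)
  have hθ0 : 0 < θ := by linarith
  have hθ2 : 4 / (δ / 2) ≤ θ := (le_max_right _ _).trans hθ
  obtain ⟨hG, hexp⟩ := hexp θ ((le_max_left _ _).trans hθ) J hJ
  set G := θ * energy θ J 0 / 2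
  have hG0 : 0 ≤ G := by
    have : 0 ≤ energy θ J 0 := by simp [energy]; positivity
    positivity
  -- Rounding up covers all |k| < (2 - δ)θ, as the weighted identity requires; the overshoot, less
  -- than 1, stays where the expansion with δ/2 is valid.
  set M : ℕ := ⌈(2 - δ) * θ⌉₊ with hM
  have hM1 : (2 - δ) * θ ≤ M := Nat.le_ceil _
  have hM2 : (M : ℝ) < (2 - δ) * θ + 1 := Nat.ceil_lt_add_one (by nlinarith)
  have hδθ : 8 ≤ δ * θ := by
    rw [div_le_iff₀ (half_pos hδ)] at hθ2; linarith
  have hM3 : (M : ℝ) ≤ (2 - δ / 2) * θ := by linarith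
  have hM4 : (M : ℝ) ≤ 3 * θ := by nlinarith
  have hbulk : ∀ k : ℤ, -(M : ℤ) ≤ k → k ≤ M → |(k : ℝ)| ≤ (2 - δ / 2) * θ := fun k h1 h2 =>
    (abs_le.2 ⟨by exact_mod_cast h1, by exact_mod_cast h2⟩ : |(k : ℝ)| ≤ M).trans hM3
  have hquarter : ∀ k : ℤ, |(k : ℝ)| ≤ (2 - δ / 2) * θ →
      |(k : ℝ) / θ| ≤ 2 - δ / 2 / 2 ∧ |((k + 1 : ℤ) : ℝ) / θ| ≤ 2 - δ / 2 / 2 := fun k hk => by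
    have h1 := abs_le_of_bulk_half (half_pos hδ) hθ2 hk (t := 0) (by simp)
    have h2 := abs_le_of_bulk_half (half_pos hδ) hθ2 hk (t := 1) (by norm_num)
    rw [add_zero] at h1
    exact ⟨abs_div_le_of_bulk hθ0 h1, abs_div_le_of_bulk hθ0 (by push_cast; exact h2)⟩
  have hIco : (M : ℤ) = -M + (2 * M : ℕ) := by push_cast; ring
  have hd : ∀ k : ℤ, ((k + 1 : ℤ) : ℝ) / θ - k / θ = 1 / θ := fun k => by push_cast; ring
  have hcount : ((2 * M : ℕ) : ℝ) * ((8 * C + 2 * C * L) * (1 / θ) ^ 2) ≤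
      6 * (8 * C + 2 * C * L) / θ := by
    have : ((2 * M : ℕ) : ℝ) ≤ 6 * θ := by push_cast; linarith
    refine (mul_le_mul_of_nonneg_right this (by positivity)).trans (le_of_eq ?_)
    field_simp
  have hZM := (hexp M (hbulk _ (by omega) le_rfl)).1
  have hZm := (hexp (-M) (hbulk _ le_rfl (by omega))).1
  have hcM : |((M : ℤ) : ℝ) / θ| ≤ 2 := by
    have := (hquarter M (hbulk _ (by omega) le_rfl)).1; linarith
  have hcm : |((-(M : ℤ) : ℤ) : ℝ) / θ| ≤ 2 := by
    have := (hquarter (-M) (hbulk _ le_rfl (by omega))).1; linarith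
  constructor
  -- A discrete primitive of J_k². The bulk carries mass at most 1, and 2G ∫ dc/√(4 - c²) over |c| ≤
  -- 2 - δ equals 4G arcsin(1 - δ/2): the upper bound on G.
  · set F : ℤ → ℝ := fun k => 2 * G * Real.arcsin (k / θ / 2) - sqFlux θ J k / θ with hF
    have hstep : ∀ k : ℤ, -(M : ℤ) ≤ k → k < -(M : ℤ) + (2 * M : ℕ) →
        |J k ^ 2 - (F (k + 1) - F k)| ≤ (8 * C + 2 * C * L) * (1 / θ) ^ 2 := by
      intro k hk1 hk2
      have hb := hbulk k hk1 (by omega)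
      obtain ⟨-, -, he⟩ := hexp k hb
      obtain ⟨hc0, hc1⟩ := hquarter k hb
      have ht := hL.arcsin_taylor _ _ hc1 hc0
      rw [hd] at ht
      set R := θ * J k ^ 2 - (2 * (arcHeight (k / θ))⁻¹ * G + (sqFlux θ J k - sqFlux θ J (k + 1)))
        with hR
      set T := Real.arcsin (((k + 1 : ℤ) : ℝ) / θ / 2) - Real.arcsin (k / θ / 2) -
        (arcHeight (k / θ))⁻¹ * (1 / θ) with hT
      have hid : J k ^ 2 - (F (k + 1) - F k) = R / θ - 2 * G * T := by
        simp only [hF, hR, hT]; field_simp; ring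
      rw [hid]
      have h1 : |R / θ| ≤ C / θ / θ := by rw [abs_div, abs_of_pos hθ0]; gcongr
      have h2 : |2 * G * T| ≤ 2 * C * (L * (1 / θ) ^ 2) := by
        rw [abs_mul, abs_mul, abs_two]; gcongr
      have h3 : C / θ / θ = C * (1 / θ) ^ 2 := by field_simp
      have h4 : 0 ≤ C * (1 / θ) ^ 2 := by positivity
      refine (abs_sub _ _).trans ((add_le_add h1 h2).trans ?_)
      rw [h3]
      linarith
    have hsum := (abs_sum_Ico_sub_le hstep).trans hcount
    rw [← hIco] at hsum
    have h1 := hJ.sum_sq_le (Finset.Ico (-(M : ℤ)) M)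
    have h2 := (abs_le.1 hsum).1
    have h3 : F M - F (-M) = 4 * G * Real.arcsin (M / θ / 2) -
        (sqFlux θ J M - sqFlux θ J (-M)) / θ := by
      simp only [hF]
      push_cast
      rw [neg_div, neg_div, Real.arcsin_neg]
      ring
    have h4 : Real.arcsin (1 - δ / 2) ≤ Real.arcsin (M / θ / 2) := by
      apply Real.monotone_arcsin
      rw [show 1 - δ / 2 = (2 - δ) / 2 by ring]
      gcongr
      rwa [le_div_iff₀ hθ0]
    have h5 : |(sqFlux θ J M - sqFlux θ J (-M)) / θ| ≤ (C + C) / θ := by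
      rw [abs_div, abs_of_pos hθ0]
      gcongr
      exact (abs_sub _ _).trans (add_le_add hZM hZm)
    have h6 := mul_le_mul_of_nonneg_left h4 (by positivity : 0 ≤ 4 * G)
    have h7 : (6 * (8 * C + 2 * C * L) + 8 * C) / θ =
      6 * (8 * C + 2 * C * L) / θ + 3 * ((C + C) / θ) + (C + C) / θ := by ring
    have h8 : 0 ≤ (C + C) / θ := by positivity
    have h9 := (abs_le.1 h5).2
    linarith
  -- With the weight 4 - c² the integral becomes 2G ∫ √(4 - c²) dc ≤ 4πG, while the sum is at least
  -- 2 - 4δ: the lower bound on G.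
  · set F : ℤ → ℝ := fun k => 2 * G * arcHeightPrimitive (k / θ) -
      (4 - (k / θ) ^ 2) * sqFlux θ J k / θ with hF
    have hs : ∀ c : ℝ, |c| ≤ 2 → |4 - c ^ 2| ≤ 4 := fun c hc => by
      have := abs_le.1 hc
      rw [abs_le]; constructor <;> nlinarith
    have hstep : ∀ k : ℤ, -(M : ℤ) ≤ k → k < -(M : ℤ) + (2 * M : ℕ) →
        |(4 - (k / θ) ^ 2) * J k ^ 2 - (F (k + 1) - F k)| ≤
          (8 * C + 2 * C * L) * (1 / θ) ^ 2 := by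
      intro k hk1 hk2
      have hb := hbulk k hk1 (by omega)
      obtain ⟨-, hZ, he⟩ := hexp k hb
      obtain ⟨hc0, hc1⟩ := hquarter k hb
      have ht := hL.primitive_taylor _ _ hc1 hc0
      rw [hd] at ht
      have hlt : |(k : ℝ) / θ| < 2 := hc0.trans_lt (by linarith)
      have hAs : (4 - ((k : ℝ) / θ) ^ 2) * (arcHeight (k / θ))⁻¹ = arcHeight (k / θ) := by
        have := arcHeight_pos hlt
        rw [← arcHeight_sq hlt]
        field_simp
      set R := θ * J k ^ 2 - (2 * (arcHeight (k / θ))⁻¹ * G + (sqFlux θ J k - sqFlux θ J (k + 1)))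
        with hR
      set T := arcHeightPrimitive (((k + 1 : ℤ) : ℝ) / θ) - arcHeightPrimitive (k / θ) -
        arcHeight (k / θ) * (1 / θ) with hT
      have hid : (4 - ((k : ℝ) / θ) ^ 2) * J k ^ 2 - (F (k + 1) - F k) =
          (4 - ((k : ℝ) / θ) ^ 2) * (R / θ) - 2 * G * T -
          (((k + 1 : ℤ) : ℝ) / θ - k / θ) * (((k + 1 : ℤ) : ℝ) / θ + k / θ) *
            sqFlux θ J (k + 1) / θ := by
        have e1 : R / θ = J k ^ 2 - 2 * (arcHeight (k / θ))⁻¹ * G * (1 / θ) -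
            (sqFlux θ J k - sqFlux θ J (k + 1)) / θ := by
          rw [hR]; field_simp; ring
        rw [e1, hT]
        simp only [hF]
        linear_combination (2 * G * (1 / θ)) * hAs
      rw [hid, hd]
      have h1 : |(4 - ((k : ℝ) / θ) ^ 2) * (R / θ)| ≤ 4 * (C / θ / θ) := by
        rw [abs_mul, abs_div, abs_of_pos hθ0]
        gcongr
        exact hs _ hlt.le
      have h2 : |2 * G * T| ≤ 2 * C * (L * (1 / θ) ^ 2) := by
        rw [abs_mul, abs_mul, abs_two]; gcongr
      have h5 : |1 / θ * (((k + 1 : ℤ) : ℝ) / θ + k / θ) * sqFlux θ J (k + 1) / θ| ≤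
          1 / θ * (2 + 2) * C / θ := by
        rw [abs_div, abs_mul, abs_mul, abs_of_pos hθ0, abs_of_pos (by positivity : 0 < 1 / θ)]
        gcongr
        exact (abs_add_le _ _).trans (add_le_add (hc1.trans (by linarith)) hlt.le)
      refine (abs_sub _ _).trans ((add_le_add ((abs_sub _ _).trans (add_le_add h1 h2)) h5).trans
        (le_of_eq ?_))
      field_simp
      ring
    have hsum := (abs_sum_Ico_sub_le hstep).trans hcount
    rw [← hIco] at hsum
    have h1 := hJ.le_sum_four_sub_sq_mul hθ0 hδ hδ1 (Finset.Ico (-(M : ℤ)) M) fun k hk => by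
      refine hM1.trans ?_
      rw [Finset.mem_Ico] at hk
      have : (M : ℤ) ≤ |k| := by
        rcases le_total 0 k with h | h
        · rw [abs_of_nonneg h]; omega
        · rw [abs_of_nonpos h]; omega
      exact_mod_cast this
    have h2 := (abs_le.1 hsum).2
    have b1 := (abs_le.1 (abs_arcHeightPrimitive_le hcM)).2
    have b2 := (abs_le.1 (abs_arcHeightPrimitive_le hcm)).1
    have c1 : |(4 - (((M : ℤ) : ℝ) / θ) ^ 2) * sqFlux θ J M / θ| ≤ 4 * C / θ := by
      rw [abs_div, abs_of_pos hθ0, abs_mul]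
      gcongr
      exact hs _ hcM
    have c2 : |(4 - (((-(M : ℤ) : ℤ) : ℝ) / θ) ^ 2) * sqFlux θ J (-M) / θ| ≤ 4 * C / θ := by
      rw [abs_div, abs_of_pos hθ0, abs_mul]
      gcongr
      exact hs _ hcm
    have h3 : F M - F (-M) ≤ 4 * Real.pi * G + 8 * C / θ := by
      simp only [hF]
      have d1 := mul_le_mul_of_nonneg_left b1 (by positivity : 0 ≤ 2 * G)
      have d2 := mul_le_mul_of_nonneg_left b2 (by positivity : 0 ≤ 2 * G)
      have d3 := (abs_le.1 c1).1
      have d4 := (abs_le.1 c2).2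
      have d5 : 8 * C / θ = 4 * C / θ + 4 * C / θ := by ring
      linarith
    have h7 : (6 * (8 * C + 2 * C * L) + 8 * C) / θ =
      6 * (8 * C + 2 * C * L) / θ + 8 * C / θ := by ring
    linarith

/-- As δ tends to 0 and θ to infinity, the two bounds tend to 2πG ≤ 1 and 2 ≤ 4πG. -/
theorem exists_abs_energy_zero_sub_le {ε : ℝ} (hε : 0 < ε) :
    ∃ θ₀ ≥ 1, ∀ θ ≥ θ₀, ∀ J, IsBesselSeq θ J →
      |θ * energy θ J 0 / 2 - 1 / (2 * Real.pi)| ≤ ε := by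
  have hπ := Real.pi_gt_three
  have hcont : Filter.Tendsto (fun δ : ℝ => 4 * Real.arcsin (1 - δ / 2) * (1 / (2 * Real.pi) + ε))
      (nhds 0) (nhds (1 + 2 * Real.pi * ε)) := by
    have h : Continuous fun δ : ℝ => 4 * Real.arcsin (1 - δ / 2) * (1 / (2 * Real.pi) + ε) :=
      (continuous_const.mul (Real.continuous_arcsin.comp (by fun_prop))).mul continuous_const
    have h0 := h.tendsto 0
    rw [zero_div, sub_zero, Real.arcsin_one] at h0
    convert h0 using 2
    field_simp
    norm_num
  have hev := (hcont.eventually (lt_mem_nhds (show 1 + ε < 1 + 2 * Real.pi * ε by nlinarith)))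
  obtain ⟨r, hr, hball⟩ := Metric.eventually_nhds_iff.1 hev
  set δ : ℝ := min (min 1 (r / 2)) ε with hδ
  have hδ0 : 0 < δ := lt_min (lt_min one_pos (half_pos hr)) hε
  have hδ1 : δ ≤ 1 := (min_le_left _ _).trans (min_le_left _ _)
  have hδr : δ < r := ((min_le_left _ _).trans (min_le_right _ _)).trans_lt (half_lt_self hr)
  have hδε : δ ≤ ε := min_le_right _ _
  have hδb := hball (y := δ) (by rwa [Real.dist_eq, sub_zero, abs_of_pos hδ0])
  obtain ⟨C, hC, θ₀, hθ₀, h⟩ := exists_energy_zero_bounds hδ0 hδ1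
  refine ⟨max θ₀ (C / ε), le_max_of_le_left hθ₀, fun θ hθ J hJ => ?_⟩
  obtain ⟨h1, h2⟩ := h θ ((le_max_left _ _).trans hθ) J hJ
  have hθ0 : 0 < θ := by linarith [hθ₀.trans ((le_max_left _ _).trans hθ)]
  have hCθ : C / θ ≤ ε := by
    rw [div_le_iff₀ hθ0]
    have := (le_max_right _ _).trans hθ
    rwa [div_le_iff₀ hε, mul_comm] at this
  set G := θ * energy θ J 0 / 2
  have hpos : 0 < 4 * Real.arcsin (1 - δ / 2) := by
    have : 0 < Real.arcsin (1 - δ / 2) := Real.arcsin_pos.2 (by linarith)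
    linarith
  rw [abs_le]
  constructor
  · have h3 : 2 * Real.pi * (1 / (2 * Real.pi)) = 1 := by field_simp
    have h4 : 2 - 5 * ε ≤ 4 * Real.pi * G := by linarith
    by_contra hc
    push Not at hc
    nlinarith [mul_lt_mul_of_pos_left hc (by positivity : 0 < 4 * Real.pi)]
  · have h3 : 4 * Real.arcsin (1 - δ / 2) * G < 4 * Real.arcsin (1 - δ / 2) *
        (1 / (2 * Real.pi) + ε) := by linarith
    have := lt_of_mul_lt_mul_left h3 hpos.le
    linarith

/-- In the bulk, `θ (J_k² + J_{k+1}² - (k/θ) J_k J_{k+1})` is asymptotic to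
`√(4 - (k/θ)²) / (2π)`. -/
theorem exists_abs_energy_sub_le {δ ε : ℝ} (hδ : 0 < δ) (hδ1 : δ ≤ 1) (hε : 0 < ε) :
    ∃ θ₀ ≥ 1, ∀ θ ≥ θ₀, ∀ J, IsBesselSeq θ J → ∀ k : ℤ, |(k : ℝ)| ≤ (2 - δ) * θ →
      |θ * energy θ J k * (arcHeight (k / θ))⁻¹ - 1 / (2 * Real.pi)| ≤ ε := by
  obtain ⟨C, hC, θ₀, hθ₀, h⟩ := exists_abs_energy_mul_sub_le hδ hδ1
  obtain ⟨θ₁, hθ₁, h'⟩ := exists_abs_energy_zero_sub_le (half_pos hε)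
  refine ⟨max (max θ₀ θ₁) (C / (ε / 2)), le_max_of_le_left (le_max_of_le_left hθ₀),
    fun θ hθ J hJ k hk => ?_⟩
  have hθ0' := (le_max_left _ _).trans ((le_max_left _ _).trans hθ)
  have hθ0 : 0 < θ := by linarith [hθ₀.trans hθ0']
  have hCθ : C / θ ≤ ε / 2 := by
    rw [div_le_iff₀ hθ0]
    have := (le_max_right _ _).trans hθ
    rwa [div_le_iff₀ (half_pos hε), mul_comm] at this
  have h1 := h θ hθ0' J hJ k 0 hk (by rw [Int.cast_zero, abs_zero]; nlinarith)
  have h2 := h' θ ((le_max_right _ _).trans ((le_max_left _ _).trans hθ)) J hJ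
  rw [Int.cast_zero, zero_div, arcHeight_zero, ← div_eq_mul_inv _ (2 : ℝ)] at h1
  have := abs_sub_le (θ * energy θ J k * (arcHeight (k / θ))⁻¹) (θ * energy θ J 0 / 2)
    (1 / (2 * Real.pi))
  linarith

/-! ### The numerator of the kernel as an approximate solution of the recurrence. -/

/-- The numerator of the discrete Bessel kernel. -/
def besselWronskian (θ : ℝ) (J : ℤ → ℝ) (j i : ℤ) : ℝ :=
  θ * (J i * J (j + 1) - J (i + 1) * J j)

/-- As a function of i, J_{i+1} solves the recurrence with (i + 1)/θ instead of i/θ; the mismatch is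
one product of Bessel functions, O(1/θ) in the bulk. -/
theorem IsBesselSeq.wronskian_recurrence {θ : ℝ} {J : ℤ → ℝ} (hJ : IsBesselSeq θ J) (hθ : θ ≠ 0)
    (j i : ℤ) : besselWronskian θ J j (i + 1) + besselWronskian θ J j (i - 1) -
      i / θ * besselWronskian θ J j i = -(J (i + 1) * J j) := by
  have h1 := hJ.add_eq hθ i
  have h2 := hJ.add_eq hθ (i + 1)
  rw [add_sub_cancel_right] at h2
  push_cast at h2
  simp only [besselWronskian, sub_add_cancel]
  have h3 : θ * (1 / θ) = 1 := by field_simp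
  linear_combination θ * J (j + 1) * h1 - θ * J j * h2 - J (i + 1) * J j * h3

/-- The Wronskian vanishes at i = j, so only the square of its value at j + 1 survives. -/
theorem IsBesselSeq.energy_wronskian_self {θ : ℝ} {J : ℤ → ℝ} (hJ : IsBesselSeq θ J) (hθ : θ ≠ 0)
    (j : ℤ) : energy θ (besselWronskian θ J j) j =
      (θ * energy θ J j - J j * J (j + 1)) ^ 2 := by
  have h2 := hJ.add_eq hθ (j + 1)
  rw [add_sub_cancel_right] at h2
  push_cast at h2
  have h0 : besselWronskian θ J j j = 0 := by unfold besselWronskian; ring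
  have h1 : besselWronskian θ J j (j + 1) = θ * energy θ J j - J j * J (j + 1) := by
    unfold besselWronskian energy
    have h3 : θ * (1 / θ) = 1 := by field_simp
    linear_combination (-θ * J j) * h2 - J j * J (j + 1) * h3
  rw [energy, h0, h1]
  ring

/-- The energy of the Wronskian starts at (θ E_j)² ≈ (4 - c²)/(4π²) and drifts by O(1/θ) per step.
Division by (4 - c²)/2 leaves 1/(2π²), the same at every point of the bulk. -/
theorem exists_wronskian_sq_expansion {δ : ℝ} (hδ : 0 < δ) (hδ1 : δ ≤ 1) :
    ∃ C > 0, ∀ ε > 0, ∃ θ₀ ≥ 1, ∀ θ ≥ θ₀, ∀ J, IsBesselSeq θ J → ∀ j : ℤ,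
      |(j : ℝ)| ≤ (2 - δ) * θ → ∃ g : ℤ → ℝ, ∀ i : ℤ, |(i : ℝ)| ≤ (2 - δ) * θ →
        |g i| ≤ C ∧ |g (i + 1)| ≤ C ∧
        |besselWronskian θ J j i ^ 2 - 1 / (2 * Real.pi ^ 2) - (g i - g (i + 1))| ≤
          ε + C * |(i : ℝ) - j| / θ := by
  obtain ⟨C, hC, θ₀, hθ₀, hbd⟩ := exists_sq_le_of_bulk hδ hδ1
  obtain ⟨L, hL⟩ := exists_arcBound hδ
  have hL0 := hL.nonneg
  refine ⟨32 * L ^ 2 * C ^ 2 + 1, by positivity, fun ε hε => ?_⟩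
  obtain ⟨θ₁, hθ₁, hG⟩ := exists_abs_energy_sub_le hδ hδ1
    (show 0 < min 1 (ε / 12) from lt_min one_pos (by positivity))
  refine ⟨max (max θ₀ θ₁) (26 * L ^ 2 * C ^ 2 / (ε / 2)),
    le_max_of_le_left (le_max_of_le_left hθ₀), fun θ hθ J hJ j hj => ?_⟩
  have hbd := hbd θ ((le_max_left _ _).trans ((le_max_left _ _).trans hθ)) J hJ
  have hG := hG θ ((le_max_right _ _).trans ((le_max_left _ _).trans hθ)) J hJ
  have hθ1 : 1 ≤ θ := hθ₀.trans ((le_max_left _ _).trans ((le_max_left _ _).trans hθ))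
  have hθ0 : 0 < θ := by linarith
  have hθε : 26 * L ^ 2 * C ^ 2 / θ ≤ ε / 2 := by
    rw [div_le_iff₀ hθ0]
    have := (le_max_right _ _).trans hθ
    rwa [div_le_iff₀ (half_pos hε), mul_comm (θ)] at this
  set B := C / θ with hB
  have hB0 : 0 < B := by positivity
  have hθB : θ * B = C := by rw [hB]; field_simp
  have h2θ : ∀ k : ℤ, |(k : ℝ)| ≤ (2 - δ) * θ → ∀ t : ℤ, |t| ≤ 2 →
      |((k + t : ℤ) : ℝ)| ≤ 2 * θ := fun k hk t ht =>
    (hbd k hk t ht).1.trans (by nlinarith)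
  have hj0 : J j ^ 2 ≤ B := by simpa using (hbd j hj 0 (by norm_num)).2
  have hj1 : J (j + 1) ^ 2 ≤ B := (hbd j hj 1 (by norm_num)).2
  set v := besselWronskian θ J j with hv
  have hvb : ∀ i : ℤ, J i ^ 2 ≤ B → J (i + 1) ^ 2 ≤ B → |v i| ≤ 2 * C := fun i h0 h1 => by
    rw [hv, besselWronskian, abs_mul, abs_of_pos hθ0, ← hθB]
    have := (abs_sub (J i * J (j + 1)) (J (i + 1) * J j)).trans
      (add_le_add (abs_mul_le_of_sq_le h0 hj1) (abs_mul_le_of_sq_le h1 hj0))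
    nlinarith
  have hvt : ∀ i : ℤ, |(i : ℝ)| ≤ (2 - δ) * θ → ∀ t : ℤ, -2 ≤ t → t ≤ 1 → |v (i + t)| ≤ 2 * C :=
    fun i hi t h1 h2 => by
      refine hvb _ (hbd i hi t (abs_le.2 ⟨h1, by omega⟩)).2 ?_
      rw [add_assoc]
      exact (hbd i hi (t + 1) (abs_le.2 ⟨by omega, by omega⟩)).2
  have hsqv : ∀ x : ℝ, |x| ≤ 2 * C → x ^ 2 ≤ 4 * C ^ 2 := fun x hx => by
    rw [← sq_abs]; nlinarith [abs_nonneg x]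
  have hJJ : ∀ i : ℤ, J i ^ 2 ≤ B → |J i * J j| ≤ B := fun i hi => abs_mul_le_of_sq_le hi hj0
  have hflux : ∀ i : ℤ, |(i : ℝ)| ≤ (2 - δ) * θ → ∀ t : ℤ, 0 ≤ t → t ≤ 1 →
      |energyFlux θ v (i + t)| ≤ 8 * C ^ 2 := fun i hi t h1 h2 => by
    have := abs_energyFlux_le (B := 4 * C ^ 2) hθ0 v
      (h2θ i hi t (abs_le.2 ⟨by omega, by omega⟩))
      (hsqv _ (hvt i hi t (by omega) h2)) (by
        rw [add_sub_assoc]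
        exact hsqv _ (hvt i hi (t - 1) (by omega) (by omega)))
    linarith
  have hstep : ∀ i : ℤ, |(i : ℝ)| ≤ (2 - δ) * θ → |(i : ℝ) + 1| ≤ (2 - δ) * θ →
      |energy θ v (i + 1) - energy θ v i| ≤ 8 * C ^ 2 / θ := by
    intro i hi hi1
    have h := energy_sub_energy hθ0.ne' v i
    have hr := hJ.wronskian_recurrence hθ0.ne' j (i + 1)
    rw [add_sub_cancel_right, show i + 1 + 1 = i + 2 by ring] at hr
    push_cast at hr
    rw [← hv] at hr
    rw [hr] at h
    have v0 : |v i| ≤ 2 * C := by simpa using hvt i hi 0 (by norm_num) (by norm_num)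
    have v1 := hvt i hi 1 (by norm_num) (by norm_num)
    have v2 : |v (i + 2)| ≤ 2 * C := by
      have := hvt (i + 1) (by push_cast; exact hi1) 1 (by norm_num) (by norm_num)
      rwa [show i + 1 + 1 = i + 2 by ring] at this
    rw [h]
    have t1 : |(v (i + 2) - v i) * -(J (i + 2) * J j)| ≤ (2 * C + 2 * C) * B := by
      rw [abs_mul, abs_neg]
      have := hJJ (i + 2) (hbd i hi 2 (by norm_num)).2
      gcongr
      exact (abs_sub _ _).trans (add_le_add v2 v0)
    have t2 : |v i * v (i + 1) / θ| ≤ 2 * C * (2 * C) / θ := by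
      rw [abs_div, abs_of_pos hθ0, abs_mul]; gcongr
    refine (abs_sub _ _).trans ((add_le_add t1 t2).trans (le_of_eq ?_))
    rw [hB]; field_simp; ring
  have hlt : ∀ k : ℤ, |(k : ℝ)| ≤ (2 - δ) * θ → |(k : ℝ) / θ| < 2 := fun k hk =>
    (abs_div_le_of_bulk hθ0 hk).trans_lt (by linarith)
  set A := (arcHeight (j / θ))⁻¹ with hA
  have hAs : A ^ 2 * (4 - (j / θ) ^ 2) = 1 := by
    have := arcHeight_pos (hlt j hj)
    rw [← arcHeight_sq (hlt j hj), hA]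
    field_simp
  have hAL : |A| ≤ L := hL.inv_le _ (abs_div_le_of_bulk hθ0 hj)
  have hA2 : A ^ 2 ≤ L ^ 2 := by rw [← sq_abs]; gcongr
  have hE : |θ * energy θ J j| ≤ 4 * C := by
    have := abs_energy_le (B := B) hθ0 J (by simpa using h2θ j hj 0 (by norm_num)) hj0 hj1
    rw [abs_mul, abs_of_pos hθ0]
    nlinarith
  have hFj : |energy θ v j - (θ * energy θ J j) ^ 2| ≤ 9 * C ^ 2 / θ := by
    rw [hv, hJ.energy_wronskian_self hθ0.ne' j, show (θ * energy θ J j - J j * J (j + 1)) ^ 2 -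
      (θ * energy θ J j) ^ 2 = J j * J (j + 1) * (J j * J (j + 1) - 2 * (θ * energy θ J j)) by ring,
      abs_mul]
    have h1 := abs_mul_le_of_sq_le hj0 hj1
    have hBC : B ≤ C := div_le_self hC.le hθ1
    calc _ ≤ B * (C + 2 * (4 * C)) := by
          gcongr
          refine (abs_sub _ _).trans ?_
          rw [abs_mul 2, abs_two]
          gcongr
          exact h1.trans hBC
      _ = 9 * C ^ 2 / θ := by rw [hB]; ring
  have hmain : |2 * (θ * energy θ J j * A) ^ 2 - 1 / (2 * Real.pi ^ 2)| ≤ ε / 2 := by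
    have h1 := hG j hj
    rw [← hA] at h1
    set X := θ * energy θ J j * A
    have hπ : 0 < 1 / (2 * Real.pi) := by positivity
    have hπ1 : 1 / (2 * Real.pi) ≤ 1 := by
      rw [div_le_one (by positivity)]; linarith [Real.pi_gt_three]
    have h2 := h1.trans (min_le_left _ _)
    have h3 := h1.trans (min_le_right _ _)
    have h4 : |X + 1 / (2 * Real.pi)| ≤ 3 := by
      rw [abs_le] at h2 ⊢; constructor <;> linarith
    have h5 : 2 * X ^ 2 - 1 / (2 * Real.pi ^ 2) =
        2 * ((X - 1 / (2 * Real.pi)) * (X + 1 / (2 * Real.pi))) := by field_simp; ring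
    rw [h5, abs_mul, abs_mul, abs_two]
    calc 2 * (|X - 1 / (2 * Real.pi)| * |X + 1 / (2 * Real.pi)|) ≤ 2 * (ε / 12 * 3) := by gcongr
      _ = ε / 2 := by ring
  -- The weight `A` is frozen at j, so that the oscillating part telescopes exactly in i. Freezing
  -- costs the term `r3`, of order |i - j|/θ.
  refine ⟨fun i => 2 * A ^ 2 * energyFlux θ v i, fun i hi => ?_⟩
  have hgb : ∀ t : ℤ, 0 ≤ t → t ≤ 1 →
      |2 * A ^ 2 * energyFlux θ v (i + t)| ≤ 32 * L ^ 2 * C ^ 2 + 1 := fun t h1 h2 => by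
    have : |2 * A ^ 2 * energyFlux θ v (i + t)| ≤ 2 * L ^ 2 * (8 * C ^ 2) := by
      rw [abs_mul, abs_mul, abs_two, abs_of_nonneg (sq_nonneg A)]
      have := hflux i hi t h1 h2
      gcongr
    nlinarith [mul_nonneg (sq_nonneg L) (sq_nonneg C)]
  refine ⟨by simpa using hgb 0 le_rfl zero_le_one, hgb 1 zero_le_one le_rfl, ?_⟩
  have v0 : |v i| ≤ 2 * C := by simpa using hvt i hi 0 (by norm_num) (by norm_num)
  have v1 := hvt i hi 1 (by norm_num) (by norm_num)
  have hloc := sq_eq_energy_add hθ0.ne' v i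
  rw [hJ.wronskian_recurrence hθ0.ne' j i] at hloc
  have hFi := abs_sub_le_of_abs_step_le hstep hi hj
  have hci : |(i : ℝ) / θ / 2| ≤ 1 := by
    rw [abs_div, abs_two]; linarith [hlt i hi]
  have r1 : |(i : ℝ) / θ / 2 * v i * -(J (i + 1) * J j)| ≤ 1 * (2 * C) * B := by
    rw [abs_mul, abs_mul, abs_neg]
    have := hJJ (i + 1) (hbd i hi 1 (by norm_num)).2
    gcongr
  have r2 : |v i * v (i + 1) / (2 * θ)| ≤ 2 * C * (2 * C) / (2 * θ) := by
    rw [abs_div, abs_of_pos (by positivity : 0 < 2 * θ), abs_mul]; gcongr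
  have r3 : |((i : ℝ) / θ - j / θ) * ((i : ℝ) / θ + j / θ) / 2 * v i ^ 2| ≤
      |(i : ℝ) - j| / θ * (2 + 2) / 2 * (4 * C ^ 2) := by
    rw [abs_mul, abs_div, abs_mul, abs_two, ← sub_div, abs_div, abs_of_pos hθ0,
      abs_of_nonneg (sq_nonneg (v i))]
    have := hsqv _ v0
    gcongr
    exact (abs_add_le _ _).trans (add_le_add (hlt i hi).le (hlt j hj).le)
  have hid : v i ^ 2 - 1 / (2 * Real.pi ^ 2) -
      (2 * A ^ 2 * energyFlux θ v i - 2 * A ^ 2 * energyFlux θ v (i + 1)) =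
      (2 * (θ * energy θ J j * A) ^ 2 - 1 / (2 * Real.pi ^ 2)) +
      2 * A ^ 2 * ((energy θ v i - energy θ v j) + (energy θ v j - (θ * energy θ J j) ^ 2) +
        (i : ℝ) / θ / 2 * v i * -(J (i + 1) * J j) - v i * v (i + 1) / (2 * θ) +
        ((i : ℝ) / θ - j / θ) * ((i : ℝ) / θ + j / θ) / 2 * v i ^ 2) := by
    linear_combination 2 * A ^ 2 * hloc - v i ^ 2 * hAs
  have hsum : |(energy θ v i - energy θ v j) + (energy θ v j - (θ * energy θ J j) ^ 2) +
        (i : ℝ) / θ / 2 * v i * -(J (i + 1) * J j) - v i * v (i + 1) / (2 * θ) +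
        ((i : ℝ) / θ - j / θ) * ((i : ℝ) / θ + j / θ) / 2 * v i ^ 2| ≤
      16 * C ^ 2 * |(i : ℝ) - j| / θ + 13 * C ^ 2 / θ := by
    refine (abs_add_le _ _).trans ((add_le_add ((abs_sub _ _).trans (add_le_add
      ((abs_add_le _ _).trans (add_le_add ((abs_add_le _ _).trans (add_le_add hFi hFj)) r1)) r2))
      r3).trans (le_of_eq ?_))
    rw [hB]; field_simp; ring
  rw [hid]
  have hA2s : |2 * A ^ 2| ≤ 2 * L ^ 2 := by
    rw [abs_of_nonneg (by positivity)]; linarith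
  refine (abs_add_le _ _).trans ?_
  rw [abs_mul (2 * A ^ 2)]
  refine (add_le_add hmain (mul_le_mul hA2s hsum (abs_nonneg _) (by positivity))).trans ?_
  have e1 : 2 * L ^ 2 * (16 * C ^ 2 * |(i : ℝ) - j| / θ + 13 * C ^ 2 / θ) =
      32 * L ^ 2 * C ^ 2 * |(i : ℝ) - j| / θ + 26 * L ^ 2 * C ^ 2 / θ := by ring
  have e2 : (32 * L ^ 2 * C ^ 2 + 1) * |(i : ℝ) - j| / θ =
      32 * L ^ 2 * C ^ 2 * |(i : ℝ) - j| / θ + |(i : ℝ) - j| / θ := by ring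
  have e3 : 0 ≤ |(i : ℝ) - j| / θ := by positivity
  linarith

/-! ### Summation over pairs near one end point. -/

/-- Abel summation against a decreasing weight. -/
theorem abs_sum_mul_sub_succ_le {w q : ℕ → ℝ} {C : ℝ} {m n : ℕ} (hmn : m ≤ n)
    (hw : ∀ e, m ≤ e → w (e + 1) ≤ w e) (hw0 : ∀ e, 0 ≤ w e)
    (hq : ∀ e, m ≤ e → e ≤ n → |q e| ≤ C) :
    |∑ e ∈ Finset.Ico m n, w e * (q e - q (e + 1))| ≤ 2 * C * w m := by
  have key : ∀ n, m ≤ n → (∀ e, m ≤ e → e ≤ n → |q e| ≤ C) →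
      |∑ e ∈ Finset.Ico m n, w e * (q e - q (e + 1)) - w m * q m + w n * q n| ≤
        C * (w m - w n) := by
    intro n hmn
    induction n, hmn using Nat.le_induction with
    | base => intro _; simp
    | succ n hmn ih =>
      intro hq
      have h1 := ih fun e h h' => hq e h (by omega)
      have h2 := hq (n + 1) (by omega) le_rfl
      have h3 : |(w n - w (n + 1)) * q (n + 1)| ≤ (w n - w (n + 1)) * C := by
        rw [abs_mul, abs_of_nonneg (sub_nonneg.2 (hw n hmn))]
        exact mul_le_mul_of_nonneg_left h2 (sub_nonneg.2 (hw n hmn))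
      rw [Finset.sum_Ico_succ_top hmn]
      rw [abs_le] at h1 h3 ⊢
      constructor <;> nlinarith
  have h1 := key n hmn hq
  have h2 : |w m * q m| ≤ w m * C := by
    rw [abs_mul, abs_of_nonneg (hw0 m)]
    exact mul_le_mul_of_nonneg_left (hq m le_rfl hmn) (hw0 m)
  have h3 : |w n * q n| ≤ w n * C := by
    rw [abs_mul, abs_of_nonneg (hw0 n)]
    exact mul_le_mul_of_nonneg_left (hq n hmn le_rfl) (hw0 n)
  rw [abs_le] at h1 h2 h3 ⊢
  constructor <;> linarith

/-- Abel summation against 1/e² reduces the telescoping part to a boundary term of order 1/m². -/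
theorem abs_sum_div_sq_sub_le {t q : ℕ → ℝ} {C κ ε : ℝ} {m M : ℕ} (hm : 1 ≤ m) (hmM : m ≤ M)
    (hq : ∀ e, m ≤ e → e ≤ M + 1 → |q e| ≤ C)
    (ht : ∀ e, m ≤ e → e ≤ M → |t e - κ - (q e - q (e + 1))| ≤ ε) :
    |∑ e ∈ Finset.Icc m M, t e / (e : ℝ) ^ 2 - κ * ∑ e ∈ Finset.Icc m M, 1 / (e : ℝ) ^ 2| ≤
      2 * C * (1 / (m : ℝ) ^ 2) + ε * ∑ e ∈ Finset.Icc m M, 1 / (e : ℝ) ^ 2 := by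
  have h1 := abs_sum_mul_sub_succ_le (w := fun e => 1 / (e : ℝ) ^ 2) (q := q) (C := C)
    (show m ≤ M + 1 by omega) (fun e he => by
      have : (0 : ℝ) < e := by exact_mod_cast (show 0 < e by omega)
      push_cast
      gcongr
      linarith) (fun e => by positivity) hq
  have hI : Finset.Ico m (M + 1) = Finset.Icc m M := by ext; simp
  rw [hI] at h1
  have h2 : |∑ e ∈ Finset.Icc m M, (t e - κ - (q e - q (e + 1))) / (e : ℝ) ^ 2| ≤
      ε * ∑ e ∈ Finset.Icc m M, 1 / (e : ℝ) ^ 2 := by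
    rw [Finset.mul_sum]
    refine (Finset.abs_sum_le_sum_abs _ _).trans (Finset.sum_le_sum fun e he => ?_)
    rw [Finset.mem_Icc] at he
    rw [abs_div, abs_of_nonneg (sq_nonneg (e : ℝ)), mul_one_div]
    have := ht e he.1 he.2
    gcongr
  have h3 : ∑ e ∈ Finset.Icc m M, t e / (e : ℝ) ^ 2 - κ * ∑ e ∈ Finset.Icc m M, 1 / (e : ℝ) ^ 2 =
      ∑ e ∈ Finset.Icc m M, 1 / (e : ℝ) ^ 2 * (q e - q (e + 1)) +
      ∑ e ∈ Finset.Icc m M, (t e - κ - (q e - q (e + 1))) / (e : ℝ) ^ 2 := by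
    rw [Finset.mul_sum, ← Finset.sum_sub_distrib, ← Finset.sum_add_distrib]
    exact Finset.sum_congr rfl fun e _ => by ring
  rw [h3]
  exact (abs_add_le _ _).trans (add_le_add h1 h2)

/-- The distance e occurs for exactly e values of m; this is the source of the logarithm. -/
theorem sum_Icc_sum_Icc_one_div_sq (M : ℕ) :
    ∑ m ∈ Finset.Icc 1 M, ∑ e ∈ Finset.Icc m M, 1 / (e : ℝ) ^ 2 =
      ∑ e ∈ Finset.Icc 1 M, 1 / (e : ℝ) := by
  rw [Finset.sum_comm' (t' := Finset.Icc 1 M) (s' := fun e => Finset.Icc 1 e)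
    (fun x y => by simp only [Finset.mem_Icc]; omega)]
  refine Finset.sum_congr rfl fun e he => ?_
  have : (0 : ℝ) < e := by exact_mod_cast (Finset.mem_Icc.1 he).1
  rw [Finset.sum_const, Nat.card_Icc, nsmul_eq_mul, Nat.add_sub_cancel]
  field_simp

theorem sum_Icc_one_div_sq_le (M : ℕ) : ∑ m ∈ Finset.Icc 1 M, 1 / (m : ℝ) ^ 2 ≤ 2 := by
  have key : ∀ M : ℕ, ∑ m ∈ Finset.Icc 1 (M + 1), 1 / (m : ℝ) ^ 2 ≤ 2 - 1 / ((M : ℝ) + 1) := by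
    intro M
    induction M with
    | zero => norm_num
    | succ M ih =>
      rw [Finset.sum_Icc_succ_top (by omega)]
      have hM : (0 : ℝ) ≤ M := M.cast_nonneg
      have : 1 / (((M + 1 + 1 : ℕ) : ℝ)) ^ 2 ≤ 1 / ((M : ℝ) + 1) - 1 / (((M + 1 : ℕ) : ℝ) + 1) := by
        push_cast
        rw [div_sub_div _ _ (by positivity) (by positivity), div_le_div_iff₀ (by positivity)
          (by positivity)]
        nlinarith
      linarith
  rcases M with _ | M
  · simp
  · refine (key M).trans ?_
    have : (0 : ℝ) ≤ 1 / ((M : ℝ) + 1) := by positivity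
    linarith

/-- The boundary terms 2C/m² are summable in m, so the oscillation contributes only 4C and no
logarithm. -/
theorem abs_sum_sum_div_sq_sub_le {t q : ℕ → ℕ → ℝ} {C κ ε : ℝ} {M : ℕ} (hC : 0 ≤ C)
    (hq : ∀ m e, 1 ≤ m → m ≤ e → m ≤ M → e ≤ M + 1 → |q m e| ≤ C)
    (ht : ∀ m e, 1 ≤ m → m ≤ e → e ≤ M → |t m e - κ - (q m e - q m (e + 1))| ≤ ε) :
    |∑ m ∈ Finset.Icc 1 M, ∑ e ∈ Finset.Icc m M, t m e / (e : ℝ) ^ 2 -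
      κ * ∑ e ∈ Finset.Icc 1 M, 1 / (e : ℝ)| ≤
      4 * C + ε * ∑ e ∈ Finset.Icc 1 M, 1 / (e : ℝ) := by
  rw [← sum_Icc_sum_Icc_one_div_sq, Finset.mul_sum, ← Finset.sum_sub_distrib]
  refine (Finset.abs_sum_le_sum_abs _ _).trans ((Finset.sum_le_sum fun m hm =>
    abs_sum_div_sq_sub_le (Finset.mem_Icc.1 hm).1 (Finset.mem_Icc.1 hm).2
      (fun e h1 h2 => hq m e (Finset.mem_Icc.1 hm).1 h1 (Finset.mem_Icc.1 hm).2 h2)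
      (fun e h1 h2 => ht m e (Finset.mem_Icc.1 hm).1 h1 h2)).trans ?_)
  rw [Finset.sum_add_distrib, ← Finset.mul_sum, ← Finset.mul_sum]
  have := mul_le_mul_of_nonneg_left (sum_Icc_one_div_sq_le M) (by positivity : 0 ≤ 2 * C)
  linarith

/-- The squared discrete Bessel kernel off the diagonal. -/
noncomputable def besselKernelSq (θ : ℝ) (J : ℤ → ℝ) (p : ℤ × ℤ) : ℝ :=
  besselWronskian θ J p.2 p.1 ^ 2 / ((p.1 : ℝ) - p.2) ^ 2

theorem besselKernelSq_nonneg (θ : ℝ) (J : ℤ → ℝ) (p : ℤ × ℤ) : 0 ≤ besselKernelSq θ J p := by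
  unfold besselKernelSq; positivity

/-- The pairs `(i, j)` with `j < x ≤ i` and `i - j ≤ M`. -/
noncomputable def leftPairs (x : ℤ) (M : ℕ) : Finset (ℤ × ℤ) :=
  (Finset.Ico x (x + M) ×ˢ Finset.Ico (x - M) x).filter fun p => p.1 - p.2 ≤ M

/-- The pairs `(i, j)` with `i ≤ y < j` and `j - i ≤ M`. -/
noncomputable def rightPairs (y : ℤ) (M : ℕ) : Finset (ℤ × ℤ) :=
  (Finset.Ioc (y - M) y ×ˢ Finset.Ioc y (y + M)).filter fun p => p.2 - p.1 ≤ M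

theorem mem_leftPairs {x : ℤ} {M : ℕ} {p : ℤ × ℤ} :
    p ∈ leftPairs x M ↔ x ≤ p.1 ∧ p.2 < x ∧ p.1 - p.2 ≤ M := by
  simp only [leftPairs, Finset.mem_filter, Finset.mem_product, Finset.mem_Ico]
  omega

theorem mem_rightPairs {y : ℤ} {M : ℕ} {p : ℤ × ℤ} :
    p ∈ rightPairs y M ↔ p.1 ≤ y ∧ y < p.2 ∧ p.2 - p.1 ≤ M := by
  simp only [rightPairs, Finset.mem_filter, Finset.mem_product, Finset.mem_Ioc]
  omega

/-- The coordinates are m = x - j and e = i - j: the inner sum keeps j fixed and moves i, as the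
expansion of the Wronskian requires. -/
theorem sum_leftPairs (θ : ℝ) (J : ℤ → ℝ) (x : ℤ) (M : ℕ) :
    ∑ p ∈ leftPairs x M, besselKernelSq θ J p = ∑ m ∈ Finset.Icc 1 M, ∑ e ∈ Finset.Icc m M,
      besselWronskian θ J (x - m) (x - m + e) ^ 2 / (e : ℝ) ^ 2 := by
  rw [Finset.sum_sigma']
  refine Finset.sum_nbij' (fun p => ⟨(x - p.2).toNat, (p.1 - p.2).toNat⟩)
    (fun s => (x - s.1 + s.2, x - s.1)) ?_ ?_ ?_ ?_ ?_
  · intro p hp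
    rw [mem_leftPairs] at hp
    simp only [Finset.mem_sigma, Finset.mem_Icc]
    omega
  · intro s hs
    simp only [Finset.mem_sigma, Finset.mem_Icc] at hs
    rw [mem_leftPairs]
    simp only
    omega
  · intro p hp
    rw [mem_leftPairs] at hp
    ext <;> simp only <;> omega
  · intro s hs
    simp only [Finset.mem_sigma, Finset.mem_Icc] at hs
    obtain ⟨m, e⟩ := s
    simp only at hs ⊢
    have h1 : (x - (x - (m : ℤ))).toNat = m := by omega
    have h2 : (x - (m : ℤ) + e - (x - m)).toNat = e := by omega
    rw [h1, h2]
  · intro p hp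
    rw [mem_leftPairs] at hp
    have h1 : x - ((x - p.2).toNat : ℤ) = p.2 := by omega
    have h2 : p.2 + ((p.1 - p.2).toNat : ℤ) = p.1 := by omega
    have h3 : (((p.1 - p.2).toNat : ℕ) : ℝ) = (p.1 : ℝ) - p.2 := by
      have : (((p.1 - p.2).toNat : ℕ) : ℤ) = p.1 - p.2 := by omega
      exact_mod_cast congrArg (Int.cast : ℤ → ℝ) this
    simp only [besselKernelSq]
    rw [h1, h2, h3]

theorem sum_rightPairs (θ : ℝ) (J : ℤ → ℝ) (y : ℤ) (M : ℕ) :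
    ∑ p ∈ rightPairs y M, besselKernelSq θ J p = ∑ m ∈ Finset.Icc 1 M, ∑ e ∈ Finset.Icc m M,
      besselWronskian θ J (y + m) (y + m - e) ^ 2 / (e : ℝ) ^ 2 := by
  rw [Finset.sum_sigma']
  refine Finset.sum_nbij' (fun p => ⟨(p.2 - y).toNat, (p.2 - p.1).toNat⟩)
    (fun s => (y + s.1 - s.2, y + s.1)) ?_ ?_ ?_ ?_ ?_
  · intro p hp
    rw [mem_rightPairs] at hp
    simp only [Finset.mem_sigma, Finset.mem_Icc]
    omega
  · intro s hs
    simp only [Finset.mem_sigma, Finset.mem_Icc] at hs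
    rw [mem_rightPairs]
    simp only
    omega
  · intro p hp
    rw [mem_rightPairs] at hp
    ext <;> simp only <;> omega
  · intro s hs
    simp only [Finset.mem_sigma, Finset.mem_Icc] at hs
    obtain ⟨m, e⟩ := s
    simp only at hs ⊢
    have h1 : (y + (m : ℤ) - y).toNat = m := by omega
    have h2 : (y + (m : ℤ) - (y + m - e)).toNat = e := by omega
    rw [h1, h2]
  · intro p hp
    rw [mem_rightPairs] at hp
    have h1 : y + ((p.2 - y).toNat : ℤ) = p.2 := by omega
    have h2 : p.2 - ((p.2 - p.1).toNat : ℤ) = p.1 := by omega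
    have h3 : (((p.2 - p.1).toNat : ℕ) : ℝ) = (p.2 : ℝ) - p.1 := by
      have : (((p.2 - p.1).toNat : ℕ) : ℤ) = p.2 - p.1 := by omega
      exact_mod_cast congrArg (Int.cast : ℤ → ℝ) this
    simp only [besselKernelSq]
    rw [h1, h2, h3, ← neg_sub (p.1 : ℝ), neg_sq]

/-- The pairs close to one end point contribute half of the logarithmic asymptotics. -/
theorem exists_sum_pairs_near {δ : ℝ} (hδ : 0 < δ) (hδ1 : δ ≤ 1) :
    ∃ C > 0, ∀ ε > 0, ∃ θ₀ ≥ 1, ∀ θ ≥ θ₀, ∀ J, IsBesselSeq θ J → ∀ (x : ℤ) (M : ℕ),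
      |(x : ℝ)| + M ≤ (2 - δ) * θ →
      |∑ p ∈ leftPairs x M, besselKernelSq θ J p -
        1 / (2 * Real.pi ^ 2) * ∑ e ∈ Finset.Icc 1 M, 1 / (e : ℝ)| ≤
        4 * C + (ε + C * M / θ) * ∑ e ∈ Finset.Icc 1 M, 1 / (e : ℝ) ∧
      |∑ p ∈ rightPairs x M, besselKernelSq θ J p -
        1 / (2 * Real.pi ^ 2) * ∑ e ∈ Finset.Icc 1 M, 1 / (e : ℝ)| ≤
        4 * C + (ε + C * M / θ) * ∑ e ∈ Finset.Icc 1 M, 1 / (e : ℝ) := by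
  obtain ⟨C, hC, h⟩ := exists_wronskian_sq_expansion hδ hδ1
  refine ⟨C, hC, fun ε hε => ?_⟩
  obtain ⟨θ₀, hθ₀, h⟩ := h ε hε
  refine ⟨θ₀, hθ₀, fun θ hθ J hJ x M hx => ?_⟩
  have hθ0 : 0 < θ := by linarith [hθ₀.trans hθ]
  have hb : ∀ k : ℤ, |k - x| ≤ M → |(k : ℝ)| ≤ (2 - δ) * θ := fun k hk => by
    have h1 : |(k : ℝ) - x| ≤ M := by exact_mod_cast hk
    have := abs_add_le ((k : ℝ) - x) x
    rw [sub_add_cancel] at this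
    linarith
  have hg : ∀ j : ℤ, ∃ g : ℤ → ℝ, |j - x| ≤ M → ∀ i : ℤ, |i - x| ≤ M →
        |g i| ≤ C ∧ |g (i + 1)| ≤ C ∧
        |besselWronskian θ J j i ^ 2 - 1 / (2 * Real.pi ^ 2) - (g i - g (i + 1))| ≤
          ε + C * |(i : ℝ) - j| / θ := fun j => by
    by_cases hj : |j - x| ≤ M
    · obtain ⟨g, hg⟩ := h θ hθ J hJ j (hb j hj)
      exact ⟨g, fun _ i hi => hg i (hb i hi)⟩
    · exact ⟨0, fun h => absurd h hj⟩
  choose g hg using hg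
  have herr : ∀ e : ℕ, e ≤ M → ε + C * (e : ℝ) / θ ≤ ε + C * M / θ := fun e he => by
    have : (e : ℝ) ≤ M := by exact_mod_cast he
    gcongr
  rw [sum_leftPairs, sum_rightPairs]
  constructor
  · refine abs_sum_sum_div_sq_sub_le (q := fun m e => g (x - m) (x - m + e)) hC.le ?_ ?_
    · intro m e h1 h2 h3 h4
      have := (hg (x - m) (abs_le.2 (by omega)) (x - m + e - 1) (abs_le.2 (by omega))).2.1
      rwa [sub_add_cancel] at this
    · intro m e h1 h2 h3
      have := (hg (x - m) (abs_le.2 (by omega)) (x - m + e) (abs_le.2 (by omega))).2.2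
      push_cast at this ⊢
      rw [add_assoc] at this
      refine this.trans ?_
      rw [add_sub_cancel_left, Nat.abs_cast]
      exact herr e h3
  -- Here i decreases as e grows, so the telescoping is reversed: hence the sign and the shift by
  -- one in `q`.
  · refine abs_sum_sum_div_sq_sub_le (q := fun m e => -g (x + m) (x + m - e + 1)) hC.le ?_ ?_
    · intro m e h1 h2 h3 h4
      have := (hg (x + m) (abs_le.2 (by omega)) (x + m - e + 1) (abs_le.2 (by omega))).1
      rwa [abs_neg]
    · intro m e h1 h2 h3
      have := (hg (x + m) (abs_le.2 (by omega)) (x + m - e) (abs_le.2 (by omega))).2.2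
      have e1 : x + (m : ℤ) - ((e + 1 : ℕ) : ℤ) + 1 = x + m - e := by push_cast; ring
      rw [e1, neg_sub_neg]
      refine this.trans ?_
      push_cast
      rw [sub_sub_cancel_left, abs_neg, Nat.abs_cast]
      exact herr e h3

/-! ### Distant pairs, and two-sided bounds for real θ. -/

theorem sum_one_div_sq_sub_le (i : ℤ) (M : ℕ) (F : Finset ℤ) (hF : ∀ j ∈ F, (M : ℤ) < |i - j|) :
    ∑ j ∈ F, 1 / ((i : ℝ) - j) ^ 2 ≤ 4 / ((M : ℝ) + 1) := by
  obtain ⟨N, hN⟩ : ∃ N : ℕ, ∀ j ∈ F, (i - j).natAbs < N :=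
    ⟨F.sup (fun j => (i - j).natAbs) + 1, fun j hj =>
      Nat.lt_succ_of_le (Finset.le_sup (f := fun j => (i - j).natAbs) hj)⟩
  have hmaps : ∀ j ∈ F, (i - j).natAbs ∈ Finset.Ioo M N := fun j hj => by
    have := hF j hj
    rw [Int.abs_eq_natAbs] at this
    rw [Finset.mem_Ioo]
    exact ⟨by omega, hN j hj⟩
  have hterm : ∀ j : ℤ, 1 / ((i : ℝ) - j) ^ 2 = (((i - j).natAbs : ℝ) ^ 2)⁻¹ := fun j => by
    rw [one_div, Nat.cast_natAbs]
    push_cast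
    rw [sq_abs]
  simp only [hterm]
  rw [← Finset.sum_fiberwise_of_maps_to hmaps]
  have hcard : ∀ n : ℕ, (F.filter fun j => (i - j).natAbs = n).card ≤ 2 := fun n => by
    refine (Finset.card_le_card (t := {i - n, i + n}) fun j hj => ?_).trans Finset.card_le_two
    rw [Finset.mem_filter] at hj
    rw [Finset.mem_insert, Finset.mem_singleton]
    omega
  have hle : ∀ n ∈ Finset.Ioo M N, ∑ j ∈ F with (i - j).natAbs = n,
      (((i - j).natAbs : ℝ) ^ 2)⁻¹ ≤ 2 * ((n : ℝ) ^ 2)⁻¹ := fun n _ => by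
    rw [Finset.sum_congr rfl fun j hj => by rw [(Finset.mem_filter.1 hj).2], Finset.sum_const,
      nsmul_eq_mul]
    gcongr
    exact_mod_cast hcard n
  refine (Finset.sum_le_sum hle).trans ?_
  rw [← Finset.mul_sum]
  have := sum_Ioo_inv_sq_le (α := ℝ) M N
  have h2 : (4 : ℝ) / (M + 1) = 2 * (2 / (M + 1)) := by ring
  rw [h2]
  gcongr

/-- If j is in a slightly larger bulk, the numerator is bounded. Otherwise |i - j| ≥ δθ/2, and the
bound J_i² = O(1/θ) leaves a term that is summable in j by the normalization of J. -/
theorem exists_besselKernelSq_le {δ : ℝ} (hδ : 0 < δ) (hδ1 : δ ≤ 1) :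
    ∃ C > 0, ∃ θ₀ ≥ 1, ∀ θ ≥ θ₀, ∀ J, IsBesselSeq θ J → ∀ i : ℤ, |(i : ℝ)| ≤ (2 - δ) * θ →
      ∀ j : ℤ, i ≠ j → besselKernelSq θ J (i, j) ≤
        C * (1 / ((i : ℝ) - j) ^ 2) + C / θ * (J j ^ 2 + J (j + 1) ^ 2) := by
  obtain ⟨C, hC, θ₀, hθ₀, h⟩ := exists_sq_le_of_bulk (half_pos hδ) (by linarith)
  refine ⟨4 * C ^ 2 + 8 * C / δ ^ 2, by positivity, θ₀, hθ₀, fun θ hθ J hJ i hi j hij => ?_⟩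
  have hθ0 : 0 < θ := by linarith [hθ₀.trans hθ]
  have h := h θ hθ J hJ
  have hij' : (i : ℝ) - j ≠ 0 := sub_ne_zero.2 (by exact_mod_cast hij)
  have hij2 : 0 < ((i : ℝ) - j) ^ 2 := by positivity
  have hib : |(i : ℝ)| ≤ (2 - δ / 2) * θ := hi.trans (by nlinarith)
  have hi0 : J i ^ 2 ≤ C / θ := by simpa using (h i hib 0 (by norm_num)).2
  have hi1 : J (i + 1) ^ 2 ≤ C / θ := (h i hib 1 (by norm_num)).2
  have hW : besselWronskian θ J j i ^ 2 ≤
      2 * θ ^ 2 * (C / θ * (J j ^ 2 + J (j + 1) ^ 2)) := by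
    have h1 : (J i * J (j + 1) - J (i + 1) * J j) ^ 2 ≤
        2 * (J i ^ 2 * J (j + 1) ^ 2 + J (i + 1) ^ 2 * J j ^ 2) := by
      nlinarith [sq_nonneg (J i * J (j + 1) + J (i + 1) * J j)]
    have h2 := mul_le_mul_of_nonneg_right hi0 (sq_nonneg (J (j + 1)))
    have h3 := mul_le_mul_of_nonneg_right hi1 (sq_nonneg (J j))
    rw [besselWronskian, mul_pow]
    nlinarith [mul_le_mul_of_nonneg_left (h1.trans (by linarith : _ ≤
      2 * (C / θ * (J j ^ 2 + J (j + 1) ^ 2)))) (sq_nonneg θ)]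
  have hS : 0 ≤ J j ^ 2 + J (j + 1) ^ 2 := by positivity
  have hrest : 0 ≤ C / θ * (J j ^ 2 + J (j + 1) ^ 2) := by positivity
  have hexp : (4 * C ^ 2 + 8 * C / δ ^ 2) * (1 / ((i : ℝ) - j) ^ 2) +
      (4 * C ^ 2 + 8 * C / δ ^ 2) / θ * (J j ^ 2 + J (j + 1) ^ 2) =
      4 * C ^ 2 * (1 / ((i : ℝ) - j) ^ 2) + 8 * C / δ ^ 2 * (1 / ((i : ℝ) - j) ^ 2) +
      4 * C ^ 2 / θ * (J j ^ 2 + J (j + 1) ^ 2) +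
      8 * C / δ ^ 2 / θ * (J j ^ 2 + J (j + 1) ^ 2) := by ring
  rw [hexp]
  have p1 : 0 ≤ 4 * C ^ 2 * (1 / ((i : ℝ) - j) ^ 2) := by positivity
  have p2 : 0 ≤ 8 * C / δ ^ 2 * (1 / ((i : ℝ) - j) ^ 2) := by positivity
  have p3 : 0 ≤ 4 * C ^ 2 / θ * (J j ^ 2 + J (j + 1) ^ 2) := by positivity
  have p4 : 0 ≤ 8 * C / δ ^ 2 / θ * (J j ^ 2 + J (j + 1) ^ 2) := by positivity
  unfold besselKernelSq
  simp only
  rcases le_or_gt |(j : ℝ)| ((2 - δ / 2) * θ) with hj | hj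
  · have hj0 : J j ^ 2 ≤ C / θ := by simpa using (h j hj 0 (by norm_num)).2
    have hj1 : J (j + 1) ^ 2 ≤ C / θ := (h j hj 1 (by norm_num)).2
    have h1 : besselWronskian θ J j i ^ 2 ≤ 4 * C ^ 2 := by
      refine hW.trans ?_
      calc 2 * θ ^ 2 * (C / θ * (J j ^ 2 + J (j + 1) ^ 2)) ≤
            2 * θ ^ 2 * (C / θ * (C / θ + C / θ)) := by gcongr
        _ = 4 * C ^ 2 := by field_simp; ring
    have h2 : besselWronskian θ J j i ^ 2 / ((i : ℝ) - j) ^ 2 ≤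
        4 * C ^ 2 * (1 / ((i : ℝ) - j) ^ 2) := by
      rw [mul_one_div]; gcongr
    linarith
  · have h1 : δ / 2 * θ ≤ |(i : ℝ) - j| := by
      have := abs_sub_abs_le_abs_sub (j : ℝ) i
      rw [abs_sub_comm]
      linarith
    have h2 : (δ / 2 * θ) ^ 2 ≤ ((i : ℝ) - j) ^ 2 := by
      rw [← sq_abs ((i : ℝ) - j)]; gcongr
    have h3 : besselWronskian θ J j i ^ 2 / ((i : ℝ) - j) ^ 2 ≤
        8 * C / δ ^ 2 / θ * (J j ^ 2 + J (j + 1) ^ 2) := by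
      calc _ ≤ 2 * θ ^ 2 * (C / θ * (J j ^ 2 + J (j + 1) ^ 2)) / (δ / 2 * θ) ^ 2 := by gcongr
        _ = _ := by field_simp; ring
    linarith

/-- Pairs at distance at most M lie near one of the end points; M ≤ y - x keeps the near pairs of
each end point inside the interval for the lower bound. Each row of distant pairs costs O(1/(M + 1))
+ O(1/θ), and there are y - x + 1 ≤ 5θ rows. All terms are nonnegative, so an upper bound for every
finite F and a lower bound for one F control the infinite sum. -/
theorem exists_sum_besselKernelSq_bounds {δ : ℝ} (hδ : 0 < δ) (hδ1 : δ ≤ 1) :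
    ∃ C > 0, ∀ ε > 0, ∃ θ₀ ≥ 1, ∀ θ ≥ θ₀, ∀ J, IsBesselSeq θ J → ∀ (x y : ℤ) (M : ℕ),
      |(x : ℝ)| + M ≤ (2 - δ) * θ → |(y : ℝ)| + M ≤ (2 - δ) * θ → (M : ℤ) ≤ y - x →
      (∀ F : Finset ℤ, Disjoint (Finset.Icc x y) F →
        ∑ i ∈ Finset.Icc x y, ∑ j ∈ F, besselKernelSq θ J (i, j) ≤
          1 / Real.pi ^ 2 * ∑ e ∈ Finset.Icc 1 M, 1 / (e : ℝ) +
          (C + 2 * (ε + C * M / θ) * ∑ e ∈ Finset.Icc 1 M, 1 / (e : ℝ) +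
            C * ((y - x + 1) / (M + 1)))) ∧
      ∃ F : Finset ℤ, Disjoint (Finset.Icc x y) F ∧
        1 / Real.pi ^ 2 * ∑ e ∈ Finset.Icc 1 M, 1 / (e : ℝ) -
          (C + 2 * (ε + C * M / θ) * ∑ e ∈ Finset.Icc 1 M, 1 / (e : ℝ)) ≤
        ∑ i ∈ Finset.Icc x y, ∑ j ∈ F, besselKernelSq θ J (i, j) := by
  obtain ⟨C, hC, hnear⟩ := exists_sum_pairs_near hδ hδ1
  obtain ⟨C1, hC1, θ₁, hθ₁, hfar⟩ := exists_besselKernelSq_le hδ hδ1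
  refine ⟨8 * C + 10 * C1, by positivity, fun ε hε => ?_⟩
  obtain ⟨θ₀, hθ₀, hnear⟩ := hnear ε hε
  refine ⟨max θ₀ θ₁, le_max_of_le_left hθ₀, fun θ hθ J hJ x y M hx hy hM => ?_⟩
  have hθ1 : 1 ≤ θ := hθ₀.trans ((le_max_left _ _).trans hθ)
  have hθ0 : 0 < θ := by linarith
  have hfar := hfar θ ((le_max_right _ _).trans hθ) J hJ
  have hL := (hnear θ ((le_max_left _ _).trans hθ) J hJ x M hx).1
  have hR := (hnear θ ((le_max_left _ _).trans hθ) J hJ y M hy).2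
  set H := ∑ e ∈ Finset.Icc 1 M, 1 / (e : ℝ) with hH
  have hH0 : 0 ≤ H := Finset.sum_nonneg fun e _ => by positivity
  have hπ : 1 / Real.pi ^ 2 * H =
      1 / (2 * Real.pi ^ 2) * H + 1 / (2 * Real.pi ^ 2) * H := by field_simp; ring
  have hmono : 2 * (ε + C * M / θ) * H ≤ 2 * (ε + (8 * C + 10 * C1) * M / θ) * H := by
    gcongr; linarith
  rw [abs_le] at hL hR
  have hdisj : Disjoint (leftPairs x M) (rightPairs y M) := by
    rw [Finset.disjoint_left]
    intro p h1 h2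
    rw [mem_leftPairs] at h1
    rw [mem_rightPairs] at h2
    omega
  have hpos := besselKernelSq_nonneg θ J
  constructor
  · intro F hF
    have hne : ∀ i ∈ Finset.Icc x y, ∀ j ∈ F, ¬ (x ≤ j ∧ j ≤ y) := fun i _ j hj h =>
      Finset.disjoint_left.1 hF (Finset.mem_Icc.2 h) hj
    rw [← Finset.sum_product', ← Finset.sum_filter_add_sum_filter_not _
      (fun p : ℤ × ℤ => |p.1 - p.2| ≤ (M : ℤ))]
    have h1 : ∑ p ∈ Finset.Icc x y ×ˢ F with |p.1 - p.2| ≤ (M : ℤ), besselKernelSq θ J p ≤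
        ∑ p ∈ leftPairs x M, besselKernelSq θ J p +
        ∑ p ∈ rightPairs y M, besselKernelSq θ J p := by
      rw [← Finset.sum_union hdisj]
      refine Finset.sum_le_sum_of_subset_of_nonneg (fun p hp => ?_) fun p _ _ => hpos p
      rw [Finset.mem_filter, Finset.mem_product] at hp
      obtain ⟨⟨hp1, hp2⟩, hp3⟩ := hp
      have h3 := hne _ hp1 _ hp2
      rw [Finset.mem_Icc] at hp1
      rw [abs_le] at hp3
      rw [Finset.mem_union, mem_leftPairs, mem_rightPairs]
      omega
    have hrow : ∀ i ∈ Finset.Icc x y, ∑ j ∈ F with ¬ |i - j| ≤ (M : ℤ), besselKernelSq θ J (i, j) ≤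
        C1 * (4 / ((M : ℝ) + 1)) + C1 / θ * 2 := by
      intro i hi
      have hib : |(i : ℝ)| ≤ (2 - δ) * θ := by
        rw [Finset.mem_Icc] at hi
        have e1 : (x : ℝ) ≤ i := by exact_mod_cast hi.1
        have e2 : (i : ℝ) ≤ y := by exact_mod_cast hi.2
        have e3 := M.cast_nonneg (α := ℝ)
        rw [abs_le]
        constructor
        · linarith [neg_abs_le (x : ℝ)]
        · linarith [le_abs_self (y : ℝ)]
      refine (Finset.sum_le_sum fun j hj => hfar i hib j fun h => hne i hi j
        (Finset.mem_filter.1 hj).1 (h ▸ Finset.mem_Icc.1 hi)).trans ?_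
      rw [Finset.sum_add_distrib, ← Finset.mul_sum, ← Finset.mul_sum, Finset.sum_add_distrib]
      have e1 := sum_one_div_sq_sub_le i M (F.filter fun j => ¬ |i - j| ≤ (M : ℤ)) fun j hj =>
        not_le.1 (Finset.mem_filter.1 hj).2
      have e2 := hJ.sum_sq_le (F.filter fun j => ¬ |i - j| ≤ (M : ℤ))
      have e3 := hJ.sum_sq_succ_le (F.filter fun j => ¬ |i - j| ≤ (M : ℤ))
      gcongr
      linarith
    have h2 : ∑ p ∈ Finset.Icc x y ×ˢ F with ¬ |p.1 - p.2| ≤ (M : ℤ), besselKernelSq θ J p ≤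
        (y - x + 1) * (C1 * (4 / ((M : ℝ) + 1)) + C1 / θ * 2) := by
      rw [Finset.sum_filter, Finset.sum_product]
      simp only [← Finset.sum_filter]
      refine (Finset.sum_le_sum hrow).trans (le_of_eq ?_)
      rw [Finset.sum_const, Int.card_Icc, nsmul_eq_mul]
      have : (((y + 1 - x).toNat : ℕ) : ℤ) = y - x + 1 := by omega
      have e1 : (((y + 1 - x).toNat : ℕ) : ℝ) = (y : ℝ) - x + 1 := by
        exact_mod_cast congrArg (Int.cast : ℤ → ℝ) this
      rw [e1]
    have hyx0 : (0 : ℝ) ≤ (y : ℝ) - x + 1 := by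
      have : (0 : ℤ) ≤ y - x + 1 := by omega
      exact_mod_cast this
    have hyx : ((y : ℝ) - x + 1) ≤ 5 * θ := by
      have e3 := M.cast_nonneg (α := ℝ)
      have e4 : |(y : ℝ)| ≤ 2 * θ := by nlinarith
      have e5 : |(x : ℝ)| ≤ 2 * θ := by nlinarith
      linarith [le_abs_self (y : ℝ), neg_abs_le (x : ℝ)]
    have h3 : ((y : ℝ) - x + 1) * (C1 * (4 / ((M : ℝ) + 1)) + C1 / θ * 2) ≤
        (8 * C + 10 * C1) * ((y - x + 1) / (M + 1)) + 10 * C1 := by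
      have e1 : ((y : ℝ) - x + 1) * (C1 / θ * 2) ≤ 5 * θ * (C1 / θ * 2) := by gcongr
      have e2 : 5 * θ * (C1 / θ * 2) = 10 * C1 := by field_simp; ring
      have e3 : 0 ≤ ((y : ℝ) - x + 1) / (M + 1) := by positivity
      have e4 : ((y : ℝ) - x + 1) * (C1 * (4 / ((M : ℝ) + 1))) =
        4 * C1 * (((y : ℝ) - x + 1) / (M + 1)) := by ring
      have e5 : 0 ≤ C1 * (((y : ℝ) - x + 1) / (M + 1)) := by positivity
      have e6 : 0 ≤ C * (((y : ℝ) - x + 1) / (M + 1)) := by positivity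
      linarith
    linarith [hL.2, hR.2]
  · refine ⟨Finset.Ico (x - M) x ∪ Finset.Ioc y (y + M), ?_, ?_⟩
    · rw [Finset.disjoint_left]
      intro i hi h
      rw [Finset.mem_union, Finset.mem_Ico, Finset.mem_Ioc] at h
      rw [Finset.mem_Icc] at hi
      omega
    · have h1 : ∑ p ∈ leftPairs x M, besselKernelSq θ J p +
          ∑ p ∈ rightPairs y M, besselKernelSq θ J p ≤ ∑ i ∈ Finset.Icc x y,
          ∑ j ∈ Finset.Ico (x - M) x ∪ Finset.Ioc y (y + M), besselKernelSq θ J (i, j) := by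
        rw [← Finset.sum_union hdisj, ← Finset.sum_product']
        refine Finset.sum_le_sum_of_subset_of_nonneg (fun p hp => ?_) fun p _ _ => hpos p
        rw [Finset.mem_union, mem_leftPairs, mem_rightPairs] at hp
        rw [Finset.mem_product, Finset.mem_union, Finset.mem_Ico, Finset.mem_Ioc, Finset.mem_Icc]
        omega
      linarith [hL.1, hR.1]

/-! ### Assembly: real θ, then complex θ. -/

theorem besselKernel_ofReal_sq {i j : ℤ} (hij : i ≠ j) (θ : ℝ) :
    besselKernel i j (θ : ℂ) ^ 2 =
      ((besselKernelSq θ (fun k => (besselJ k (2 * (θ : ℂ))).re) (i, j) : ℝ) : ℂ) := by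
  have hre : ∀ k, besselJ k (2 * (θ : ℂ)) = (((besselJ k (2 * (θ : ℂ))).re : ℝ) : ℂ) := fun k =>
    Complex.ext (by simp) (by simp [besselJ_ofReal_im])
  rw [besselKernel, if_neg hij, hre i, hre (i + 1), hre j, hre (j + 1), besselKernelSq,
    besselWronskian]
  push_cast
  rw [div_pow]

theorem exists_hasSum_poissonizedVariance (x y : ℤ) (θ : ℝ) :
    ∃ v : ℝ, poissonizedVariance x y θ = v ∧
      HasSum (fun j : {j : ℤ // j ∉ Finset.Icc x y} => ∑ i ∈ Finset.Icc x y,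
        besselKernelSq θ (fun k => (besselJ k (2 * (θ : ℂ))).re) (i, j)) v := by
  have h : HasSum (fun j : {j : ℤ // j ∉ Finset.Icc x y} => ((∑ i ∈ Finset.Icc x y,
      besselKernelSq θ (fun k => (besselJ k (2 * (θ : ℂ))).re) (i, j) : ℝ) : ℂ))
      (poissonizedVariance x y θ) := by
    have := hasSum_sum fun i (hi : i ∈ Finset.Icc x y) =>
      (summable_sq_besselKernel (θ : ℂ) i hi).hasSum
    refine this.congr_fun fun j => ?_
    rw [Complex.ofReal_sum]
    exact Finset.sum_congr rfl fun i hi =>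
      (besselKernel_ofReal_sq (i := i) (j := j) (fun h => j.2 (h ▸ hi)) θ).symm
  obtain ⟨v, hv⟩ := Complex.summable_ofReal.1 h.summable
  exact ⟨v, h.unique (Complex.hasSum_ofReal.2 hv), hv⟩

theorem sum_Icc_one_div_bounds (M : ℕ) :
    Real.log (M + 1) ≤ ∑ e ∈ Finset.Icc 1 M, 1 / (e : ℝ) ∧
      ∑ e ∈ Finset.Icc 1 M, 1 / (e : ℝ) ≤ 1 + Real.log M := by
  have h : ∑ e ∈ Finset.Icc 1 M, 1 / (e : ℝ) = (harmonic M : ℝ) := by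
    rw [harmonic_eq_sum_Icc]
    push_cast
    exact Finset.sum_congr rfl fun e _ => one_div _
  rw [h]
  exact ⟨by exact_mod_cast log_add_one_le_harmonic M, harmonic_le_one_add_log M⟩

/-- For real `θ`, the variance is `log (y - x) / π²` up to lower order, uniformly over the bulk. -/
theorem exists_abs_variance_sub_le {δ τ : ℝ} (hδ : 0 < δ) (hδ1 : δ ≤ 1) (hτ : 0 < τ) :
    ∃ A : ℝ, ∃ θ₀ ≥ 1, ∀ θ ≥ θ₀, ∀ x y : ℤ, |(x : ℝ)| ≤ (2 - 2 * δ) * θ →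
      |(y : ℝ)| ≤ (2 - 2 * δ) * θ → A ≤ (y : ℝ) - x →
      ∃ v : ℝ, poissonizedVariance x y θ = v ∧
        |v - Real.log ((y : ℝ) - x) / Real.pi ^ 2| ≤ A + 4 * τ * Real.log ((y : ℝ) - x) := by
  obtain ⟨C, hC, hbd⟩ := exists_sum_besselKernelSq_bounds hδ hδ1
  obtain ⟨θ₀, hθ₀, hbd⟩ := hbd τ hτ
  -- With M ≈ ηD and D ≤ 4θ, the first bound keeps the window inside the bulk (M ≤ δθ) and the
  -- second gives CM/θ ≤ τ. Since η is fixed, passing from M to D changes the logarithm by O(1).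
  set η : ℝ := min (δ / 4) (τ / (4 * C)) with hη
  have hη0 : 0 < η := lt_min (by positivity) (by positivity)
  have hηδ : η ≤ δ / 4 := min_le_left _ _
  have hητ : 4 * C * η ≤ τ := by
    have : η ≤ τ / (4 * C) := min_le_right _ _
    rwa [le_div_iff₀ (by positivity), mul_comm] at this
  have hη1 : η ≤ 1 := by linarith
  set B : ℝ := 1 - Real.log η with hB
  have hlogη : Real.log η ≤ 0 := Real.log_nonpos hη0.le hη1
  have hB0 : 0 ≤ B := by linarith
  -- The terms account for the bounded errors, the distant pairs, the relative error applied to B,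
  -- the gap between H and log D, and the requirement D ≥ 1/η that makes M at least 1.
  refine ⟨C + C * (2 / η) + 4 * τ * B + B + 1 / η, θ₀, hθ₀, fun θ hθ x y hx hy hA => ?_⟩
  have hθ0 : 0 < θ := by linarith [hθ₀.trans hθ]
  obtain ⟨v, hv, hsum⟩ := exists_hasSum_poissonizedVariance x y θ
  refine ⟨v, hv, ?_⟩
  set J : ℤ → ℝ := fun k => (besselJ k (2 * (θ : ℂ))).re
  set D : ℝ := (y : ℝ) - x with hD
  have hp1 : 0 ≤ C * (2 / η) := by positivity
  have hp2 : 0 ≤ 4 * τ * B := by positivity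
  have hDη : 1 / η ≤ D := by linarith
  have hηD : 1 ≤ η * D := by rwa [div_le_iff₀ hη0, mul_comm] at hDη
  have hD1 : 1 ≤ D := (one_le_one_div hη0 hη1).trans hDη
  have hD4 : D ≤ 4 * θ := by
    have := le_abs_self (y : ℝ)
    have := neg_abs_le (x : ℝ)
    nlinarith
  set M : ℕ := ⌊η * D⌋₊ with hM
  have hM1 : 1 ≤ M := Nat.one_le_floor_iff _ |>.2 hηD
  have hMle : (M : ℝ) ≤ η * D := Nat.floor_le (by positivity)
  have hMlt : η * D < (M : ℝ) + 1 := Nat.lt_floor_add_one _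
  have hMδ : (M : ℝ) ≤ δ * θ := by nlinarith
  have hMD : (M : ℝ) ≤ D := by nlinarith
  have hMD' : (M : ℤ) ≤ y - x := by
    have : ((M : ℤ) : ℝ) ≤ ((y - x : ℤ) : ℝ) := by push_cast; exact hMD
    exact_mod_cast this
  obtain ⟨hup, F, hF, hlow⟩ := hbd θ hθ J (isBesselSeq_besselJ θ) x y M
    (by linarith) (by linarith) hMD'
  set H := ∑ e ∈ Finset.Icc 1 M, 1 / (e : ℝ) with hH
  obtain ⟨hH1, hH2⟩ := sum_Icc_one_div_bounds M
  rw [← hH] at hH1 hH2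
  have hMpos : (0 : ℝ) < M := by exact_mod_cast hM1
  have hlog1 : Real.log D + Real.log η ≤ H := by
    rw [add_comm, ← Real.log_mul hη0.ne' (by positivity)]
    exact (Real.log_le_log (by positivity) hMlt.le).trans hH1
  have hlog2 : H ≤ 1 + Real.log D := hH2.trans (by
    have := Real.log_le_log hMpos hMD
    linarith)
  have hlogD : 0 ≤ Real.log D := Real.log_nonneg hD1
  have hH0 : 0 ≤ H := Finset.sum_nonneg fun e _ => by positivity
  have herr : 2 * (τ + C * M / θ) * H ≤ 4 * τ * (B + Real.log D) := by
    have h1 : C * M / θ ≤ τ := by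
      rw [div_le_iff₀ hθ0]
      have : C * (M : ℝ) ≤ C * (η * (4 * θ)) := by
        gcongr
        exact hMle.trans (by gcongr)
      nlinarith
    have h2 : H ≤ B + Real.log D := by linarith
    calc 2 * (τ + C * M / θ) * H ≤ 2 * (τ + τ) * (B + Real.log D) := by gcongr
      _ = 4 * τ * (B + Real.log D) := by ring
  have hratio : C * ((y - x + 1) / (M + 1)) ≤ C * (2 / η) := by
    gcongr C * ?_
    rw [div_le_div_iff₀ (by positivity) hη0, ← hD]
    linarith
  have hπ1 : 1 / Real.pi ^ 2 ≤ 1 := by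
    rw [div_le_one (by positivity)]
    nlinarith [Real.pi_gt_three]
  have hπ0 : 0 ≤ 1 / Real.pi ^ 2 := by positivity
  have hHD : |1 / Real.pi ^ 2 * H - Real.log D / Real.pi ^ 2| ≤ B := by
    have h1 : 1 / Real.pi ^ 2 * H - Real.log D / Real.pi ^ 2 =
        1 / Real.pi ^ 2 * (H - Real.log D) := by ring
    have h2 : |H - Real.log D| ≤ B := by rw [abs_le]; constructor <;> linarith
    rw [h1, abs_mul, abs_of_nonneg hπ0]
    calc _ ≤ 1 * B := by gcongr
      _ = B := one_mul B
  have hvup : v ≤ 1 / Real.pi ^ 2 * H + (C + 2 * (τ + C * M / θ) * H +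
      C * ((y - x + 1) / (M + 1))) := by
    refine hasSum_le_of_sum_le hsum fun s => ?_
    have hd : Disjoint (Finset.Icc x y) (s.map (Function.Embedding.subtype _)) := by
      rw [Finset.disjoint_left]
      intro i hi hi'
      obtain ⟨j, -, rfl⟩ := Finset.mem_map.1 hi'
      exact j.2 hi
    have := hup _ hd
    rwa [Finset.sum_comm, Finset.sum_map] at this
  have hvlow : 1 / Real.pi ^ 2 * H - (C + 2 * (τ + C * M / θ) * H) ≤ v := by
    refine hlow.trans ?_
    have := sum_le_hasSum (F.subtype fun j => j ∉ Finset.Icc x y)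
      (fun j _ => Finset.sum_nonneg fun i _ => besselKernelSq_nonneg θ J _) hsum
    have hmem : ∀ j ∈ F, j ∉ Finset.Icc x y := fun j hj hj' => Finset.disjoint_left.1 hF hj' hj
    rwa [Finset.sum_subtype_of_mem (fun j : ℤ => ∑ i ∈ Finset.Icc x y, besselKernelSq θ J (i, j))
      hmem, Finset.sum_comm] at this
  have hη2 : 0 < 1 / η := by positivity
  rw [abs_le] at hHD ⊢
  constructor <;> linarith

theorem mainTheorem2 :
    ∃ γ : ℝ, 0 < γ ∧
      ∀ a ∈ Set.Ioo (-2 : ℝ) 2, ∀ b ∈ Set.Ioo (-2 : ℝ) 2, ∀ x y : ℕ → ℤ,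
        Filter.Tendsto (fun n : ℕ => (x n : ℝ) / Real.sqrt n) Filter.atTop (nhds a) →
        Filter.Tendsto (fun n : ℕ => (y n : ℝ) / Real.sqrt n) Filter.atTop (nhds b) →
        Filter.Tendsto (fun n : ℕ => y n - x n) Filter.atTop Filter.atTop →
        (∀ (n : ℕ) (θ : ℂ), ∀ i ∈ Finset.Icc (x n) (y n),
          Summable fun j : {j : ℤ // j ∉ Finset.Icc (x n) (y n)} => besselKernel i j θ ^ 2) ∧
        ∀ ε : ℝ, 0 < ε → ∃ N : ℕ, ∀ n : ℕ, N ≤ n → ∀ θ : ℂ,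
          ‖poissonizedVariance (x n) (y n) θ / ((Real.log ((y n : ℝ) - (x n : ℝ)) : ℝ) : ℂ)
              - 1 / (Real.pi : ℂ) ^ 2‖
            * Real.exp (-γ * ‖((Real.sqrt n : ℝ) : ℂ) - θ‖) ≤ ε := by
  -- The rate 9 is the 8 of the Lipschitz estimate plus 1 to absorb its linear factor, through r
  -- exp(-r) ≤ 1.
  refine ⟨9, by norm_num, fun a ha b hb x y hx hy hxy => ⟨fun n θ i hi =>
    summable_sq_besselKernel θ i hi, fun ε hε => ?_⟩⟩
  have ha' : |a| < 2 := abs_lt.2 ha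
  have hb' : |b| < 2 := abs_lt.2 hb
  set δ : ℝ := min 1 (min ((2 - |a|) / 4) ((2 - |b|) / 4)) with hδ
  have hδ0 : 0 < δ := lt_min one_pos (lt_min (by linarith) (by linarith))
  have hδ1 : δ ≤ 1 := min_le_left _ _
  have hδa : |a| < 2 - 2 * δ := by
    have : δ ≤ (2 - |a|) / 4 := (min_le_right _ _).trans (min_le_left _ _)
    linarith
  have hδb : |b| < 2 - 2 * δ := by
    have : δ ≤ (2 - |b|) / 4 := (min_le_right _ _).trans (min_le_right _ _)
    linarith
  -- Of six shares of ε, four go to the relative error 4τ, one to A divided by the logarithm, and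
  -- one to the passage from √n to complex θ.
  have hτ : 0 < ε / 6 := by positivity
  obtain ⟨A, θ₀, hθ₀, hvar⟩ := exists_abs_variance_sub_le hδ0 hδ1 hτ
  have hsqrt : Filter.Tendsto (fun n : ℕ => Real.sqrt n) Filter.atTop Filter.atTop :=
    Real.tendsto_sqrt_atTop.comp tendsto_natCast_atTop_atTop
  have hD : Filter.Tendsto (fun n : ℕ => (y n : ℝ) - x n) Filter.atTop Filter.atTop := by
    have := tendsto_intCast_atTop_atTop (R := ℝ) |>.comp hxy
    refine this.congr fun n => ?_
    simp
  have hlog := Real.tendsto_log_atTop.comp hD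
  have hev : ∀ᶠ n : ℕ in Filter.atTop, ∀ θ : ℂ,
      ‖poissonizedVariance (x n) (y n) θ / ((Real.log ((y n : ℝ) - (x n : ℝ)) : ℝ) : ℂ)
        - 1 / (Real.pi : ℂ) ^ 2‖ * Real.exp (-9 * ‖((Real.sqrt n : ℝ) : ℂ) - θ‖) ≤ ε := by
    filter_upwards [hx.abs.eventually_le_const hδa, hy.abs.eventually_le_const hδb,
      hsqrt.eventually_ge_atTop θ₀, hD.eventually_ge_atTop A,
      hlog.eventually_ge_atTop 1, hlog.eventually_ge_atTop (A / (ε / 6)),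
      hlog.eventually_ge_atTop (4 / (ε / 6))] with n h1 h2 h3 h4 h5 h6 h7 θ
    simp only [Function.comp] at h5 h6 h7
    have hr0 : 0 < Real.sqrt n := by linarith [hθ₀.trans h3]
    rw [abs_div, abs_of_pos hr0, div_le_iff₀ hr0] at h1 h2
    obtain ⟨v, hv, hle⟩ := hvar _ h3 (x n) (y n) h1 h2 h4
    have hcx := norm_poissonizedVariance_sub_le (x n) (y n) (Real.sqrt n) θ
    rw [hv] at hcx
    set ℓ := Real.log ((y n : ℝ) - x n) with hℓ
    set r := ‖((Real.sqrt n : ℝ) : ℂ) - θ‖ with hr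
    have hℓ0 : 0 < ℓ := by linarith
    rw [div_le_iff₀ hτ] at h6 h7
    have hreal : ‖((v : ℝ) : ℂ) / (ℓ : ℂ) - 1 / (Real.pi : ℂ) ^ 2‖ ≤ 5 * (ε / 6) := by
      have e1 : ((v : ℝ) : ℂ) / (ℓ : ℂ) - 1 / (Real.pi : ℂ) ^ 2 =
          (((v - ℓ / Real.pi ^ 2) / ℓ : ℝ) : ℂ) := by
        have : (ℓ : ℂ) ≠ 0 := by exact_mod_cast hℓ0.ne'
        have : (Real.pi : ℂ) ≠ 0 := by exact_mod_cast Real.pi_ne_zero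
        push_cast
        field_simp
      rw [e1, Complex.norm_real, Real.norm_eq_abs, abs_div, abs_of_pos hℓ0, div_le_iff₀ hℓ0]
      linarith
    have hexp1 : Real.exp (-9 * r) ≤ 1 := Real.exp_le_one_iff.2 (by
      have : 0 ≤ r := norm_nonneg _
      linarith)
    have hexp2 : 4 * Real.exp (8 * r) * r * Real.exp (-9 * r) ≤ 4 := by
      have e1 : 4 * Real.exp (8 * r) * r * Real.exp (-9 * r) = 4 * (r * Real.exp (-r)) := by
        rw [show -r = 8 * r + -9 * r by ring, Real.exp_add]; ring
      have e2 : r * Real.exp (-r) ≤ 1 := by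
        rw [Real.exp_neg, ← div_eq_mul_inv, div_le_one (Real.exp_pos _)]
        linarith [Real.add_one_le_exp r]
      linarith
    have hsplit : poissonizedVariance (x n) (y n) θ / (ℓ : ℂ) - 1 / (Real.pi : ℂ) ^ 2 =
        (poissonizedVariance (x n) (y n) θ - v) / (ℓ : ℂ) +
          (((v : ℝ) : ℂ) / (ℓ : ℂ) - 1 / (Real.pi : ℂ) ^ 2) := by ring
    have hcx' : ‖(poissonizedVariance (x n) (y n) θ - v) / (ℓ : ℂ)‖ * Real.exp (-9 * r) ≤
        ε / 6 := by
      rw [norm_div, Complex.norm_real, Real.norm_of_nonneg hℓ0.le, div_mul_eq_mul_div,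
        div_le_iff₀ hℓ0]
      refine (mul_le_mul_of_nonneg_right hcx (Real.exp_pos _).le).trans (hexp2.trans ?_)
      linarith
    calc _ ≤ (‖(poissonizedVariance (x n) (y n) θ - v) / (ℓ : ℂ)‖ +
          ‖((v : ℝ) : ℂ) / (ℓ : ℂ) - 1 / (Real.pi : ℂ) ^ 2‖) * Real.exp (-9 * r) := by
          rw [hsplit]; gcongr; exact norm_add_le _ _
      _ ≤ ε / 6 + 5 * (ε / 6) * 1 := by
          rw [add_mul]
          exact add_le_add hcx' (mul_le_mul hreal hexp1 (Real.exp_pos _).le (by positivity))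
      _ = ε := by ring
  exact Filter.eventually_atTop.1 hev
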